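/- Let $H$ be a real separable Hilbert space and let $A:D(A)\subset H\to H$ be a negative definite self-adjoint operator such that $(-A)^{-1+\delta}$ is of trace class for some $\delta\in(0,1)$. For $t>0$ put $Q_t=-\frac12A^{-1}(I-e^{2tA})$, let $\mu=N(0,Q)$ be the Gaussian measure on $H$ with mean $0$ and covariance $Q=-\frac12A^{-1}$, and let $$R_tf(x)=\int_H f(y)\,N(e^{tA}x,Q_t)(dy),\qquad x\in H,\ t>0,$$ be the Ornstein–Uhlenbeck semigroup. Let $L=L_2$ with domain $D(L_2)$ be the infinitesimal generator of $(R_t)$ on $L^2(H,\mu)$, let $\|\cdot\|_0$ be the $\mu$-essential supremum norm, and let $C_0$ be the smallest constant such that $|DR_t\varphi(x)|\le C_0t^{-1/2}\|\varphi\|_0$ for all $t>0$, all $x\in H$ and all bounded Borel $\varphi:H\to\mathbb R$. Write $C^1_b(H)$ for the bounded, continuously Fréchet differentiable real functions on $H$ with bounded derivative. Let $f,f_n:H\to\mathbb R$ and $B,B_n:H\to H$ ($n\ge1$) be bounded Borel maps such that $f_n\to f$ and $B_n\to B$ $\mu$-a.e., and $\|f_n\|_0\le M$, $\|B_n\|_0\le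 M$ for all $n$ and some constant $M$. Let $\lambda>0$ with $\lambda\ge 4\|B\|_0^2C_0^2$, and let $u,u_n\in C^1_b(H)\cap D(L_2)$ be solutions of $$\lambda u-Lu-\langle B,Du\rangle=f,\qquad \lambda u_n-Lu_n-\langle B_n,Du_n\rangle=f_n\qquad(\mu\text{-a.e.}).$$ Then, for every $x\in H$ (not only for $\mu$-a.e. $x$), as $n\to\infty$, $$u_n(x)\to u(x)\quad\text{and}\quad Du_n(x)\to Du(x)\ \text{ in } H.$$ -/

import Mathlib

open MeasureTheory Filter Topology
open scoped ENNReal RealInnerProductSpace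

noncomputable section

namespace OU

section Operators

variable {H : Type*} [NormedAddCommGroup H] [InnerProductSpace ℝ H]

/-- `T = (s - A)⁻¹`: the bounded operator `T` is a two-sided inverse of `s - A : D(A) → H`.
The first condition says that `T y ∈ D(A)` and `A (T y) = s T y - y`. -/
def IsResolvent (A : H →ₗ.[ℝ] H) (s : ℝ) (T : H →L[ℝ] H) : Prop :=
  (∀ y : H, (T y, s • T y - y) ∈ A.graph) ∧ ∀ x : A.domain, T (s • (x : H) - A x) = x

open Classical in
/-- The resolvent `(s - A)⁻¹` (zero if `s - A` has no bounded inverse). -/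
def resolventOp (A : H →ₗ.[ℝ] H) (s : ℝ) : H →L[ℝ] H :=
  if h : ∃ T : H →L[ℝ] H, IsResolvent A s T then h.choose else 0

/-- `A` is negative definite. -/
def IsNegDef (A : H →ₗ.[ℝ] H) : Prop :=
  ∀ x : A.domain, (x : H) ≠ 0 → ⟪A x, (x : H)⟫ < 0

/-- The fractional power `(-A)^(-α)`, `0 < α < 1`, by the Balakrishnan formula
`(-A)^(-α) = (sin (π α) / π) ∫₀^∞ s^(-α) (s - A)⁻¹ ds`. -/
def negFracPow (A : H →ₗ.[ℝ] H) (α : ℝ) : H →L[ℝ] H :=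
  (Real.sin (Real.pi * α) / Real.pi) •
    ∫ s in Set.Ioi (0 : ℝ), s ^ (-α) • resolventOp A s

/-- Trace class (nuclear) operators on a Hilbert space: `T x = ∑ₙ ⟨aₙ, x⟩ bₙ` with
`∑ₙ |aₙ| |bₙ| < ∞`. -/
def IsTraceClass (T : H →L[ℝ] H) : Prop :=
  ∃ a b : ℕ → H, Summable (fun n => ‖a n‖ * ‖b n‖) ∧
    ∀ x : H, HasSum (fun n => ⟪a n, x⟫ • b n) (T x)

/-- The operator `(-A)^(-α)` is of trace class. The first condition, absolute convergence of the
integral in operator norm, says that `(-A)^(-α)` is a bounded operator: for self-adjoint `A ≤ 0`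
it holds exactly when `0` is in the resolvent set of `A`. -/
def IsTraceClassNegPow (A : H →ₗ.[ℝ] H) (α : ℝ) : Prop :=
  IntegrableOn (fun s : ℝ => s ^ (-α) • resolventOp A s) (Set.Ioi 0) ∧
    IsTraceClass (negFracPow A α)

/-- `(S t)`, `t ≥ 0`, is the strongly continuous semigroup whose infinitesimal generator is `A`
(with exactly the domain of `A`). The values `S t` for `t < 0` play no role. -/
structure IsSemigroupGeneratedBy (A : H →ₗ.[ℝ] H) (S : ℝ → H →L[ℝ] H) : Prop where
  zero : S 0 = ContinuousLinearMap.id ℝ H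
  add : ∀ s t : ℝ, 0 ≤ s → 0 ≤ t → S (s + t) = (S s).comp (S t)
  tendsto : ∀ x : H, Tendsto (fun t => S t x) (𝓝[>] 0) (𝓝 x)
  generator : ∀ x y : H, (x, y) ∈ A.graph ↔
    Tendsto (fun t : ℝ => t⁻¹ • (S t x - x)) (𝓝[>] 0) (𝓝 y)

open Classical in
/-- The semigroup `e^{tA}`, `t ≥ 0`, generated by `A` (zero if `A` is not a generator). -/
def expOp (A : H →ₗ.[ℝ] H) : ℝ → H →L[ℝ] H :=
  if h : ∃ S : ℝ → H →L[ℝ] H, IsSemigroupGeneratedBy A S then h.choose else 0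

/-- `Q = -(1/2) A⁻¹`. -/
def covQ (A : H →ₗ.[ℝ] H) : H →L[ℝ] H := (1 / 2 : ℝ) • resolventOp A 0

/-- `Q_t = -(1/2) A⁻¹ (I - e^{2tA})`. -/
def covQt (A : H →ₗ.[ℝ] H) (t : ℝ) : H →L[ℝ] H :=
  (1 / 2 : ℝ) • (resolventOp A 0).comp (ContinuousLinearMap.id ℝ H - expOp A (2 * t))

end Operators

section Gaussian

variable {H : Type*} [NormedAddCommGroup H] [InnerProductSpace ℝ H] [MeasurableSpace H]

/-- `ν` is the Gaussian measure with mean `m` and covariance operator `Q`, i.e. the Borel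
probability measure with characteristic function `h ↦ exp (i⟨m, h⟩ - ⟨Q h, h⟩ / 2)`. -/
def IsNormalLaw (m : H) (Q : H →L[ℝ] H) (ν : Measure H) : Prop :=
  IsProbabilityMeasure ν ∧ ∀ h : H,
    charFun ν h = Complex.exp ((⟪m, h⟫ : ℂ) * Complex.I - (⟪Q h, h⟫ : ℂ) / 2)

open Classical in
/-- The Gaussian measure `N(m, Q)` (zero if there is none). -/
def normalLaw (m : H) (Q : H →L[ℝ] H) : Measure H :=
  if h : ∃ ν : Measure H, IsNormalLaw m Q ν then h.choose else 0

/-- The invariant measure `μ = N(0, Q)`. -/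
def invMeasure (A : H →ₗ.[ℝ] H) : Measure H := normalLaw 0 (covQ A)

/-- The Ornstein-Uhlenbeck semigroup `R_t f (x) = ∫ f(y) N(e^{tA}x, Q_t)(dy)`. -/
def ouSemigroup (A : H →ₗ.[ℝ] H) (t : ℝ) (f : H → ℝ) (x : H) : ℝ :=
  ∫ y, f y ∂(normalLaw (expOp A t x) (covQt A t))

/-- `u ∈ D(L₂)` and `L₂ u = g`, where `L₂` is the infinitesimal generator of `(R_t)` on
`L²(H, μ)`: the difference quotients `(R_t u - u) / t` converge to `g` in `L²(H, μ)` as `t → 0+`.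
The extension of `R_t` from bounded Borel functions to `L²(H, μ)` is given by the same kernel. -/
def HasL2Generator (A : H →ₗ.[ℝ] H) (u g : H → ℝ) : Prop :=
  MemLp u 2 (invMeasure A) ∧ MemLp g 2 (invMeasure A) ∧
    Tendsto (fun t : ℝ => eLpNorm (fun x => t⁻¹ * (ouSemigroup A t u x - u x) - g x) 2
      (invMeasure A)) (𝓝[>] 0) (𝓝 0)

/-- Bounded Borel maps, `B_b(H, E)`. -/
def IsBddBorel {E : Type*} [NormedAddCommGroup E] [MeasurableSpace E] (f : H → E) : Prop :=
  Measurable f ∧ ∃ C : ℝ, ∀ x, ‖f x‖ ≤ C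

/-- The `μ`-essential supremum norm `‖f‖₀` (finite for bounded Borel `f`). -/
def essNorm {E : Type*} [NormedAddCommGroup E] (A : H →ₗ.[ℝ] H) (f : H → E) : ℝ :=
  (eLpNorm f ∞ (invMeasure A)).toReal

variable [CompleteSpace H]

/-- `u ∈ C¹_b(H)`: `u` is continuously differentiable, and `u` and `Du` are bounded. -/
def IsC1b (u : H → ℝ) : Prop :=
  ContDiff ℝ 1 u ∧ ∃ C : ℝ, ∀ x, |u x| ≤ C ∧ ‖gradient u x‖ ≤ C

/-- The smallest constant `C₀ ≥ 0` such that `|D R_t φ (x)| ≤ C₀ t^(-1/2) ‖φ‖₀` for all `t > 0`,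
`x ∈ H` and all bounded Borel `φ : H → ℝ`. -/
def gradConst (A : H →ₗ.[ℝ] H) : ℝ :=
  sInf {C : ℝ | 0 ≤ C ∧ ∀ t : ℝ, 0 < t → ∀ φ : H → ℝ, IsBddBorel φ → ∀ x : H,
    ‖gradient (ouSemigroup A t φ) x‖ ≤ C * t ^ (-(1 / 2) : ℝ) * essNorm A φ}

/-- `u ∈ C¹_b(H) ∩ D(L₂)` is a solution of `lam u - L₂ u - ⟨B, Du⟩ = f` (`μ`-a.e.). -/
def IsKolmogorovSolution (A : H →ₗ.[ℝ] H) (lam : ℝ) (B : H → H) (f u : H → ℝ) : Prop :=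
  IsC1b u ∧ ∃ Lu : H → ℝ, HasL2Generator A u Lu ∧
    ∀ᵐ x ∂(invMeasure A), lam * u x - Lu x - ⟪B x, gradient u x⟫ = f x

end Gaussian

end OU

end

set_option linter.unusedSectionVars false

namespace OU

/-! ### Gaussian measures: marginals, the Cameron-Martin formula, integration by parts. -/

section GaussianLaw

variable {H : Type*} [NormedAddCommGroup H] [InnerProductSpace ℝ H] [CompleteSpace H]
  [SecondCountableTopology H] [MeasurableSpace H] [BorelSpace H]
  {m : H} {C : H →L[ℝ] H} {ν ν' : Measure H}

/-! Put `g = f + ⟨B, Du⟩` and `gₙ = fₙ + ⟨Bₙ, Duₙ⟩`. Then `lam u - Lu = g`, and `u` is the Laplace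
transform `u(x) = ∫ e^{-lam s} R_s g(x) ds`, with a similar formula for `Du`. Both hold at every
`x`, because for `s > 0` the kernel `N(e^{sA}x, Q_s)` is absolutely continuous with respect to `μ`
and integrates `L²(μ)` functions continuously. This follows from Wang's Harnack inequality, that is,
from the Cameron-Martin formula and Cauchy-Schwarz (`IsMehler.harnack`,
`IsMehler.eq_integral_ouSemigroup`, `IsMehler.inner_gradient_eq_integral`). Information valid
`μ`-a.e. thereby yields conclusions at every point.

The functions `Dₙ(x) = |Duₙ(x) - Du(x)|` are then estimated by a contraction. Suppose that `limsup
Dₙ(y) ≤ c` for every `y`. If the `Duₙ` are uniformly bounded, the a.e. convergence of the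
coefficients gives `limsup |gₙ - g| ≤ ‖B‖₀ c` a.e. The Laplace formula for the gradient, the bound
`C₀ s^{-1/2}` and dominated convergence give `limsup Dₙ(x) ≤ θ c` for every `x`, where `θ = ‖B‖₀ C₀
∫ e^{-lam s} s^{-1/2} ds = ‖B‖₀ C₀ (π/lam)^{1/2}`. Since `lam ≥ 4 ‖B‖₀² C₀²`, one has `θ² ≤ π/4 <
1`, and iterating gives `Dₙ → 0`. Then `gₙ → g` a.e., and the Laplace formula gives `uₙ → u`. The
optimal constant `C₀` enters through the first absolute moments of `⟨V_t h, ·⟩`, which a sign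
function turns into a gradient (`IsMehler.integral_abs_inner_V_le`); the part of `|gₙ - g|` above
the level `‖B‖₀ c` is only small in mean square and is handled by Cauchy-Schwarz
(`IsMehler.abs_inner_gradient_le`).

The uniform bound on `Duₙ` does not come from this contraction, as `M` may be large compared with
`lam`. A maximum principle, proved by the energy method with the Dirichlet form of `(R_t)`, gives
`‖uₙ‖₀ ≤ M / lam` whatever the size of the drift (`IsMehler.essNorm_le_div`). Adding a large
multiple `κ uₙ` to both sides of the equation then makes the drift term absorbable
(`IsMehler.norm_gradient_le_of_solution`).

All of this rests on a spectral description of `A`: the trace condition makes `A⁻¹` compact and of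
trace class, so that in an eigenbasis `e^{tA}`, `Q_t` and `μ` are explicit and `R_t` has Mehler's
form `R_t φ(x) = ∫ φ(e^{tA}x + Γ_t y) μ(dy)` (`exists_eigenbasis`, `exists_isMehler`). -/

theorem IsNormalLaw.unique (h : IsNormalLaw m C ν) (h' : IsNormalLaw m C ν') : ν = ν' := by
  have := h.1
  have := h'.1
  exact Measure.ext_of_charFun (funext fun t => by rw [h.2, h'.2])

theorem normalLaw_eq (h : IsNormalLaw m C ν) : normalLaw m C = ν := by
  have hex : ∃ ν : Measure H, IsNormalLaw m C ν := ⟨ν, h⟩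
  unfold normalLaw
  rw [dif_pos hex]
  exact IsNormalLaw.unique hex.choose_spec h

/-- Positivity of the covariance is not part of `IsNormalLaw`; it is forced because a characteristic
function has modulus at most one. -/
theorem IsNormalLaw.inner_nonneg (hν : IsNormalLaw 0 C ν) (v : H) : 0 ≤ ⟪C v, v⟫ := by
  have := hν.1
  have h := norm_charFun_le_one (μ := ν) v
  rw [hν.2 v, inner_zero_left, Complex.norm_exp] at h
  have h2 := Real.exp_le_one_iff.1 h
  simp at h2
  linarith

theorem IsNormalLaw.map_inner (hν : IsNormalLaw 0 C ν) (v : H) :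
    ν.map (fun z => ⟪v, z⟫) = ProbabilityTheory.gaussianReal 0 ⟪C v, v⟫.toNNReal := by
  have := hν.1
  have hm : Measurable fun z : H => ⟪v, z⟫ := by fun_prop
  have : IsProbabilityMeasure (ν.map fun z => ⟪v, z⟫) :=
    Measure.isProbabilityMeasure_map hm.aemeasurable
  refine Measure.ext_of_charFun (funext fun t => ?_)
  rw [ProbabilityTheory.charFun_gaussianReal, charFun_apply_real,
    integral_map hm.aemeasurable (by fun_prop)]
  have h := hν.2 (t • v)
  rw [charFun_apply] at h
  rw [Real.coe_toNNReal _ (hν.inner_nonneg v)]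
  calc _ = ∫ z, Complex.exp ((⟪z, t • v⟫ : ℂ) * Complex.I) ∂ν := by
        congr 1; ext z
        rw [inner_smul_right, real_inner_comm]
        push_cast; ring_nf
    _ = _ := by
        rw [h]
        simp only [map_smul, inner_smul_left, inner_smul_right, inner_zero_left]
        simp
        ring_nf

theorem IsNormalLaw.integral_comp_inner (hν : IsNormalLaw 0 C ν) (v : H) {f : ℝ → ℝ}
    (hf : Measurable f) :
    ∫ z, f ⟪v, z⟫ ∂ν = ∫ r, f r ∂(ProbabilityTheory.gaussianReal 0 ⟪C v, v⟫.toNNReal) := by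
  rw [← hν.map_inner v, integral_map (by fun_prop) hf.aestronglyMeasurable]

theorem IsNormalLaw.memLp_inner (hν : IsNormalLaw 0 C ν) (v : H) (p : ℝ≥0∞) (hp : p ≠ ∞) :
    MemLp (fun z => ⟪v, z⟫) p ν := by
  have h := ProbabilityTheory.memLp_id_gaussianReal' (μ := 0) (v := ⟪C v, v⟫.toNNReal) p hp
  rw [← hν.map_inner v] at h
  exact (memLp_map_measure_iff (f := fun z => ⟪v, z⟫) (by fun_prop) (by fun_prop)).1 h

theorem IsNormalLaw.integrable_inner (hν : IsNormalLaw 0 C ν) (v : H) :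
    Integrable (fun z => ⟪v, z⟫) ν :=
  memLp_one_iff_integrable.1 (hν.memLp_inner v 1 (by simp))

theorem IsNormalLaw.integral_inner (hν : IsNormalLaw 0 C ν) (v : H) :
    ∫ z, ⟪v, z⟫ ∂ν = 0 := by
  rw [hν.integral_comp_inner v measurable_id']
  exact ProbabilityTheory.integral_id_gaussianReal

theorem IsNormalLaw.integral_inner_sq (hν : IsNormalLaw 0 C ν) (v : H) :
    ∫ z, ⟪v, z⟫ ^ 2 ∂ν = ⟪C v, v⟫ := by
  rw [hν.integral_comp_inner v (f := fun r => r ^ 2) (by fun_prop)]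
  have h := ProbabilityTheory.variance_fun_id_gaussianReal (μ := 0) (v := ⟪C v, v⟫.toNNReal)
  rw [ProbabilityTheory.variance_of_integral_eq_zero (by fun_prop)
    ProbabilityTheory.integral_id_gaussianReal, Real.coe_toNNReal _ (hν.inner_nonneg v)] at h
  simpa using h

theorem IsNormalLaw.integrable_exp_inner (hν : IsNormalLaw 0 C ν) (v : H) :
    Integrable (fun z => Real.exp ⟪v, z⟫) ν := by
  have h := ProbabilityTheory.integrable_exp_mul_gaussianReal (μ := 0) (v := ⟪C v, v⟫.toNNReal) 1
  rw [← hν.map_inner v] at h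
  simpa [Function.comp_def] using (integrable_map_measure (by fun_prop) (by fun_prop)).1 h

theorem IsNormalLaw.integral_exp_inner (hν : IsNormalLaw 0 C ν) (v : H) :
    ∫ z, Real.exp ⟪v, z⟫ ∂ν = Real.exp (⟪C v, v⟫ / 2) := by
  have h := ProbabilityTheory.mgf_gaussianReal (hν.map_inner v) 1
  rw [ProbabilityTheory.mgf, Real.coe_toNNReal _ (hν.inner_nonneg v)] at h
  simpa using h

theorem IsNormalLaw.exp_sub_eq_tilted_density (hν : IsNormalLaw 0 C ν) (v z : H) :
    Real.exp ⟪v, z⟫ / ∫ x, Real.exp ⟪v, x⟫ ∂ν = Real.exp (⟪v, z⟫ - ⟪C v, v⟫ / 2) := by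
  rw [hν.integral_exp_inner, Real.exp_sub]

/-- The **Cameron-Martin formula** for shifts by vectors in the range of the covariance. -/
theorem IsNormalLaw.map_add_eq_tilted (hν : IsNormalLaw 0 C ν)
    (hC : ∀ x y, ⟪C x, y⟫ = ⟪x, C y⟫) (v : H) :
    ν.map (fun z => C v + z) = ν.tilted (fun z => ⟪v, z⟫) := by
  have := hν.1
  have : IsProbabilityMeasure (ν.map fun z => C v + z) :=
    Measure.isProbabilityMeasure_map (by fun_prop)
  have hp : IsProbabilityMeasure (ν.tilted fun z => ⟪v, z⟫) :=
    isProbabilityMeasure_tilted (hν.integrable_exp_inner v)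
  refine Measure.ext_of_charFun (funext fun h => ?_)
  rw [charFun_map_const_add, hν.2 h]
  have hmgf : ProbabilityTheory.mgf (fun z => ⟪h, z⟫) (ν.tilted fun z => ⟪v, z⟫)
      = ProbabilityTheory.mgf id
        (ProbabilityTheory.gaussianReal ⟪C v, h⟫ ⟪C h, h⟫.toNNReal) := by
    ext t
    rw [ProbabilityTheory.mgf_id_gaussianReal, ProbabilityTheory.mgf, integral_exp_tilted]
    have : (fun x => Real.exp (((fun z => ⟪v, z⟫) + fun x => t * ⟪h, x⟫) x))
        = fun x => Real.exp ⟪v + t • h, x⟫ := by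
      ext x; simp [inner_add_left, inner_smul_left]
    rw [this, hν.integral_exp_inner, hν.integral_exp_inner, ← Real.exp_sub,
      Real.coe_toNNReal _ (hν.inner_nonneg h)]
    congr 1
    have : ⟪C h, v⟫ = ⟪C v, h⟫ := by rw [hC, real_inner_comm]
    simp only [map_add, map_smul, inner_add_left, inner_add_right, inner_smul_left,
      inner_smul_right, this]
    simp
    ring
  -- Equality of the real moment generating functions extends by analyticity to the complex argument
  -- `Complex.I`, which yields the characteristic function.
  have hc := ProbabilityTheory.eqOn_complexMGF_of_mgf hmgf.symm (x := Complex.I) (by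
    simp [ProbabilityTheory.integrableExpSet_id_gaussianReal])
  have hg := ProbabilityTheory.complexMGF_id_gaussianReal (μ := ⟪C v, h⟫) (v := ⟪C h, h⟫.toNNReal)
    Complex.I
  rw [charFun_apply]
  rw [hc, ProbabilityTheory.complexMGF, Real.coe_toNNReal _ (hν.inner_nonneg h)] at hg
  have e : ∫ x, Complex.exp ((⟪x, h⟫ : ℂ) * Complex.I) ∂(ν.tilted fun z => ⟪v, z⟫)
      = ∫ x, Complex.exp (Complex.I * (⟪h, x⟫ : ℂ)) ∂(ν.tilted fun z => ⟪v, z⟫) := by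
    congr 1; ext x; rw [mul_comm, real_inner_comm]
  rw [e, hg, ← Complex.exp_add]
  congr 1
  simp
  ring

theorem IsNormalLaw.integral_shift (hν : IsNormalLaw 0 C ν)
    (hC : ∀ x y, ⟪C x, y⟫ = ⟪x, C y⟫) (v : H) {φ : H → ℝ} (hφ : Measurable φ) :
    ∫ z, φ (C v + z) ∂ν = ∫ z, Real.exp (⟪v, z⟫ - ⟪C v, v⟫ / 2) * φ z ∂ν := by
  rw [← integral_map (φ := fun z => C v + z) (by fun_prop) hφ.aestronglyMeasurable,
    hν.map_add_eq_tilted hC, integral_tilted]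
  simp_rw [hν.exp_sub_eq_tilted_density, smul_eq_mul]

theorem IsNormalLaw.lintegral_shift (hν : IsNormalLaw 0 C ν)
    (hC : ∀ x y, ⟪C x, y⟫ = ⟪x, C y⟫) (v : H) {φ : H → ℝ≥0∞} (hφ : Measurable φ) :
    ∫⁻ z, φ (C v + z) ∂ν
      = ∫⁻ z, ENNReal.ofReal (Real.exp (⟪v, z⟫ - ⟪C v, v⟫ / 2)) * φ z ∂ν := by
  rw [← lintegral_map (g := fun z => C v + z) hφ (by fun_prop),
    hν.map_add_eq_tilted hC, lintegral_tilted]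
  simp_rw [hν.exp_sub_eq_tilted_density]

theorem integral_abs_mul_le_sqrt {α : Type*} {mα : MeasurableSpace α} {μ : Measure α} {f g : α → ℝ}
    (hf : MemLp f 2 μ) (hg : MemLp g 2 μ) :
    ∫ x, |f x * g x| ∂μ ≤ √(∫ x, f x ^ 2 ∂μ) * √(∫ x, g x ^ 2 ∂μ) := by
  have h := integral_mul_norm_le_Lp_mul_Lq (μ := μ) (f := f) (g := g) Real.HolderConjugate.two_two
    (by simpa using hf) (by simpa using hg)
  simpa [Real.sqrt_eq_rpow, abs_mul] using h

theorem IsNormalLaw.memLp_exp_inner (hν : IsNormalLaw 0 C ν) (v : H) :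
    MemLp (fun z => Real.exp (⟪v, z⟫ - ⟪C v, v⟫ / 2)) 2 ν := by
  have hm : Measurable fun z => Real.exp (⟪v, z⟫ - ⟪C v, v⟫ / 2) := by fun_prop
  rw [memLp_two_iff_integrable_sq hm.aestronglyMeasurable]
  refine ((hν.integrable_exp_inner ((2 : ℝ) • v)).mul_const (Real.exp (-⟪C v, v⟫))).congr
    (ae_of_all _ fun z => ?_)
  simp only [← Real.exp_add, sq, inner_smul_left]
  congr 1
  simp
  ring

theorem IsNormalLaw.integral_exp_inner_sq (hν : IsNormalLaw 0 C ν) (v : H) :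
    ∫ z, Real.exp (⟪v, z⟫ - ⟪C v, v⟫ / 2) ^ 2 ∂ν = Real.exp ⟪C v, v⟫ := by
  have e : ∀ z, Real.exp (⟪v, z⟫ - ⟪C v, v⟫ / 2) ^ 2
      = Real.exp ⟪(2 : ℝ) • v, z⟫ * Real.exp (-⟪C v, v⟫) := fun z => by
    simp only [← Real.exp_add, sq, inner_smul_left]
    congr 1
    simp
    ring
  simp_rw [e]
  rw [integral_mul_const, hν.integral_exp_inner, ← Real.exp_add]
  congr 1
  simp [inner_smul_left, inner_smul_right]
  ring

/-- The square is expanded using that the density `e` has mean `1`, `e ⟨v, ·⟩` has mean `q = ⟨Cv,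
v⟩` (the shift formula), and `e²` has mean `exp q`. The linear terms cancel, so the density minus
its first-order expansion has `L²` norm of order `q`. -/
theorem IsNormalLaw.integral_exp_remainder_sq (hν : IsNormalLaw 0 C ν)
    (hC : ∀ x y, ⟪C x, y⟫ = ⟪x, C y⟫) (v : H) :
    ∫ z, (Real.exp (⟪v, z⟫ - ⟪C v, v⟫ / 2) - 1 - ⟪v, z⟫) ^ 2 ∂ν
      = Real.exp ⟪C v, v⟫ - 1 - ⟪C v, v⟫ := by
  have := hν.1
  set q := ⟪C v, v⟫ with hq
  have hE := hν.memLp_exp_inner v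
  have hL := hν.memLp_inner v 2 (by simp)
  have iE : Integrable (fun z => Real.exp (⟪v, z⟫ - q / 2)) ν := hE.integrable (by simp)
  have iL := hν.integrable_inner v
  have iEL : Integrable (fun z => Real.exp (⟪v, z⟫ - q / 2) * ⟪v, z⟫) ν := hE.integrable_mul hL
  have iE2 := hE.integrable_sq
  have iL2 := hL.integrable_sq
  have e1 : ∫ z, Real.exp (⟪v, z⟫ - q / 2) ∂ν = 1 := by
    have := hν.integral_shift hC v (φ := fun _ => 1) measurable_const
    simpa using this.symm
  have e2 : ∫ z, Real.exp (⟪v, z⟫ - q / 2) * ⟪v, z⟫ ∂ν = q := by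
    rw [← hν.integral_shift hC v (φ := fun z => ⟪v, z⟫) (by fun_prop)]
    simp_rw [inner_add_right]
    rw [integral_add (integrable_const _) iL, hν.integral_inner, hq, real_inner_comm]
    simp
  have e : ∀ z, (Real.exp (⟪v, z⟫ - q / 2) - 1 - ⟪v, z⟫) ^ 2
      = (Real.exp (⟪v, z⟫ - q / 2) ^ 2 + ⟪v, z⟫ ^ 2) + ((1 + 2 * ⟪v, z⟫)
        - (2 * Real.exp (⟪v, z⟫ - q / 2) + 2 * (Real.exp (⟪v, z⟫ - q / 2) * ⟪v, z⟫))) := fun z => by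
    ring
  have iA : Integrable (fun z => Real.exp (⟪v, z⟫ - q / 2) ^ 2 + ⟪v, z⟫ ^ 2) ν := iE2.add iL2
  simp_rw [e]
  rw [integral_add iA, integral_add iE2 iL2, integral_sub, integral_add, integral_add,
    integral_const_mul, integral_const_mul, integral_const_mul, hν.integral_exp_inner_sq,
    hν.integral_inner_sq, e1, e2, hν.integral_inner]
  · simp; ring
  · exact iE.const_mul 2
  · exact iEL.const_mul 2
  · exact integrable_const _
  · exact iL.const_mul 2
  · exact (integrable_const _).add (iL.const_mul 2)
  · exact (iE.const_mul 2).add (iEL.const_mul 2)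
  · exact ((integrable_const _).add (iL.const_mul 2)).sub ((iE.const_mul 2).add (iEL.const_mul 2))

theorem exp_sub_one_sub_id_le_sq {q : ℝ} (h0 : 0 ≤ q) (h1 : q ≤ 1) :
    Real.exp q - 1 - q ≤ q ^ 2 := by
  have := Real.abs_exp_sub_one_sub_id_le (x := q) (by rwa [abs_of_nonneg h0])
  exact (le_abs_self _).trans this

/-- By Cameron-Martin the shift moves onto the density, where the expansion is smooth, so `φ` need
only be bounded and Borel; Cauchy-Schwarz finishes. The error is quadratic in the Cameron-Martin
norm of the shift, which later gives Fréchet differentiability of `R_t φ`. -/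
theorem IsNormalLaw.abs_integral_shift_sub_le (hν : IsNormalLaw 0 C ν)
    (hC : ∀ x y, ⟪C x, y⟫ = ⟪x, C y⟫) (v : H) (hv : ⟪C v, v⟫ ≤ 1) {φ : H → ℝ} (hφ : Measurable φ)
    {K : ℝ} (hK : ∀ x, |φ x| ≤ K) :
    |∫ z, φ (C v + z) ∂ν - ∫ z, φ z ∂ν - ∫ z, φ z * ⟪v, z⟫ ∂ν| ≤ K * ⟪C v, v⟫ := by
  have := hν.1
  have hK0 : 0 ≤ K := (abs_nonneg _).trans (hK 0)
  have hφ2 : MemLp φ 2 ν :=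
    MemLp.of_bound hφ.aestronglyMeasurable K (ae_of_all _ hK)
  have hE := hν.memLp_exp_inner v
  have hL := hν.memLp_inner v 2 (by simp)
  have hR : MemLp (fun z => Real.exp (⟪v, z⟫ - ⟪C v, v⟫ / 2) - 1 - ⟪v, z⟫) 2 ν :=
    (hE.sub (memLp_const 1)).sub hL
  rw [hν.integral_shift hC v hφ, ← integral_sub, ← integral_sub]
  · calc |∫ z, (Real.exp (⟪v, z⟫ - ⟪C v, v⟫ / 2) * φ z - φ z - φ z * ⟪v, z⟫) ∂ν|
        = |∫ z, φ z * (Real.exp (⟪v, z⟫ - ⟪C v, v⟫ / 2) - 1 - ⟪v, z⟫) ∂ν| := by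
          congr 2; ext z; ring
      _ ≤ ∫ z, |φ z * (Real.exp (⟪v, z⟫ - ⟪C v, v⟫ / 2) - 1 - ⟪v, z⟫)| ∂ν :=
          abs_integral_le_integral_abs
      _ ≤ √(∫ z, φ z ^ 2 ∂ν) * √(⟪C v, v⟫ ^ 2) := by
          refine (integral_abs_mul_le_sqrt hφ2 hR).trans ?_
          rw [hν.integral_exp_remainder_sq hC]
          gcongr
          exact exp_sub_one_sub_id_le_sq (hν.inner_nonneg v) hv
      _ ≤ √(K ^ 2) * √(⟪C v, v⟫ ^ 2) := by
          gcongr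
          calc ∫ z, φ z ^ 2 ∂ν ≤ ∫ _, K ^ 2 ∂ν := by
                refine integral_mono hφ2.integrable_sq (integrable_const _) fun z => ?_
                exact sq_le_sq.2 ((hK z).trans (le_abs_self K))
            _ = K ^ 2 := by simp
      _ = K * ⟪C v, v⟫ := by rw [Real.sqrt_sq hK0, Real.sqrt_sq (hν.inner_nonneg v)]
  · exact (hE.integrable_mul hφ2).sub (hφ2.integrable (by simp))
  · exact hφ2.integrable_mul hL
  · exact hE.integrable_mul hφ2
  · exact hφ2.integrable (by simp)

theorem IsNormalLaw.hasDerivAt_integral_shift (hν : IsNormalLaw 0 C ν)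
    (hC : ∀ x y, ⟪C x, y⟫ = ⟪x, C y⟫) (v : H) {φ : H → ℝ} (hφ : Measurable φ)
    {K : ℝ} (hK : ∀ x, |φ x| ≤ K) :
    HasDerivAt (fun ε : ℝ => ∫ z, φ (C (ε • v) + z) ∂ν) (∫ z, φ z * ⟪v, z⟫ ∂ν) 0 := by
  rw [hasDerivAt_iff_isLittleO]
  simp only [zero_smul, map_zero, zero_add, sub_zero]
  have hO : (fun ε : ℝ => ∫ z, φ (C (ε • v) + z) ∂ν - ∫ z, φ z ∂ν - ε • ∫ z, φ z * ⟪v, z⟫ ∂ν)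
      =O[𝓝 0] fun ε : ℝ => ε ^ 2 := by
    refine Asymptotics.IsBigO.of_bound (K * ⟪C v, v⟫) ?_
    have hc : ContinuousAt (fun ε : ℝ => ε ^ 2 * ⟪C v, v⟫) 0 := by fun_prop
    have h1 : ∀ᶠ ε : ℝ in 𝓝 0, ε ^ 2 * ⟪C v, v⟫ < 1 :=
      hc.eventually_lt continuousAt_const (by simp)
    filter_upwards [h1] with ε hε
    have hq : ⟪C (ε • v), ε • v⟫ = ε ^ 2 * ⟪C v, v⟫ := by
      simp [inner_smul_left, inner_smul_right]; ring
    have h := hν.abs_integral_shift_sub_le hC (ε • v) (hq ▸ hε.le) hφ hK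
    rw [hq] at h
    simp only [inner_smul_left, conj_trivial] at h
    simp_rw [mul_left_comm _ ε, integral_const_mul] at h
    rw [smul_eq_mul, Real.norm_eq_abs, norm_pow, Real.norm_eq_abs, sq_abs]
    linarith
  refine hO.trans_isLittleO ?_
  simpa using Asymptotics.isLittleO_pow_id (𝕜 := ℝ) (n := 2) (by norm_num)

/-- Gaussian integration by parts. -/
theorem IsNormalLaw.integral_mul_inner_eq (hν : IsNormalLaw 0 C ν)
    (hC : ∀ x y, ⟪C x, y⟫ = ⟪x, C y⟫) (m v : H) {w : H → ℝ} (hw : ContDiff ℝ 1 w)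
    {K : ℝ} (hK : ∀ x, |w x| ≤ K) (hK' : ∀ x, ‖gradient w x‖ ≤ K) :
    ∫ z, w (m + z) * ⟪v, z⟫ ∂ν = ∫ z, ⟪gradient w (m + z), C v⟫ ∂ν := by
  have := hν.1
  have hd : Differentiable ℝ w := hw.differentiable (by norm_num)
  have h1 := hν.hasDerivAt_integral_shift hC v (φ := fun z => w (m + z))
    (by have := hw.continuous; fun_prop) (fun x => hK (m + x))
  have hgc : Continuous (gradient w) := by
    have := hw.continuous_fderiv (by norm_num)
    unfold gradient
    fun_prop
  -- The same derivative computed by differentiating `w` under the integral; the formula is the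
  -- uniqueness of the derivative.
  have h2 := (hasDerivAt_integral_of_dominated_loc_of_deriv_le (μ := ν) (x₀ := (0 : ℝ)) (s := Set.univ)
    (F := fun ε z => w (m + (C (ε • v) + z)))
    (F' := fun ε z => ⟪gradient w (m + (C (ε • v) + z)), C v⟫) (bound := fun _ => K * ‖C v‖)
    univ_mem (Eventually.of_forall fun ε => by
      have := hw.continuous
      exact Continuous.aestronglyMeasurable (by fun_prop)) ?_ ?_ ?_ (by fun_prop) ?_).2
  · have := h1.unique h2
    simpa using this
  · refine Integrable.of_bound (Continuous.aestronglyMeasurable ?_) K (ae_of_all _ fun z => hK _)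
    have := hw.continuous
    fun_prop
  · exact Continuous.aestronglyMeasurable (by fun_prop)
  · exact ae_of_all _ fun z ε _ => (norm_inner_le_norm _ _).trans (by gcongr; exact hK' _)
  · refine ae_of_all _ fun z ε _ => ?_
    have hg := (hd (m + (C (ε • v) + z))).hasGradientAt.hasFDerivAt
    have hl : HasDerivAt (fun ε : ℝ => m + (C (ε • v) + z)) (C v) ε := by
      have : HasDerivAt (fun ε : ℝ => ε • C v) ((1 : ℝ) • C v) ε := (hasDerivAt_id ε).smul_const _
      simp only [map_smul]
      simpa using (this.add_const z).const_add m
    simpa [Function.comp_def] using hg.comp_hasDerivAt ε hl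

end GaussianLaw

/-! ### Existence of Gaussian measures with diagonal trace-class covariance. -/

section GaussianExistence

variable {H : Type*} [NormedAddCommGroup H] [InnerProductSpace ℝ H] [CompleteSpace H]
  [SecondCountableTopology H] [MeasurableSpace H] [BorelSpace H] {ι : Type*}

theorem _root_.HilbertBasis.summable_smul (b : HilbertBasis ι ℝ H) {c : ι → ℝ}
    (hc : Summable fun i => c i ^ 2) : Summable fun i => c i • b i := by
  have hm : Memℓp c 2 := by
    refine memℓp_gen ?_
    simpa using hc
  exact (b.hasSum_repr_symm ⟨c, hm⟩).summable

/-- The sum has finite expectation `∑ q i`, each coordinate having variance one. -/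
theorem ae_summable_mul_sq_infinitePi [Countable ι] {q : ι → ℝ} (hq0 : ∀ i, 0 ≤ q i)
    (hq : Summable q) :
    ∀ᵐ ω ∂(Measure.infinitePi fun _ : ι => ProbabilityTheory.gaussianReal 0 1),
      Summable fun i => q i * ω i ^ 2 := by
  set P := Measure.infinitePi fun _ : ι => ProbabilityTheory.gaussianReal 0 1 with hP
  have h2 : ∀ i, ∫⁻ ω : ι → ℝ, ENNReal.ofReal (q i * ω i ^ 2) ∂P = ENNReal.ofReal (q i) := by
    intro i
    have hme := measurePreserving_eval_infinitePi
      (fun _ : ι => ProbabilityTheory.gaussianReal 0 1) i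
    rw [← hP] at hme
    have hl := hme.lintegral_comp (f := fun r : ℝ => ENNReal.ofReal (q i * r ^ 2)) (by fun_prop)
    simp only [Function.eval] at hl
    rw [hl]
    have hint : Integrable (fun r : ℝ => r ^ 2) (ProbabilityTheory.gaussianReal 0 1) :=
      (ProbabilityTheory.memLp_id_gaussianReal' (μ := 0) (v := 1) 2 (by simp)).integrable_sq
    rw [← ofReal_integral_eq_lintegral_ofReal (hint.const_mul _)
      (ae_of_all _ fun r => mul_nonneg (hq0 i) (sq_nonneg r)), integral_const_mul]
    have h := ProbabilityTheory.variance_fun_id_gaussianReal (μ := 0) (v := 1)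
    rw [ProbabilityTheory.variance_of_integral_eq_zero (by fun_prop)
      ProbabilityTheory.integral_id_gaussianReal] at h
    rw [h]
    simp
  have hm : ∀ i, Measurable fun ω : ι → ℝ => ENNReal.ofReal (q i * ω i ^ 2) := fun i =>
    ENNReal.measurable_ofReal.comp (((measurable_pi_apply i).pow_const 2).const_mul _)
  have h3 : ∫⁻ ω : ι → ℝ, ∑' i, ENNReal.ofReal (q i * ω i ^ 2) ∂P ≠ ∞ := by
    rw [lintegral_tsum fun i => (hm i).aemeasurable]
    simp_rw [h2]
    exact hq.tsum_ofReal_ne_top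
  filter_upwards [ae_lt_top (Measurable.tsum hm) h3] with ω hω
  have h4 := ENNReal.summable_toReal hω.ne
  refine h4.congr fun i => ?_
  rw [ENNReal.toReal_ofReal (mul_nonneg (hq0 i) (sq_nonneg _))]

theorem charFun_gaussian_sum (s : Finset ι) (c : ι → ℝ) :
    ∫ ω : ι → ℝ, Complex.exp (((∑ i ∈ s, c i * ω i : ℝ) : ℂ) * Complex.I)
      ∂(Measure.infinitePi fun _ : ι => ProbabilityTheory.gaussianReal 0 1)
      = Complex.exp (-((∑ i ∈ s, c i ^ 2 : ℝ) : ℂ) / 2) := by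
  set P := Measure.infinitePi fun _ : ι => ProbabilityTheory.gaussianReal 0 1 with hP
  have hind := ProbabilityTheory.iIndepFun_infinitePi
    (P := fun _ : ι => ProbabilityTheory.gaussianReal 0 1) (X := fun i (r : ℝ) => c i * r)
    (fun i => by fun_prop)
  rw [← hP] at hind
  have hcm : ∀ i, Measurable fun ω : ι → ℝ => c i * ω i := fun i =>
    (measurable_pi_apply i).const_mul _
  have h1 := ProbabilityTheory.iIndepFun.charFun_map_fun_finsetSum_eq_prod (s := s)
    (X := fun i (ω : ι → ℝ) => c i * ω i) (P := P) (fun i _ => (hcm i).aemeasurable) (hind.restrict _)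
  have h1 := congrFun h1 1
  rw [charFun_apply_real, integral_map (Finset.measurable_fun_sum s fun i _ => hcm i).aemeasurable (by fun_prop)] at h1
  simp only [Complex.ofReal_one, one_mul] at h1
  rw [h1, Finset.prod_apply]
  have h2 : ∀ i, charFun (P.map fun ω => c i * ω i) 1 = Complex.exp (-((c i ^ 2 : ℝ) : ℂ) / 2) := by
    intro i
    have : P.map (fun ω => c i * ω i) = (P.map fun ω => ω i).map (fun r => c i * r) := by
      rw [Measure.map_map (by fun_prop) (by fun_prop)]; rfl
    rw [this, hP, Measure.infinitePi_map_eval, ProbabilityTheory.gaussianReal_map_const_mul,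
      ProbabilityTheory.charFun_gaussianReal]
    simp
    ring_nf
  simp_rw [h2]
  rw [← Complex.exp_sum]
  congr 1
  push_cast
  rw [← Finset.sum_div, Finset.sum_neg_distrib]

/-- The measure is the law of the random series `∑ √(q i) ω_i b_i` with independent standard
Gaussian `ω_i` (Karhunen-Loève). The characteristic functions of the partial sums converge by
dominated convergence and by Parseval. -/
theorem exists_isNormalLaw_of_summable [Countable ι] (b : HilbertBasis ι ℝ H) {q : ι → ℝ}
    (hq0 : ∀ i, 0 ≤ q i) (hq : Summable q) (Q : H →L[ℝ] H)
    (hQ : ∀ i x, ⟪b i, Q x⟫ = q i * ⟪b i, x⟫) : ∃ ν : Measure H, IsNormalLaw 0 Q ν := by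
  set P := Measure.infinitePi fun _ : ι => ProbabilityTheory.gaussianReal 0 1 with hP
  have : Countable (Finset ι) := inferInstance
  let F : Finset ι → (ι → ℝ) → H := fun s ω => ∑ i ∈ s, (√(q i) * ω i) • b i
  let G : (ι → ℝ) → H := fun ω => ∑' i, (√(q i) * ω i) • b i
  have hFG : ∀ᵐ ω ∂P, Tendsto (fun s => F s ω) atTop (𝓝 (G ω)) := by
    filter_upwards [ae_summable_mul_sq_infinitePi hq0 hq] with ω hω
    refine (b.summable_smul ?_).hasSum
    refine hω.congr fun i => ?_
    rw [mul_pow, Real.sq_sqrt (hq0 i)]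
  have hFm : ∀ s, Measurable (F s) := fun s => by fun_prop
  have hGm : AEMeasurable G P :=
    aemeasurable_of_tendsto_metrizable_ae atTop (fun s => (hFm s).aemeasurable) hFG
  refine ⟨P.map G, Measure.isProbabilityMeasure_map hGm, fun h => ?_⟩
  rw [charFun_apply, integral_map hGm (by fun_prop)]
  have hlim : Tendsto (fun s => ∫ ω, Complex.exp ((⟪F s ω, h⟫ : ℂ) * Complex.I) ∂P) atTop
      (𝓝 (∫ ω, Complex.exp ((⟪G ω, h⟫ : ℂ) * Complex.I) ∂P)) := by
    refine tendsto_integral_filter_of_dominated_convergence (fun _ => 1)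
      (Eventually.of_forall fun s => ?_) (Eventually.of_forall fun s => ae_of_all _ fun ω => ?_)
      (integrable_const _) ?_
    · have := hFm s
      exact Measurable.aestronglyMeasurable (by fun_prop)
    · rw [Complex.norm_exp_ofReal_mul_I]
    · filter_upwards [hFG] with ω hω
      have hc : Continuous fun y : H => Complex.exp ((⟪y, h⟫ : ℂ) * Complex.I) := by fun_prop
      exact (hc.tendsto _).comp hω
  have hval : ∀ s : Finset ι, ∫ ω, Complex.exp ((⟪F s ω, h⟫ : ℂ) * Complex.I) ∂P
      = Complex.exp (-((∑ i ∈ s, ⟪Q h, b i⟫ * ⟪b i, h⟫ : ℝ) : ℂ) / 2) := by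
    intro s
    have e : ∀ ω, ⟪F s ω, h⟫ = ∑ i ∈ s, (√(q i) * ⟪b i, h⟫) * ω i := fun ω => by
      simp only [F, sum_inner, inner_smul_left, conj_trivial]
      exact Finset.sum_congr rfl fun i _ => by ring
    simp_rw [e]
    rw [charFun_gaussian_sum]
    congr 5
    ext i
    rw [mul_pow, Real.sq_sqrt (hq0 i), real_inner_comm (b i) (Q h), hQ]
    ring
  simp_rw [hval] at hlim
  have hsum := b.hasSum_inner_mul_inner (Q h) h
  have hlim2 : Tendsto (fun s : Finset ι =>
      Complex.exp (-((∑ i ∈ s, ⟪Q h, b i⟫ * ⟪b i, h⟫ : ℝ) : ℂ) / 2)) atTop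
      (𝓝 (Complex.exp (-((⟪Q h, h⟫ : ℝ) : ℂ) / 2))) := by
    have hc : Continuous fun r : ℝ => Complex.exp (-(r : ℂ) / 2) := by fun_prop
    exact (hc.tendsto _).comp hsum
  rw [tendsto_nhds_unique hlim hlim2]
  congr 1
  simp
  ring

end GaussianExistence

/-! ### Resolvents of a negative definite self-adjoint operator. -/

section Resolvent

variable {H : Type*} [NormedAddCommGroup H] [InnerProductSpace ℝ H] {A : H →ₗ.[ℝ] H}

theorem IsNegDef.inner_nonpos (hA : IsNegDef A) (x : A.domain) : ⟪A x, (x : H)⟫ ≤ 0 := by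
  by_cases h : (x : H) = 0
  · simp [h]
  · exact (hA x h).le

theorem IsResolvent.exists_apply {s : ℝ} {T : H →L[ℝ] H} (hT : IsResolvent A s T) (y : H) :
    ∃ x : A.domain, (x : H) = T y ∧ A x = s • T y - y := by
  have h := hT.1 y
  rw [LinearPMap.mem_graph_iff] at h
  exact h

theorem IsResolvent.apply_eq_of_mem_graph {s : ℝ} {T : H →L[ℝ] H} (hT : IsResolvent A s T)
    {x y : H} (h : (x, y) ∈ A.graph) : T (s • x - y) = x := by
  rw [LinearPMap.mem_graph_iff] at h
  obtain ⟨x', hx, hy⟩ := h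
  simp only at hx hy
  rw [← hx, ← hy]
  exact hT.2 x'

theorem IsResolvent.unique {s : ℝ} {T T' : H →L[ℝ] H} (hT : IsResolvent A s T)
    (hT' : IsResolvent A s T') : T = T' := by
  ext y
  have := hT'.apply_eq_of_mem_graph (hT.1 y)
  simpa using this.symm

theorem resolventOp_eq {s : ℝ} {T : H →L[ℝ] H} (hT : IsResolvent A s T) : resolventOp A s = T := by
  have hex : ∃ T : H →L[ℝ] H, IsResolvent A s T := ⟨T, hT⟩
  unfold resolventOp
  rw [dif_pos hex]
  exact hex.choose_spec.unique hT

theorem IsResolvent.isResolvent_resolventOp {s : ℝ} {T : H →L[ℝ] H} (hT : IsResolvent A s T) :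
    IsResolvent A s (resolventOp A s) := by
  rwa [resolventOp_eq hT]

theorem IsResolvent.inner_apply_self_nonneg (hA : IsNegDef A) {s : ℝ} (hs : 0 ≤ s)
    {T : H →L[ℝ] H} (hT : IsResolvent A s T) (y : H) : 0 ≤ ⟪T y, y⟫ := by
  obtain ⟨x, hx, hAx⟩ := hT.exists_apply y
  have h := hA.inner_nonpos x
  rw [hx, hAx, inner_sub_left, inner_smul_left, real_inner_self_eq_norm_sq, conj_trivial] at h
  rw [real_inner_comm]
  nlinarith [mul_nonneg hs (sq_nonneg ‖T y‖)]

theorem IsResolvent.injective {s : ℝ} {T : H →L[ℝ] H} (hT : IsResolvent A s T) (y : H)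
    (hy : T y = 0) : y = 0 := by
  obtain ⟨x, hx, hAx⟩ := hT.exists_apply y
  have : x = 0 := Subtype.ext (hx.trans hy)
  rw [this, hy] at hAx
  simpa using hAx

variable [CompleteSpace H]

theorem _root_.IsSelfAdjoint.linearPMap_inner (hA : IsSelfAdjoint A) (x y : A.domain) :
    ⟪A x, (y : H)⟫ = ⟪(x : H), A y⟫ := by
  have h := LinearPMap.adjoint_isFormalAdjoint hA.dense_domain
  rw [LinearPMap.isSelfAdjoint_def.1 hA] at h
  exact h x y

theorem IsResolvent.inner_comm (hA : IsSelfAdjoint A) {s : ℝ} {T : H →L[ℝ] H}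
    (hT : IsResolvent A s T) (y z : H) : ⟪T y, z⟫ = ⟪y, T z⟫ := by
  obtain ⟨x, hx, hAx⟩ := hT.exists_apply y
  obtain ⟨x', hx', hAx'⟩ := hT.exists_apply z
  have h := hA.linearPMap_inner x x'
  rw [hAx, hAx', hx, hx', inner_sub_left, inner_sub_right, inner_smul_left, inner_smul_right] at h
  simp only [conj_trivial] at h
  linarith

theorem IsNegDef.norm_smul_le (hA : IsNegDef A) (s : ℝ) (x : A.domain) :
    s * ‖(x : H)‖ ≤ ‖s • (x : H) - A x‖ := by
  by_cases h0 : ‖(x : H)‖ = 0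
  · rw [h0, mul_zero]; positivity
  have hpos : 0 < ‖(x : H)‖ := lt_of_le_of_ne (norm_nonneg _) (Ne.symm h0)
  refine le_of_mul_le_mul_right ?_ hpos
  calc s * ‖(x : H)‖ * ‖(x : H)‖ ≤ ⟪s • (x : H) - A x, (x : H)⟫ := by
        rw [inner_sub_left, inner_smul_left, real_inner_self_eq_norm_sq, conj_trivial]
        nlinarith [hA.inner_nonpos x]
    _ ≤ _ := real_inner_le_norm _ _

/-- The range is closed by the coercivity `s ‖x‖ ≤ ‖s x - A x‖` and the closedness of `A`. A vector
`y` orthogonal to it lies in the domain of `A* = A` with `A y = s y`, which contradicts negativity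
unless `y = 0`. -/
theorem IsNegDef.surjective_smul_sub (hA : IsNegDef A) (hsa : IsSelfAdjoint A) {s : ℝ}
    (hs : 0 < s) (y : H) : ∃ x : A.domain, s • (x : H) - A x = y := by
  let L : A.domain →ₗ[ℝ] H := s • A.domain.subtype - A.toFun
  have hL : ∀ x, L x = s • (x : H) - A x := fun x => rfl
  have hclosed : IsClosed (LinearMap.range L : Set H) := by
    refine isClosed_of_closure_subset fun y hy => ?_
    obtain ⟨yn, hyn, hlim⟩ := mem_closure_iff_seq_limit.1 hy
    choose xn hxn using hyn
    have hcau : CauchySeq fun n => (xn n : H) := by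
      have hc := hlim.cauchySeq
      rw [Metric.cauchySeq_iff'] at hc ⊢
      intro ε hε
      obtain ⟨N, hN⟩ := hc (s * ε) (by positivity)
      refine ⟨N, fun n hn => ?_⟩
      have h1 := hN n hn
      rw [dist_eq_norm, ← hxn, ← hxn, ← map_sub, hL] at h1
      have h2 := (hA.norm_smul_le s (xn n - xn N)).trans_lt h1
      rw [dist_eq_norm]
      exact lt_of_mul_lt_mul_left h2 hs.le
    obtain ⟨x, hx⟩ := cauchySeq_tendsto_of_complete hcau
    have hg : Tendsto (fun n => ((xn n : H), A (xn n))) atTop (𝓝 (x, s • x - y)) := by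
      refine hx.prodMk_nhds ?_
      have : (fun n => A (xn n)) = fun n => s • (xn n : H) - yn n := by
        ext n; rw [← hxn, hL]; abel
      rw [this]
      exact (hx.const_smul s).sub hlim
    have hmem := hsa.isClosed.mem_of_tendsto hg
      (Eventually.of_forall fun n => LinearPMap.mem_graph A (xn n))
    obtain ⟨x', hx', hAx'⟩ := (LinearPMap.mem_graph_iff A).1 hmem
    simp only at hx' hAx'
    refine ⟨x', ?_⟩
    rw [hL, hx', hAx']; abel
  have hbot : (LinearMap.range L)ᗮ = ⊥ := by
    rw [eq_bot_iff]
    intro y hy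
    rw [Submodule.mem_orthogonal'] at hy
    have h1 : ∀ x : A.domain, ⟪s • y, (x : H)⟫ = ⟪y, A x⟫ := fun x => by
      have := hy (L x) ⟨x, rfl⟩
      rw [hL, inner_sub_right, inner_smul_right] at this
      rw [inner_smul_left, conj_trivial]
      linarith
    have hdom := LinearPMap.mem_adjoint_domain_of_exists (T := A) y ⟨s • y, h1⟩
    have hadj := LinearPMap.isSelfAdjoint_def.1 hsa
    have hAy := LinearPMap.adjoint_apply_eq hsa.dense_domain ⟨y, hdom⟩ h1
    have hg : (y, s • y) ∈ A.graph := by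
      rw [← hadj, LinearPMap.mem_graph_iff]
      exact ⟨⟨y, hdom⟩, rfl, hAy⟩
    obtain ⟨x', hx', hAx'⟩ := (LinearPMap.mem_graph_iff A).1 hg
    simp only at hx' hAx'
    have h2 := hA.inner_nonpos x'
    rw [hx', hAx', inner_smul_left, real_inner_self_eq_norm_sq, conj_trivial] at h2
    have h3 : ‖y‖ ^ 2 ≤ 0 := by nlinarith
    have : ‖y‖ = 0 := by nlinarith [norm_nonneg y]
    simpa using this
  have htop : LinearMap.range L = ⊤ := by
    rw [← hclosed.submodule_topologicalClosure_eq, Submodule.topologicalClosure_eq_top_iff]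
    exact hbot
  obtain ⟨x, hx⟩ : y ∈ LinearMap.range L := htop ▸ Submodule.mem_top
  exact ⟨x, hx⟩

theorem IsNegDef.exists_isResolvent (hA : IsNegDef A) (hsa : IsSelfAdjoint A) {s : ℝ}
    (hs : 0 < s) : ∃ T : H →L[ℝ] H, IsResolvent A s T := by
  let L : A.domain →ₗ[ℝ] H := s • A.domain.subtype - A.toFun
  have hL : ∀ x, L x = s • (x : H) - A x := fun x => rfl
  have hinj : Function.Injective L := by
    rw [← LinearMap.ker_eq_bot, LinearMap.ker_eq_bot']
    intro x hx
    have h := hA.norm_smul_le s x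
    rw [← hL, hx, norm_zero] at h
    have : ‖(x : H)‖ ≤ 0 := by nlinarith
    exact Subtype.ext (by simpa using this)
  let E := LinearEquiv.ofBijective L ⟨hinj, fun y => hA.surjective_smul_sub hsa hs y⟩
  have hE : ∀ y, s • (E.symm y : H) - A (E.symm y) = y := fun y => E.apply_symm_apply y
  refine ⟨(A.domain.subtype.comp E.symm.toLinearMap).mkContinuous s⁻¹ fun y => ?_,
    fun y => ?_, fun x => ?_⟩
  · have h := hA.norm_smul_le s (E.symm y)
    rw [hE] at h
    change ‖(E.symm y : H)‖ ≤ s⁻¹ * ‖y‖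
    rw [inv_mul_eq_div, le_div_iff₀ hs]
    linarith
  · rw [LinearPMap.mem_graph_iff]
    refine ⟨E.symm y, rfl, ?_⟩
    change A (E.symm y) = s • (E.symm y : H) - y
    nth_rewrite 3 [← hE y]
    abel
  · change ((E.symm (L x) : A.domain) : H) = x
    rw [show E.symm (L x) = x from E.symm_apply_apply x]

/-- If `‖(s - A)⁻¹‖ ≥ 1/s` held for all `s > 0`, the integrand would dominate `s^{-α-1}`, which is
not integrable on the half-line. Hence `‖s (s - A)⁻¹‖ < 1` for some `s`, and `-A = (I - s (s -
A)⁻¹)(s - A)` on `D(A)` is inverted by a Neumann series. -/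
theorem exists_isResolvent_zero {α : ℝ} (hA : IsNegDef A) (hsa : IsSelfAdjoint A)
    (hint : IntegrableOn (fun s : ℝ => s ^ (-α) • resolventOp A s) (Set.Ioi 0)) :
    ∃ T : H →L[ℝ] H, IsResolvent A 0 T := by
  obtain ⟨s, hs, hlt⟩ : ∃ s : ℝ, 0 < s ∧ ‖resolventOp A s‖ < s⁻¹ := by
    by_contra! hcon
    refine not_integrableOn_Ioi_rpow (-α - 1) (Integrable.mono' (Integrable.norm hint) ?_ ?_)
    · exact Measurable.aestronglyMeasurable (by fun_prop)
    · refine (ae_restrict_iff' measurableSet_Ioi).2 (ae_of_all _ fun s hs => ?_)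
      have hs : 0 < s := hs
      rw [norm_smul, Real.norm_of_nonneg (by positivity), Real.norm_of_nonneg (by positivity),
        Real.rpow_sub_one hs.ne', div_eq_mul_inv]
      gcongr
      exact hcon s hs
  set R := resolventOp A s with hR
  have hres : IsResolvent A s R := (hA.exists_isResolvent hsa hs).choose_spec.isResolvent_resolventOp
  have hn : ‖s • R‖ < 1 := by
    rw [norm_smul, Real.norm_of_nonneg hs.le]
    calc s * ‖R‖ < s * s⁻¹ := by gcongr
      _ = 1 := mul_inv_cancel₀ hs.ne'
  obtain ⟨u, hu⟩ := isUnit_one_sub_of_norm_lt_one hn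
  have hu1 : ∀ y, (↑u⁻¹ : H →L[ℝ] H) y - s • R ((↑u⁻¹ : H →L[ℝ] H) y) = y := fun y => by
    have : (↑u * ↑u⁻¹ : H →L[ℝ] H) y = y := by rw [Units.mul_inv]; rfl
    rw [hu] at this
    simpa using this
  have hu2 : ∀ y, (↑u⁻¹ : H →L[ℝ] H) (y - s • R y) = y := fun y => by
    have : (↑u⁻¹ * ↑u : H →L[ℝ] H) y = y := by rw [Units.inv_mul]; rfl
    rw [hu] at this
    simpa using this
  refine ⟨(↑u⁻¹ : H →L[ℝ] H).comp R, fun y => ?_, fun x => ?_⟩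
  · have hc : (↑u⁻¹ : H →L[ℝ] H) (R y) = R ((↑u⁻¹ : H →L[ℝ] H) y) := by
      nth_rewrite 1 [← hu1 y]
      rw [map_sub, map_smul]
      exact hu2 _
    have := hres.1 ((↑u⁻¹ : H →L[ℝ] H) y)
    rw [ContinuousLinearMap.comp_apply, hc, zero_smul, zero_sub]
    convert this using 2
    nth_rewrite 1 [← hu1 y]
    abel
  · have := hres.2 x
    rw [map_sub, map_smul] at this
    rw [ContinuousLinearMap.comp_apply, zero_smul, zero_sub, map_neg,
      show -R (A x) = (x : H) - s • R x by linear_combination (norm := module) this]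
    exact hu2 _

end Resolvent

/-! ### From the trace condition on the fractional power to an eigenbasis of `A⁻¹`. -/

section Eigenbasis

universe u

variable {H : Type u} [NormedAddCommGroup H] [InnerProductSpace ℝ H] {A : H →ₗ.[ℝ] H}

/-- For each rank-one term, Cauchy-Schwarz and Bessel bound `∑ᵢ ⟨aₙ, eᵢ⟩⟨bₙ, eᵢ⟩` by `‖aₙ‖‖bₙ‖`.
Positivity then turns bounded finite sums into summability. -/
theorem IsTraceClass.summable_inner {T : H →L[ℝ] H} (hT : IsTraceClass T)
    (hpos : ∀ x, 0 ≤ ⟪T x, x⟫) {ι : Type*} {e : ι → H} (he : Orthonormal ℝ e) :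
    Summable fun i => ⟪T (e i), e i⟫ := by
  obtain ⟨a, b, hab, hsum⟩ := hT
  refine summable_of_sum_le (c := ∑' n, ‖a n‖ * ‖b n‖) (fun i => hpos _) fun s => ?_
  have h1 : HasSum (fun n => ∑ i ∈ s, ⟪a n, e i⟫ * ⟪b n, e i⟫) (∑ i ∈ s, ⟪T (e i), e i⟫) := by
    refine hasSum_sum fun i _ => ?_
    have := (hsum (e i)).mapL (innerSL ℝ (e i))
    simpa [real_inner_comm, inner_smul_right] using this
  refine hasSum_le (fun n => ?_) h1 hab.hasSum
  calc ∑ i ∈ s, ⟪a n, e i⟫ * ⟪b n, e i⟫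
      ≤ √(∑ i ∈ s, ⟪a n, e i⟫ ^ 2) * √(∑ i ∈ s, ⟪b n, e i⟫ ^ 2) :=
        Real.sum_mul_le_sqrt_mul_sqrt _ _ _
    _ ≤ √(‖a n‖ ^ 2) * √(‖b n‖ ^ 2) := by
        have hB : ∀ x : H, ∑ i ∈ s, ⟪x, e i⟫ ^ 2 ≤ ‖x‖ ^ 2 := fun x => by
          have := he.sum_inner_products_le (s := s) x
          simpa [real_inner_comm] using this
        gcongr <;> exact hB _
    _ = ‖a n‖ * ‖b n‖ := by rw [Real.sqrt_sq (norm_nonneg _), Real.sqrt_sq (norm_nonneg _)]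

/-- The quadratic polynomial `r ↦ ⟨T(x + r Tx), x + r Tx⟩` is nonnegative, so its discriminant is
not positive. This makes an operator with summable diagonal Hilbert-Schmidt. -/
theorem norm_sq_le_of_symm_nonneg {T : H →L[ℝ] H} (hsymm : ∀ x y, ⟪T x, y⟫ = ⟪x, T y⟫)
    (hpos : ∀ x, 0 ≤ ⟪T x, x⟫) (x : H) : ‖T x‖ ^ 2 ≤ ‖T‖ * ⟪T x, x⟫ := by
  have hq : ∀ r : ℝ, 0 ≤ ⟪T (T x), T x⟫ * (r * r) + (2 * ‖T x‖ ^ 2) * r + ⟪T x, x⟫ := fun r => by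
    have h := hpos (x + r • T x)
    have h2 : ⟪T (T x), x⟫ = ‖T x‖ ^ 2 := by rw [hsymm, real_inner_self_eq_norm_sq]
    simp only [map_add, map_smul, inner_add_left, inner_add_right, inner_smul_left,
      inner_smul_right, conj_trivial, h2, real_inner_self_eq_norm_sq] at h
    linarith
  have hd := discrim_le_zero hq
  have h3 : ⟪T (T x), T x⟫ ≤ ‖T‖ * ‖T x‖ ^ 2 :=
    (real_inner_le_norm _ _).trans (by
      rw [sq, ← mul_assoc]; gcongr; exact T.le_opNorm _)
  rw [discrim] at hd
  by_cases h0 : ‖T x‖ ^ 2 = 0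
  · rw [h0]; exact mul_nonneg (norm_nonneg _) (hpos x)
  have hp : 0 < ‖T x‖ ^ 2 := lt_of_le_of_ne (sq_nonneg _) (Ne.symm h0)
  have h4 : ‖T x‖ ^ 2 * ‖T x‖ ^ 2 ≤ ‖T‖ * ⟪T x, x⟫ * ‖T x‖ ^ 2 := by
    nlinarith [mul_le_mul_of_nonneg_right h3 (hpos x)]
  exact le_of_mul_le_mul_right h4 hp

theorem isCompactOperator_innerSL_smulRight (e y : H) :
    IsCompactOperator ((innerSL ℝ e).smulRight y : H →L[ℝ] H) := by
  have h : IsCompactOperator (innerSL ℝ e : H →L[ℝ] ℝ) :=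
    isCompactOperator_of_locallyCompactSpace_dom _
  exact h.clm_comp (ContinuousLinearMap.toSpanSingleton ℝ y)

variable [CompleteSpace H]

/-- The finite-rank truncations converge in operator norm: by Cauchy-Schwarz the error is at most
the tail of the Hilbert-Schmidt sum. -/
theorem isCompactOperator_of_summable_norm_sq {T : H →L[ℝ] H} {ι : Type*} (b : HilbertBasis ι ℝ H)
    (hT : Summable fun i => ‖T (b i)‖ ^ 2) : IsCompactOperator T := by
  classical
  let F : Finset ι → H →L[ℝ] H := fun s => ∑ i ∈ s, (innerSL ℝ (b i)).smulRight (T (b i))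
  have hFapp : ∀ s x, F s x = ∑ i ∈ s, ⟪b i, x⟫ • T (b i) := fun s x => by simp [F]
  have hlim : ∀ x, Tendsto (fun s => F s x) atTop (𝓝 (T x)) := fun x => by
    have h := (b.hasSum_repr x).mapL T
    simp only [map_smul, HilbertBasis.repr_apply_apply] at h
    simp only [hFapp]
    exact h
  have hbound : ∀ s, ‖T - F s‖ ≤ √(∑' i, ‖T (b i)‖ ^ 2 - ∑ i ∈ s, ‖T (b i)‖ ^ 2) := fun s => by
    refine ContinuousLinearMap.opNorm_le_bound _ (Real.sqrt_nonneg _) fun x => ?_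
    refine le_of_tendsto ((hlim x).sub_const (F s x)).norm ?_
    filter_upwards [eventually_ge_atTop s] with t hst
    rw [hFapp, hFapp, ← Finset.sum_sdiff hst, add_sub_cancel_right]
    calc ‖∑ i ∈ t \ s, ⟪b i, x⟫ • T (b i)‖ ≤ ∑ i ∈ t \ s, |⟪b i, x⟫| * ‖T (b i)‖ := by
          refine (norm_sum_le _ _).trans_eq ?_
          simp [norm_smul]
      _ ≤ √(∑ i ∈ t \ s, |⟪b i, x⟫| ^ 2) * √(∑ i ∈ t \ s, ‖T (b i)‖ ^ 2) :=
          Real.sum_mul_le_sqrt_mul_sqrt _ _ _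
      _ ≤ √(‖x‖ ^ 2) * √(∑' i, ‖T (b i)‖ ^ 2 - ∑ i ∈ s, ‖T (b i)‖ ^ 2) := by
          gcongr
          · simpa using b.orthonormal.sum_inner_products_le (s := t \ s) x
          · rw [le_sub_iff_add_le, Finset.sum_sdiff hst]
            exact hT.sum_le_tsum t fun i _ => sq_nonneg _
      _ = _ := by rw [Real.sqrt_sq (norm_nonneg _), mul_comm]
  have hF : Tendsto F atTop (𝓝 T) := by
    rw [tendsto_iff_norm_sub_tendsto_zero]
    have h1 : Tendsto (fun s : Finset ι => √(∑' i, ‖T (b i)‖ ^ 2 - ∑ i ∈ s, ‖T (b i)‖ ^ 2)) atTop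
        (𝓝 0) := by
      have := ((tendsto_const_nhds (x := ∑' i, ‖T (b i)‖ ^ 2)).sub hT.hasSum).sqrt
      simpa using this
    refine squeeze_zero (fun _ => norm_nonneg _) (fun s => ?_) h1
    rw [norm_sub_rev]
    exact hbound s
  refine isCompactOperator_of_tendsto hF (Eventually.of_forall fun s => ?_)
  induction s using Finset.induction_on with
  | empty => simpa [F] using isCompactOperator_zero
  | insert i s hi ih =>
    have : F (insert i s) = (innerSL ℝ (b i)).smulRight (T (b i)) + F s := Finset.sum_insert hi
    rw [this]
    exact (isCompactOperator_innerSL_smulRight _ _).add ih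

/-- A comparison of `(-A)⁻¹` with `(s - A)⁻¹` as quadratic forms, proved before any spectral
decomposition is available: with `y = Rx`, both forms are combinations of `⟨Ty, y⟩`, `‖y‖²` and
`-⟨Ay, y⟩`. The factor `2` absorbs the cross term `2 s ‖y‖²`. -/
theorem inner_resolvent_le (hA : IsNegDef A) (hsa : IsSelfAdjoint A) {s : ℝ} (hs : 0 < s)
    {T R : H →L[ℝ] H} (hT : IsResolvent A 0 T) (hR : IsResolvent A s R) (x : H) :
    ⟪T x, x⟫ ≤ (2 + s * ‖T‖) * ⟪R x, x⟫ := by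
  obtain ⟨y, hy, hAy⟩ := hR.exists_apply x
  have hx : x = s • (y : H) - A y := by rw [hAy, hy]; abel
  have hTA : T (-A y) = y := by simpa using hT.2 y
  have hTx : T x = s • T (y : H) + y := by
    rw [hx, sub_eq_add_neg, map_add, map_smul, hTA]
  have h1 : ⟪A y, (y : H)⟫ ≤ 0 := hA.inner_nonpos y
  have h2 : ⟪T (y : H), A y⟫ = -‖(y : H)‖ ^ 2 := by
    rw [hT.inner_comm hsa, ← neg_neg (A y), map_neg, hTA, inner_neg_right,
      real_inner_self_eq_norm_sq]
  have h3 : ⟪T (y : H), (y : H)⟫ ≤ ‖T‖ * ‖(y : H)‖ ^ 2 :=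
    (real_inner_le_norm _ _).trans (by rw [sq, ← mul_assoc]; gcongr; exact T.le_opNorm _)
  have e1 : ⟪R x, x⟫ = s * ‖(y : H)‖ ^ 2 - ⟪A y, (y : H)⟫ := by
    rw [← hy, hx, inner_sub_right, inner_smul_right, real_inner_self_eq_norm_sq, real_inner_comm]
  have e2 : ⟪T x, x⟫ = s ^ 2 * ⟪T (y : H), (y : H)⟫ + 2 * s * ‖(y : H)‖ ^ 2 - ⟪A y, (y : H)⟫ := by
    rw [hTx, hx]
    simp only [inner_sub_right, inner_smul_right, inner_add_left, inner_smul_left, conj_trivial,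
      h2, real_inner_self_eq_norm_sq, real_inner_comm (A y) (y : H)]
    ring
  rw [e1, e2]
  have h4 : s ^ 2 * ⟪T (y : H), (y : H)⟫ ≤ s ^ 2 * (‖T‖ * ‖(y : H)‖ ^ 2) := by gcongr
  have h5 : 0 ≤ s * ‖T‖ * (-⟪A y, (y : H)⟫) := by
    have : 0 ≤ -⟪A y, (y : H)⟫ := by linarith
    positivity
  nlinarith

/-- In the Balakrishnan integral only `0 < s ≤ 1` is kept: there `s^{-α} ≥ 1`, and `(s - A)⁻¹`
dominates a fixed multiple of `(-A)⁻¹`. Thus summability of the diagonal passes from `(-A)^{-α}` to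
`(-A)⁻¹`. -/
theorem exists_inner_le_negFracPow {α : ℝ} (hα0 : 0 < α) (hα1 : α < 1) (hA : IsNegDef A)
    (hsa : IsSelfAdjoint A)
    (hint : IntegrableOn (fun s : ℝ => s ^ (-α) • resolventOp A s) (Set.Ioi 0))
    {T : H →L[ℝ] H} (hT : IsResolvent A 0 T) :
    ∃ c : ℝ, 0 < c ∧ ∀ x, ⟪T x, x⟫ ≤ c * ⟪negFracPow A α x, x⟫ := by
  have hsin : 0 < Real.sin (Real.pi * α) / Real.pi :=
    div_pos (Real.sin_pos_of_pos_of_lt_pi (by positivity) (by nlinarith [Real.pi_pos])) Real.pi_pos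
  refine ⟨(2 + ‖T‖) * (Real.sin (Real.pi * α) / Real.pi)⁻¹, by positivity, fun x => ?_⟩
  have hres : ∀ s : ℝ, 0 < s → IsResolvent A s (resolventOp A s) := fun s hs =>
    (hA.exists_isResolvent hsa hs).choose_spec.isResolvent_resolventOp
  have hint' : IntegrableOn (fun s : ℝ => s ^ (-α) * ⟪resolventOp A s x, x⟫) (Set.Ioi 0) := by
    have h := ((innerSL ℝ x).comp (ContinuousLinearMap.apply ℝ H x)).integrable_comp hint
    refine h.congr (ae_of_all _ fun s => ?_)
    simp [real_inner_comm]
  have e : ⟪negFracPow A α x, x⟫ = (Real.sin (Real.pi * α) / Real.pi)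
      * ∫ s in Set.Ioi (0 : ℝ), s ^ (-α) * ⟪resolventOp A s x, x⟫ := by
    have h := ((innerSL ℝ x).comp (ContinuousLinearMap.apply ℝ H x)).integral_comp_comm hint
    rw [negFracPow, _root_.smul_apply, inner_smul_left, conj_trivial]
    congr 1
    rw [real_inner_comm]
    refine Eq.trans (Eq.symm h) ?_
    refine integral_congr_ae (ae_of_all _ fun s => ?_)
    simp [real_inner_comm]
  have hTx : 0 ≤ ⟪T x, x⟫ := hT.inner_apply_self_nonneg hA le_rfl x
  have hlow : (2 + ‖T‖)⁻¹ * ⟪T x, x⟫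
      ≤ ∫ s in Set.Ioi (0 : ℝ), s ^ (-α) * ⟪resolventOp A s x, x⟫ := by
    calc (2 + ‖T‖)⁻¹ * ⟪T x, x⟫ = ∫ _ in Set.Ioc (0 : ℝ) 1, (2 + ‖T‖)⁻¹ * ⟪T x, x⟫ := by simp
      _ ≤ ∫ s in Set.Ioc (0 : ℝ) 1, s ^ (-α) * ⟪resolventOp A s x, x⟫ := by
          refine setIntegral_mono_on (integrableOn_const (by simp)) (hint'.mono_set Set.Ioc_subset_Ioi_self)
            measurableSet_Ioc fun s hs => ?_
          have h1 := inner_resolvent_le hA hsa hs.1 hT (hres s hs.1) x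
          have h2 := (hres s hs.1).inner_apply_self_nonneg hA hs.1.le x
          have h3 : 1 ≤ s ^ (-α) := Real.one_le_rpow_of_pos_of_le_one_of_nonpos hs.1 hs.2 (by linarith)
          have h4 : (2 + s * ‖T‖) * ⟪resolventOp A s x, x⟫
              ≤ (2 + ‖T‖) * ⟪resolventOp A s x, x⟫ := by
            have : s * ‖T‖ ≤ ‖T‖ := mul_le_of_le_one_left (norm_nonneg _) hs.2
            gcongr
          rw [inv_mul_le_iff₀ (by positivity)]
          calc ⟪T x, x⟫ ≤ (2 + ‖T‖) * (1 * ⟪resolventOp A s x, x⟫) := by linarith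
            _ ≤ _ := by gcongr
      _ ≤ _ := by
          refine setIntegral_mono_set hint' ?_ Set.Ioc_subset_Ioi_self.eventuallyLE
          refine (ae_restrict_iff' measurableSet_Ioi).2 (ae_of_all _ fun s hs => ?_)
          have hs : 0 < s := hs
          exact mul_nonneg (by positivity) ((hres s hs).inner_apply_self_nonneg hA hs.le x)
  rw [e, mul_assoc, inv_mul_cancel_left₀ hsin.ne']
  rwa [inv_mul_le_iff₀ (by positivity)] at hlow

theorem mem_orthogonal_of_hilbertBasis {K : Submodule ℝ H} {ι : Type*} (e : HilbertBasis ι ℝ K)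
    {x : H} (hx : ∀ i, ⟪x, (e i : H)⟫ = 0) : x ∈ Kᗮ := by
  rw [Submodule.mem_orthogonal']
  intro y hy
  have h := (e.hasSum_repr ⟨y, hy⟩).mapL ((innerSL ℝ x).comp K.subtypeL)
  simp only [map_smul, ContinuousLinearMap.comp_apply, Submodule.subtypeL_apply, innerSL_apply_apply,
    hx, smul_zero] at h
  exact h.unique hasSum_zero

/-- Bases of all eigenspaces are put together. The union is total because a compact symmetric
operator has no nonzero vector orthogonal to every eigenspace. -/
theorem exists_hilbertBasis_eigenvectors {T : H →L[ℝ] H} (hT : IsCompactOperator T)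
    (hsymm : ∀ x y, ⟪T x, y⟫ = ⟪x, T y⟫) :
    ∃ (ι : Type u) (b : HilbertBasis ι ℝ H) (t : ι → ℝ), ∀ i, T (b i) = t i • b i := by
  have hs : (T : H →ₗ[ℝ] H).IsSymmetric := hsymm
  let E : ℝ → Submodule ℝ H := fun r => Module.End.eigenspace (T : Module.End ℝ H) r
  have hcl : ∀ r, CompleteSpace (E r) := fun r => by
    have : IsClosed (E r : Set H) := by
      have : (E r : Set H) = {x | T x = r • x} := by
        ext x; simp [E]
      rw [this]
      exact isClosed_eq T.continuous (continuous_const_smul r)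
    exact this.completeSpace_coe
  choose w e he using fun r => exists_hilbertBasis ℝ (E r)
  let v : (Σ r, w r) → H := fun p => ((e p.1 p.2 : E p.1) : H)
  have hv : Orthonormal ℝ v :=
    hs.orthogonalFamily_eigenspaces.orthonormal_sigma_orthonormal fun r => (e r).orthonormal
  have hTv : ∀ p, T (v p) = p.1 • v p := fun p => Module.End.mem_eigenspace_iff.1 (e p.1 p.2).2
  have hbot : (Submodule.span ℝ (Set.range v))ᗮ = ⊥ := by
    rw [eq_bot_iff, ← ContinuousLinearMap.orthogonalComplement_iSup_eigenspaces_eq_bot hT hs]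
    refine fun x hx => ?_
    rw [← Submodule.iInf_orthogonal, Submodule.mem_iInf]
    intro r
    rw [Submodule.mem_orthogonal'] at hx
    exact mem_orthogonal_of_hilbertBasis (K := E r) (e r) fun i =>
      hx (v ⟨r, i⟩) (Submodule.subset_span ⟨_, rfl⟩)
  refine ⟨Σ r, w r, HilbertBasis.mkOfOrthogonalEqBot hv hbot, fun p => p.1, ?_⟩
  rw [HilbertBasis.coe_mkOfOrthogonalEqBot]
  exact hTv

theorem exists_eigenbasis (hsa : IsSelfAdjoint A) (hA : IsNegDef A) {α : ℝ} (hα0 : 0 < α)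
    (hα1 : α < 1) (htr : IsTraceClassNegPow A α) :
    ∃ (ι : Type u) (b : HilbertBasis ι ℝ H) (a : ι → ℝ) (a₀ : ℝ), Countable ι ∧ 0 < a₀ ∧
      (∀ i, a₀ ≤ a i) ∧ (Summable fun i => (a i)⁻¹) ∧ IsResolvent A 0 (resolventOp A 0) ∧
      ∀ i, resolventOp A 0 (b i) = (a i)⁻¹ • b i := by
  obtain ⟨T, hT⟩ := exists_isResolvent_zero hA hsa htr.1
  rw [resolventOp_eq hT]
  have hsymm := hT.inner_comm hsa
  have hpos : ∀ x, 0 ≤ ⟪T x, x⟫ := hT.inner_apply_self_nonneg hA le_rfl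
  obtain ⟨c, hc, hcT⟩ := exists_inner_le_negFracPow hα0 hα1 hA hsa htr.1 hT
  have hP : ∀ x, 0 ≤ ⟪negFracPow A α x, x⟫ := fun x =>
    nonneg_of_mul_nonneg_right ((hpos x).trans (hcT x)) hc
  have htrace : ∀ {ι : Type u} {e : ι → H}, Orthonormal ℝ e → Summable fun i => ⟪T (e i), e i⟫ :=
    fun he => Summable.of_nonneg_of_le (fun i => hpos _) (fun i => hcT _)
      ((htr.2.summable_inner hP he).mul_left c)
  have hcomp : IsCompactOperator T := by
    obtain ⟨w, b, -⟩ := exists_hilbertBasis ℝ H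
    refine isCompactOperator_of_summable_norm_sq b ?_
    exact Summable.of_nonneg_of_le (fun i => sq_nonneg _)
      (fun i => norm_sq_le_of_symm_nonneg hsymm hpos (b i)) ((htrace b.orthonormal).mul_left ‖T‖)
  obtain ⟨ι, b, t, ht⟩ := exists_hilbertBasis_eigenvectors hcomp hsymm
  have hb : ∀ i, ⟪b i, b i⟫ = 1 := fun i => by
    rw [real_inner_self_eq_norm_sq, b.orthonormal.1 i, one_pow]
  have htT : ∀ i, ⟪T (b i), b i⟫ = t i := fun i => by
    rw [ht, inner_smul_left, hb, conj_trivial, mul_one]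
  have htpos : ∀ i, 0 < t i := fun i => by
    refine lt_of_le_of_ne (htT i ▸ hpos _) fun h0 => ?_
    have h1 : T (b i) = 0 := by rw [ht, ← h0, zero_smul]
    have h2 := hb i
    rw [hT.injective _ h1] at h2
    simp at h2
  have htle : ∀ i, t i ≤ ‖T‖ + 1 := fun i => by
    rw [← htT]
    have h1 := real_inner_le_norm (T (b i)) (b i)
    have h2 := T.le_opNorm (b i)
    rw [b.orthonormal.1 i, mul_one] at h1 h2
    linarith
  have hsum : Summable t := by simpa [htT] using htrace b.orthonormal
  -- The `+ 1` keeps the lower bound positive even if `T = 0`, that is, on the trivial space.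
  -- Countability of `ι` comes from the summability of the strictly positive family `t`.
  refine ⟨ι, b, fun i => (t i)⁻¹, (‖T‖ + 1)⁻¹, ?_, by positivity,
    fun i => inv_anti₀ (htpos i) (htle i), by simpa using hsum, hT, fun i => by simpa using ht i⟩
  have h := hsum.countable_support
  rw [Function.support_eq_univ fun i => (htpos i).ne'] at h
  exact Set.countable_univ_iff.1 h

end Eigenbasis

/-! ### Operators that are diagonal in a Hilbert basis. -/

section Diagonal

variable {H : Type*} [NormedAddCommGroup H] [InnerProductSpace ℝ H] {ι : Type*}
  (b : HilbertBasis ι ℝ H)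

theorem _root_.HilbertBasis.ext_inner {x y : H} (h : ∀ i, ⟪b i, x⟫ = ⟪b i, y⟫) : x = y := by
  apply b.repr.injective
  ext i
  simpa [HilbertBasis.repr_apply_apply] using h i

theorem _root_.HilbertBasis.hasSum_norm_sq (x : H) :
    HasSum (fun i => ⟪b i, x⟫ ^ 2) (‖x‖ ^ 2) := by
  have h := b.hasSum_inner_mul_inner x x
  rw [real_inner_self_eq_norm_sq] at h
  refine h.congr_fun fun i => ?_
  rw [sq, real_inner_comm x]

open Classical in
/-- The bounded operator that is diagonal in the Hilbert basis `b`, with bounded eigenvalues `c`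
(zero if there is none). -/
noncomputable def diagOp (c : ι → ℝ) : H →L[ℝ] H :=
  if h : ∃ T : H →L[ℝ] H, ∀ i x, ⟪b i, T x⟫ = c i * ⟪b i, x⟫ then h.choose else 0

variable {b} {c d : ι → ℝ} {C : ℝ}

theorem exists_diag (hc : ∀ i, |c i| ≤ C) :
    ∃ T : H →L[ℝ] H, ∀ i x, ⟪b i, T x⟫ = c i * ⟪b i, x⟫ := by
  have hm : ∀ x : H, Memℓp (fun i => c i * ⟪b i, x⟫) 2 := fun x => by
    refine memℓp_gen ?_
    have hs := (b.hasSum_norm_sq x).summable.mul_left (C ^ 2)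
    refine Summable.of_nonneg_of_le (fun i => by positivity) (fun i => ?_) hs
    simp only [ENNReal.toReal_ofNat, Real.rpow_ofNat, Real.norm_eq_abs, sq_abs, mul_pow]
    exact mul_le_mul_of_nonneg_right (sq_le_sq.2 ((hc i).trans (le_abs_self C))) (sq_nonneg _)
  let F : H → H := fun x => b.repr.symm ⟨fun i => c i * ⟪b i, x⟫, hm x⟩
  have hF : ∀ i x, ⟪b i, F x⟫ = c i * ⟪b i, x⟫ := fun i x => by
    rw [← HilbertBasis.repr_apply_apply]
    simp [F]
  let L : H →ₗ[ℝ] H :=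
    { toFun := F
      map_add' := fun x y => b.ext_inner fun i => by
        simp only [inner_add_right, hF]; ring
      map_smul' := fun r x => b.ext_inner fun i => by
        simp only [inner_smul_right, hF, RingHom.id_apply]; ring }
  refine ⟨L.mkContinuous |C| fun x => ?_, fun i x => hF i x⟩
  refine abs_le_of_sq_le_sq' ?_ (by positivity) |>.2
  rw [mul_pow, sq_abs]
  refine hasSum_le (fun i => ?_) (b.hasSum_norm_sq (F x)) ((b.hasSum_norm_sq x).mul_left (C ^ 2))
  rw [hF, mul_pow]
  exact mul_le_mul_of_nonneg_right (sq_le_sq.2 ((hc i).trans (le_abs_self C))) (sq_nonneg _)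

theorem inner_diagOp (hc : ∀ i, |c i| ≤ C) (i : ι) (x : H) :
    ⟪b i, diagOp b c x⟫ = c i * ⟪b i, x⟫ := by
  have h := exists_diag (b := b) hc
  unfold diagOp
  rw [dif_pos h]
  exact h.choose_spec i x

theorem diagOp_symm (hc : ∀ i, |c i| ≤ C) (x y : H) :
    ⟪diagOp b c x, y⟫ = ⟪x, diagOp b c y⟫ := by
  refine (b.hasSum_inner_mul_inner (diagOp b c x) y).unique ?_
  refine (b.hasSum_inner_mul_inner x (diagOp b c y)).congr_fun fun i => ?_
  rw [inner_diagOp hc, real_inner_comm (b i) (diagOp b c x), inner_diagOp hc, real_inner_comm x]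
  ring

theorem norm_diagOp_le (hC : 0 ≤ C) (hc : ∀ i, |c i| ≤ C) (x : H) : ‖diagOp b c x‖ ≤ C * ‖x‖ := by
  refine abs_le_of_sq_le_sq' ?_ (by positivity) |>.2
  rw [mul_pow]
  refine hasSum_le (fun i => ?_) (b.hasSum_norm_sq (diagOp b c x))
    ((b.hasSum_norm_sq x).mul_left (C ^ 2))
  rw [inner_diagOp hc, mul_pow]
  exact mul_le_mul_of_nonneg_right (sq_le_sq.2 ((hc i).trans (le_abs_self C))) (sq_nonneg _)

/-- Dominated convergence in Parseval's sum: convergence of each multiplier with a common bound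
gives strong convergence, with no uniformity in `i`. -/
theorem tendsto_diagOp {β : Type*} {l : Filter β} {e : β → ι → ℝ} (hc : ∀ i, |c i| ≤ C)
    (he : ∀ᶠ n in l, ∀ i, |e n i| ≤ C) (hlim : ∀ i, Tendsto (fun n => e n i) l (𝓝 (c i))) (x : H) :
    Tendsto (fun n => diagOp b (e n) x) l (𝓝 (diagOp b c x)) := by
  rw [tendsto_iff_norm_sub_tendsto_zero]
  have h1 : Tendsto (fun n => ∑' i, (e n i - c i) ^ 2 * ⟪b i, x⟫ ^ 2) l
      (𝓝 (∑' _ : ι, (0 : ℝ))) := by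
    refine tendsto_tsum_of_dominated_convergence (bound := fun i => (2 * C) ^ 2 * ⟪b i, x⟫ ^ 2)
      ((b.hasSum_norm_sq x).summable.mul_left _) (fun i => ?_) ?_
    · have := (((hlim i).sub_const (c i)).pow 2).mul_const (⟪b i, x⟫ ^ 2)
      simpa using this
    · filter_upwards [he] with n hn i
      rw [Real.norm_of_nonneg (by positivity)]
      refine mul_le_mul_of_nonneg_right (sq_le_sq.2 (((abs_sub _ _).trans
        (add_le_add (hn i) (hc i))).trans ?_)) (sq_nonneg _)
      rw [← two_mul]
      exact le_abs_self _
  simp only [tsum_zero] at h1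
  have h2 := h1.sqrt
  rw [Real.sqrt_zero] at h2
  refine h2.congr' ?_
  filter_upwards [he] with n hn
  have h3 := b.hasSum_norm_sq (diagOp b (e n) x - diagOp b c x)
  have h4 : (fun i => ⟪b i, diagOp b (e n) x - diagOp b c x⟫ ^ 2)
      = fun i => (e n i - c i) ^ 2 * ⟪b i, x⟫ ^ 2 := by
    ext i
    rw [inner_sub_right, inner_diagOp hn, inner_diagOp hc]
    ring
  rw [h4] at h3
  rw [h3.tsum_eq, Real.sqrt_sq (norm_nonneg _)]

theorem continuous_diagOp {e : ℝ → ι → ℝ} (he : ∀ t i, |e t i| ≤ C)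
    (hcont : ∀ i, Continuous fun t => e t i) (x : H) : Continuous fun t => diagOp b (e t) x :=
  continuous_iff_continuousAt.2 fun t => tendsto_diagOp (C := C) (he t)
    (Eventually.of_forall he) (fun i => (hcont i).tendsto t) x

theorem diagOp_apply_basis (hc : ∀ i, |c i| ≤ C) (i : ι) : diagOp b c (b i) = c i • b i := by
  classical
  refine b.ext_inner fun j => ?_
  rw [inner_diagOp hc, inner_smul_right]
  by_cases h : j = i
  · rw [h]
  · rw [b.orthonormal.2 h]; simp

end Diagonal

/-! ### The semigroup generated by `A`, and its uniqueness on eigenvectors. -/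

section Semigroup

variable {H : Type*} [NormedAddCommGroup H] [InnerProductSpace ℝ H] [CompleteSpace H]
  {A : H →ₗ.[ℝ] H} {ι : Type*} {b : HilbertBasis ι ℝ H} {a : ι → ℝ}

/-- The cut-off `max t 0` makes the multipliers bounded and continuous on all of `ℝ`, so that the
families built from them need no sign condition on `t`. -/
theorem abs_exp_neg_mul_le_one {a t : ℝ} (ha : 0 ≤ a) : |Real.exp (-a * max t 0)| ≤ 1 := by
  rw [abs_of_pos (Real.exp_pos _), Real.exp_le_one_iff]
  have : 0 ≤ a * max t 0 := mul_nonneg ha (le_max_right _ _)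
  linarith

theorem abs_one_sub_exp_div_le_one {r : ℝ} (hr : 0 < r) : |(1 - Real.exp (-r)) / r| ≤ 1 := by
  have h1 : Real.exp (-r) ≤ 1 := Real.exp_le_one_iff.2 (by linarith)
  have h2 := Real.add_one_le_exp (-r)
  rw [abs_of_nonneg (div_nonneg (by linarith) hr.le), div_le_one hr]
  linarith

theorem tendsto_one_sub_exp_div {a : ℝ} (ha : 0 < a) :
    Tendsto (fun t : ℝ => (1 - Real.exp (-(a * t))) / (a * t)) (𝓝[>] 0) (𝓝 1) := by
  have h : HasDerivAt (fun t : ℝ => 1 - Real.exp (-(a * t))) a 0 := by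
    have h1 : HasDerivAt (fun t : ℝ => -(a * t)) (-a) 0 := by
      simpa using ((hasDerivAt_id (0 : ℝ)).const_mul a).fun_neg
    simpa using h1.exp.const_sub 1
  have h2 := (hasDerivAt_iff_tendsto_slope.1 h).mono_left
    (nhdsWithin_mono 0 (fun t (ht : 0 < t) => ht.ne') : 𝓝[>] (0 : ℝ) ≤ 𝓝[≠] 0)
  have h3 := h2.div_const a
  rw [div_self ha.ne'] at h3
  refine h3.congr' ?_
  filter_upwards [self_mem_nhdsWithin] with t ht
  have ht : 0 < t := ht
  rw [slope_def_field]
  simp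
  field_simp

/-- For `y = A x` the difference quotient at `x` is the diagonal operator with multipliers `(1 -
e^{-a t}) / (a t)`, bounded by one and tending to one, applied to `y`. Conversely, a limit of
difference quotients is identified coordinate by coordinate and returned to the graph through `A⁻¹`.
-/
theorem isSemigroupGeneratedBy_diagOp {a₀ : ℝ} (ha₀ : 0 < a₀) (ha : ∀ i, a₀ ≤ a i)
    (hres : IsResolvent A 0 (resolventOp A 0))
    (hb : ∀ i x, ⟪b i, resolventOp A 0 x⟫ = (a i)⁻¹ * ⟪b i, x⟫) :
    IsSemigroupGeneratedBy A fun t => diagOp b fun i => Real.exp (-a i * max t 0) := by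
  have hpos : ∀ i, 0 < a i := fun i => ha₀.trans_le (ha i)
  have hbd : ∀ t i, |Real.exp (-a i * max t 0)| ≤ 1 := fun t i =>
    abs_exp_neg_mul_le_one (hpos i).le
  refine ⟨?_, fun s t hs ht => ?_, fun x => ?_, fun x y => ⟨fun h => ?_, fun h => ?_⟩⟩
  · ext x
    refine b.ext_inner fun i => ?_
    rw [inner_diagOp (hbd 0)]
    simp
  · ext x
    refine b.ext_inner fun i => ?_
    rw [ContinuousLinearMap.comp_apply, inner_diagOp (hbd _), inner_diagOp (hbd _),
      inner_diagOp (hbd _), max_eq_left hs, max_eq_left ht, max_eq_left (add_nonneg hs ht),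
      ← mul_assoc, ← Real.exp_add]
    ring_nf
  · have h := continuous_diagOp (b := b) hbd (fun i => by fun_prop) x
    have h0 : diagOp b (fun i => Real.exp (-a i * max 0 0)) x = x := by
      refine b.ext_inner fun i => ?_
      rw [inner_diagOp (hbd 0)]
      simp
    have h2 := (h.tendsto 0).mono_left (nhdsWithin_le_nhds (s := Set.Ioi 0))
    rwa [h0] at h2
  · have hx : x = resolventOp A 0 (-y) := by simpa using (hres.apply_eq_of_mem_graph h).symm
    have hxi : ∀ i, ⟪b i, x⟫ = -((a i)⁻¹ * ⟪b i, y⟫) := fun i => by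
      rw [hx, hb, inner_neg_right]; ring
    have h1 : Tendsto (fun t : ℝ => diagOp b (fun i => (1 - Real.exp (-(a i * t))) / (a i * t)) y)
        (𝓝[>] 0) (𝓝 (diagOp b (fun _ => 1) y)) := by
      refine tendsto_diagOp (C := 1) (by simp) ?_ (fun i => tendsto_one_sub_exp_div (hpos i)) y
      filter_upwards [self_mem_nhdsWithin] with t ht i
      exact abs_one_sub_exp_div_le_one (mul_pos (hpos i) ht)
    have h2 : diagOp b (fun _ => 1) y = y := b.ext_inner fun i => by
      rw [inner_diagOp (C := 1) (by simp), one_mul]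
    rw [h2] at h1
    refine h1.congr' ?_
    filter_upwards [self_mem_nhdsWithin] with t ht
    have ht : 0 < t := ht
    refine b.ext_inner fun i => ?_
    rw [inner_diagOp (C := 1) fun i => abs_one_sub_exp_div_le_one (mul_pos (hpos i) ht),
      inner_smul_right, inner_sub_right, inner_diagOp (hbd t), hxi, max_eq_left ht.le]
    have := (hpos i).ne'
    field_simp
    ring
  · have hy : ∀ i, ⟪b i, y⟫ = -(a i * ⟪b i, x⟫) := fun i => by
      have h1 := ((innerSL ℝ (b i)).continuous.tendsto y).comp h
      have h2 := ((tendsto_one_sub_exp_div (hpos i)).mul_const (-(a i * ⟪b i, x⟫)))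
      rw [one_mul] at h2
      refine tendsto_nhds_unique h1 (h2.congr' ?_)
      filter_upwards [self_mem_nhdsWithin] with t ht
      have ht : 0 < t := ht
      simp only [Function.comp_apply, innerSL_apply_apply]
      rw [inner_smul_right, inner_sub_right, inner_diagOp (hbd t), max_eq_left ht.le]
      have := (hpos i).ne'
      field_simp
      ring
    have hx : resolventOp A 0 (-y) = x := b.ext_inner fun i => by
      rw [hb, inner_neg_right, hy, neg_neg, inv_mul_cancel_left₀ (hpos i).ne']
    have h3 := hres.1 (-y)
    simpa [hx] using h3

/-- Otherwise there would be times `tₙ → 0` with unbounded norms, although `S (tₙ) x → x` for every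
`x`; Banach-Steinhaus excludes this. -/
theorem IsSemigroupGeneratedBy.exists_bound {S : ℝ → H →L[ℝ] H} (hS : IsSemigroupGeneratedBy A S) :
    ∃ δ : ℝ, 0 < δ ∧ ∃ M : ℝ, ∀ t, 0 ≤ t → t ≤ δ → ‖S t‖ ≤ M := by
  by_contra! hcon
  have h : ∀ n : ℕ, ∃ t : ℝ, 0 ≤ t ∧ t ≤ 1 / ((n : ℝ) + 1) ∧ (n : ℝ) < ‖S t‖ := fun n =>
    hcon (1 / ((n : ℝ) + 1)) (by positivity) n
  choose t ht0 ht1 htn using h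
  have hlim : ∀ x, Tendsto (fun n => S (t n) x) atTop (𝓝 x) := fun x => by
    have h0 : Tendsto t atTop (𝓝[≥] 0) :=
      tendsto_nhdsWithin_iff.2 ⟨squeeze_zero ht0 ht1 tendsto_one_div_add_atTop_nhds_zero_nat,
        Eventually.of_forall ht0⟩
    have h1 : Tendsto (fun s => S s x) (𝓝[≥] 0) (𝓝 x) := by
      rw [← Set.Ioi_insert, nhdsWithin_insert, tendsto_sup]
      refine ⟨?_, hS.tendsto x⟩
      rw [tendsto_pure_left]
      intro s hs
      rw [hS.zero]
      exact mem_of_mem_nhds hs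
    exact h1.comp h0
  obtain ⟨C, hC⟩ := banach_steinhaus (g := fun n => S (t n)) fun x => by
    obtain ⟨C, hC⟩ := (hlim x).norm.bddAbove_range
    exact ⟨C, fun n => hC ⟨n, rfl⟩⟩
  obtain ⟨n, hn⟩ := exists_nat_gt C
  exact absurd (hC n) (not_le.2 (hn.trans (htn n)))

/-- Let `E h` be the error between `S h v` and `e^{-rh} v`. Telescoping gives `E (k h) ≤ k M E h`,
and `E h = o(h)` because both sides have the same derivative at zero; taking `h = t/(n+1)` and `n →
∞` forces `E t = 0`. This identifies `expOp`, which is obtained by choice, on eigenvectors. -/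
theorem IsSemigroupGeneratedBy.apply_eigenvector_of_bound {S : ℝ → H →L[ℝ] H}
    (hS : IsSemigroupGeneratedBy A S) {v : H} {r : ℝ} (hr : 0 ≤ r) (hv : (v, -r • v) ∈ A.graph)
    {δ M : ℝ} (hM : ∀ t, 0 ≤ t → t ≤ δ → ‖S t‖ ≤ M) {t : ℝ} (ht : 0 < t) (htδ : t ≤ δ) :
    S t v = Real.exp (-r * t) • v := by
  set E : ℝ → ℝ := fun h => ‖S h v - Real.exp (-r * h) • v‖ with hE
  have hM0 : 0 ≤ M := (norm_nonneg _).trans (hM t ht.le htδ)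
  have hstep : ∀ (h : ℝ), 0 ≤ h → ∀ k : ℕ, k * h ≤ δ → E (k * h) ≤ k * (M * E h) := by
    intro h hh k
    induction k with
    | zero => intro _; simp [hE, hS.zero]
    | succ k ih =>
      intro hk
      have hk' : (k : ℝ) * h ≤ δ := by push_cast at hk; linarith
      have e1 : S ((k + 1 : ℕ) * h) v - Real.exp (-r * ((k + 1 : ℕ) * h)) • v
          = S (k * h) (S h v - Real.exp (-r * h) • v)
            + Real.exp (-r * h) • (S (k * h) v - Real.exp (-r * (k * h)) • v) := by
        have : ((k + 1 : ℕ) : ℝ) * h = k * h + h := by push_cast; ring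
        rw [this, hS.add _ _ (by positivity) hh, mul_add, Real.exp_add]
        simp only [ContinuousLinearMap.comp_apply, map_sub, map_smul]
        module
      have e2 : Real.exp (-r * h) ≤ 1 := Real.exp_le_one_iff.2 (by nlinarith)
      calc E ((k + 1 : ℕ) * h) ≤ ‖S (k * h) (S h v - Real.exp (-r * h) • v)‖
            + ‖Real.exp (-r * h) • (S (k * h) v - Real.exp (-r * (k * h)) • v)‖ := by
            rw [hE]; simp only; rw [e1]; exact norm_add_le _ _
        _ ≤ M * E h + 1 * E (k * h) := by
            refine add_le_add ((S (k * h)).le_of_opNorm_le (hM _ (by positivity) hk') _) ?_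
            rw [norm_smul, Real.norm_of_nonneg (Real.exp_pos _).le]
            gcongr
        _ ≤ M * E h + 1 * (k * (M * E h)) := by gcongr; exact ih hk'
        _ = (k + 1 : ℕ) * (M * E h) := by push_cast; ring
  have hsmall : Tendsto (fun h => h⁻¹ * E h) (𝓝[>] 0) (𝓝 0) := by
    have h1 := (hS.generator v (-r • v)).1 hv
    have h2 : HasDerivAt (fun h : ℝ => Real.exp (-r * h) • v) (-r • v) 0 := by
      have h3 : HasDerivAt (fun h : ℝ => -r * h) (-r) 0 := by
        simpa using (hasDerivAt_id (0 : ℝ)).const_mul (-r)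
      simpa using h3.exp.smul_const v
    have h4 := (hasDerivAt_iff_tendsto_slope.1 h2).mono_left
      (nhdsWithin_mono 0 (fun t (ht : 0 < t) => ht.ne') : 𝓝[>] (0 : ℝ) ≤ 𝓝[≠] 0)
    have h5 := (h1.sub h4).norm
    rw [sub_self, norm_zero] at h5
    refine h5.congr' ?_
    filter_upwards [self_mem_nhdsWithin] with h hh
    have hh : 0 < h := hh
    rw [slope_def_module, sub_zero, mul_zero, Real.exp_zero, one_smul, ← smul_sub, norm_smul,
      Real.norm_of_nonneg (by positivity), sub_sub_sub_cancel_right]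
  have hfin : ∀ n : ℕ, E t ≤ t * M * ((t / (n + 1))⁻¹ * E (t / (n + 1))) := fun n => by
    have h0 : ((n + 1 : ℕ) : ℝ) * (t / (n + 1)) = t := by push_cast; field_simp
    have h := hstep (t / (n + 1)) (by positivity) (n + 1) (by rw [h0]; exact htδ)
    rw [h0] at h
    refine h.trans_eq ?_
    push_cast
    field_simp
  have hlim : Tendsto (fun n : ℕ => t * M * ((t / (n + 1))⁻¹ * E (t / (n + 1)))) atTop (𝓝 0) := by
    have h1 : Tendsto (fun n : ℕ => t / ((n : ℝ) + 1)) atTop (𝓝[>] 0) := by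
      refine tendsto_nhdsWithin_iff.2 ⟨?_, Eventually.of_forall fun n => ?_⟩
      · simpa [div_eq_mul_inv] using (tendsto_one_div_add_atTop_nhds_zero_nat (𝕜 := ℝ)).const_mul t
      · exact div_pos ht (by positivity)
    simpa using (hsmall.comp h1).const_mul (t * M)
  have h0 : E t ≤ 0 := ge_of_tendsto hlim (Eventually.of_forall hfin)
  have : E t = 0 := le_antisymm h0 (norm_nonneg _)
  rw [hE] at this
  exact sub_eq_zero.1 (norm_eq_zero.1 this)

theorem IsSemigroupGeneratedBy.apply_eigenvector {S : ℝ → H →L[ℝ] H}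
    (hS : IsSemigroupGeneratedBy A S) {v : H} {r : ℝ} (hr : 0 ≤ r) (hv : (v, -r • v) ∈ A.graph)
    {t : ℝ} (ht : 0 ≤ t) : S t v = Real.exp (-r * t) • v := by
  obtain ⟨δ, hδ, M, hM⟩ := hS.exists_bound
  have key : ∀ n : ℕ, ∀ t : ℝ, 0 < t → t ≤ 2 ^ n * δ → S t v = Real.exp (-r * t) • v := by
    intro n
    induction n with
    | zero =>
      intro t ht htδ
      exact hS.apply_eigenvector_of_bound hr hv hM ht (by simpa using htδ)
    | succ n ih =>
      intro t ht htδ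
      have h := ih (t / 2) (by positivity) (by rw [pow_succ] at htδ; linarith)
      have e : S t = (S (t / 2)).comp (S (t / 2)) := by
        rw [← hS.add _ _ (by positivity) (by positivity), add_halves]
      rw [e, ContinuousLinearMap.comp_apply, h, map_smul, h, smul_smul, ← Real.exp_add]
      ring_nf
  rcases ht.eq_or_lt with rfl | ht
  · simp [hS.zero]
  · obtain ⟨n, hn⟩ := pow_unbounded_of_one_lt (t / δ) (one_lt_two (α := ℝ))
    exact key n t ht ((div_lt_iff₀ hδ).1 hn).le

theorem expOp_eq_diagOp {a₀ : ℝ} (ha₀ : 0 < a₀) (ha : ∀ i, a₀ ≤ a i)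
    (hres : IsResolvent A 0 (resolventOp A 0))
    (hb : ∀ i, resolventOp A 0 (b i) = (a i)⁻¹ • b i)
    (hb' : ∀ i x, ⟪b i, resolventOp A 0 x⟫ = (a i)⁻¹ * ⟪b i, x⟫) {t : ℝ} (ht : 0 ≤ t) :
    expOp A t = diagOp b fun i => Real.exp (-a i * max t 0) := by
  have hpos : ∀ i, 0 < a i := fun i => ha₀.trans_le (ha i)
  have hex : ∃ S : ℝ → H →L[ℝ] H, IsSemigroupGeneratedBy A S :=
    ⟨_, isSemigroupGeneratedBy_diagOp ha₀ ha hres hb'⟩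
  unfold expOp
  rw [dif_pos hex]
  refine ContinuousLinearMap.ext_on (s := Set.range b) ?_ ?_
  · rw [Submodule.dense_iff_topologicalClosure_eq_top]
    exact b.dense_span
  rintro _ ⟨i, rfl⟩
  have hg : (b i, -a i • b i) ∈ A.graph := by
    have h4 := hres.1 (a i • b i)
    rw [map_smul, hb, smul_smul, mul_inv_cancel₀ (hpos i).ne', one_smul, zero_smul, zero_sub] at h4
    simpa using h4
  rw [hex.choose_spec.apply_eigenvector (hpos i).le hg ht,
    diagOp_apply_basis (C := 1) fun i => abs_exp_neg_mul_le_one (hpos i).le, max_eq_left ht]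

end Semigroup

/-! ### The Mehler representation from the spectral data. -/

section Mehler

variable {H : Type*} [NormedAddCommGroup H] [InnerProductSpace ℝ H] [MeasurableSpace H]

/-- The operators entering the Mehler representation
`R_t φ (x) = ∫ φ (S t x + Γ t y) μ(dy)` of the Ornstein-Uhlenbeck semigroup: `S t = e^{tA}`,
`Γ t = (I - e^{2tA})^{1/2}`, `Qt t = Q_t` and `V t = Q_t⁻¹ e^{tA}`. -/
structure IsMehler (A : H →ₗ.[ℝ] H) (S Γ Qt V : ℝ → H →L[ℝ] H) (Q : H →L[ℝ] H) : Prop where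
  expOp_eq : ∀ t, 0 ≤ t → expOp A t = S t
  covQt_eq : ∀ t, 0 ≤ t → covQt A t = Qt t
  isNormalLaw : IsNormalLaw 0 Q (invMeasure A)
  S_symm : ∀ t x y, ⟪S t x, y⟫ = ⟪x, S t y⟫
  S_cont : ∀ x, Continuous fun t => S t x
  S_zero : ∀ x, S 0 x = x
  S_add : ∀ s t, 0 ≤ s → 0 ≤ t → ∀ x, S (s + t) x = S s (S t x)
  Γ_symm : ∀ t x y, ⟪Γ t x, y⟫ = ⟪x, Γ t y⟫
  Γ_cont : ∀ x, Continuous fun t => Γ t x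
  Γ_zero : ∀ x, Γ 0 x = 0
  Q_symm : ∀ x y, ⟪Q x, y⟫ = ⟪x, Q y⟫
  Q_S : ∀ t x, Q (S t x) = S t (Q x)
  Γ_Q_Γ : ∀ t x, Γ t (Q (Γ t x)) = Qt t x
  S_Q_S_add : ∀ t x, S t (Q (S t x)) + Qt t x = Q x
  Qt_V : ∀ t, 0 < t → ∀ x, Qt t (V t x) = S t x
  V_le : ∀ t, 0 < t → ∀ x, ⟪S t x, V t x⟫ ≤ t⁻¹ * ‖x‖ ^ 2
  Qt_norm_le : ∀ t, 0 < t → ∀ x, ‖t⁻¹ • Qt t x‖ ≤ ‖x‖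
  Qt_tendsto : ∀ x, Tendsto (fun t => t⁻¹ • Qt t x) (𝓝[>] 0) (𝓝 x)

variable [CompleteSpace H] [SecondCountableTopology H] [BorelSpace H]

theorem exists_isMehler {A : H →ₗ.[ℝ] H} (hsa : IsSelfAdjoint A) (hA : IsNegDef A) {α : ℝ}
    (hα0 : 0 < α) (hα1 : α < 1) (htr : IsTraceClassNegPow A α) :
    ∃ (S Γ Qt V : ℝ → H →L[ℝ] H) (Q : H →L[ℝ] H), IsMehler A S Γ Qt V Q := by
  obtain ⟨ι, b, a, a₀, hι, ha₀, ha, hsum, hres, hb⟩ := exists_eigenbasis hsa hA hα0 hα1 htr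
  have hpos : ∀ i, 0 < a i := fun i => ha₀.trans_le (ha i)
  have hb' : ∀ i x, ⟪b i, resolventOp A 0 x⟫ = (a i)⁻¹ * ⟪b i, x⟫ := fun i x => by
    rw [← hres.inner_comm hsa, hb, inner_smul_left, conj_trivial]
  set e : ℝ → ι → ℝ := fun t i => Real.exp (-a i * max t 0) with he
  have he0 : ∀ t i, 0 < e t i := fun t i => Real.exp_pos _
  have he1 : ∀ t i, e t i ≤ 1 := fun t i => by
    exact (le_abs_self _).trans (abs_exp_neg_mul_le_one (hpos i).le)
  have hesq : ∀ t i, e t i ^ 2 ≤ 1 := fun t i => pow_le_one₀ (he0 t i).le (he1 t i)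
  have hecont : ∀ i, Continuous fun t => e t i := fun i => by simp only [he]; fun_prop
  have hE : ∀ t i, |e t i| ≤ 1 := fun t i => by rw [abs_of_pos (he0 t i)]; exact he1 t i
  have hG : ∀ t i, |√(1 - e t i ^ 2)| ≤ 1 := fun t i => by
    rw [abs_of_nonneg (Real.sqrt_nonneg _)]
    exact Real.sqrt_le_one.2 (by nlinarith [sq_nonneg (e t i)])
  have hinv : ∀ i, (2 * a i)⁻¹ ≤ (2 * a₀)⁻¹ := fun i => by
    have := ha i
    gcongr
  have hQ : ∀ i, |(2 * a i)⁻¹| ≤ (2 * a₀)⁻¹ := fun i => by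
    rw [abs_of_pos (inv_pos.2 (mul_pos two_pos (hpos i)))]
    exact hinv i
  have hQt : ∀ t i, |(1 - e t i ^ 2) * (2 * a i)⁻¹| ≤ (2 * a₀)⁻¹ := fun t i => by
    have h1 : 0 ≤ 1 - e t i ^ 2 := sub_nonneg.2 (hesq t i)
    have h2 : 1 - e t i ^ 2 ≤ 1 := by nlinarith [sq_nonneg (e t i)]
    rw [abs_mul, abs_of_nonneg h1]
    exact (mul_le_of_le_one_left (abs_nonneg _) h2).trans (hQ i)
  -- This is `1 + r ≤ e^r` at `r = 2 a t`. It gives `2 a e² / (1 - e²) ≤ 1/t`, the bound `V_le` on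
  -- `|Q_t^{-1/2} e^{tA} x|²`.
  have hlt : ∀ t, 0 < t → ∀ i, e t i ^ 2 * (1 + 2 * a i * t) ≤ 1 := fun t ht i => by
    have h1 := Real.add_one_le_exp (2 * a i * t)
    have h2 : e t i ^ 2 = Real.exp (-(2 * a i * t)) := by
      simp only [he, max_eq_left ht.le, ← Real.exp_nat_mul]
      congr 1; push_cast; ring
    calc e t i ^ 2 * (1 + 2 * a i * t) ≤ Real.exp (-(2 * a i * t)) * Real.exp (2 * a i * t) := by
          rw [h2]; gcongr; linarith
      _ = 1 := by rw [← Real.exp_add]; simp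
  have hlt1 : ∀ t, 0 < t → ∀ i, 0 < 1 - e t i ^ 2 := fun t ht i => by
    have h1 := hlt t ht i
    have h2 : 0 < e t i ^ 2 * (2 * a i * t) := by have := he0 t i; have := hpos i; positivity
    linarith
  -- The operator `Q_t⁻¹ e^{tA}` is bounded for `t > 0`: the decay `a e^{-at} ≤ 1/t` compensates the
  -- unbounded factor `a`, and the spectral gap `a₀` keeps `1 - e²` away from zero.
  have hV : ∀ t, 0 < t → ∀ i, |2 * a i * e t i * (1 - e t i ^ 2)⁻¹|
      ≤ 2 * t⁻¹ * (1 - Real.exp (-a₀ * t) ^ 2)⁻¹ := fun t ht i => by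
    have h0 := hlt1 t ht i
    have h1 : a i * e t i ≤ t⁻¹ := by
      have h3 := Real.add_one_le_exp (a i * t)
      have h4 : e t i * Real.exp (a i * t) = 1 := by
        simp only [he, max_eq_left ht.le, ← Real.exp_add]; simp
      rw [← one_div, le_div_iff₀ ht]
      nlinarith [he0 t i]
    have h2 : e t i ≤ Real.exp (-a₀ * t) := by
      simp only [he, max_eq_left ht.le]
      gcongr
      nlinarith [ha i]
    have h5 : Real.exp (-a₀ * t) ^ 2 < 1 := by
      rw [sq_lt_one_iff₀ (Real.exp_pos _).le, Real.exp_lt_one_iff]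
      nlinarith
    have h6 : e t i ^ 2 ≤ Real.exp (-a₀ * t) ^ 2 := pow_le_pow_left₀ (he0 t i).le h2 2
    have h7 := he0 t i
    have h8 := hpos i
    rw [abs_of_pos (by positivity)]
    have h9 : 2 * a i * e t i ≤ 2 * t⁻¹ := by linarith
    have h10 : 0 < 1 - Real.exp (-a₀ * t) ^ 2 := by linarith
    gcongr
  have hcovQ : covQ A = diagOp b fun i => (2 * a i)⁻¹ := by
    ext x
    refine b.ext_inner fun i => ?_
    rw [covQ, _root_.smul_apply, inner_smul_right, hb', inner_diagOp hQ, mul_inv]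
    ring
  have hexp : ∀ t, 0 ≤ t → expOp A t = diagOp b (e t) := fun t ht =>
    expOp_eq_diagOp ha₀ ha hres hb hb' ht
  refine ⟨fun t => diagOp b (e t), fun t => diagOp b fun i => √(1 - e t i ^ 2),
    fun t => diagOp b fun i => (1 - e t i ^ 2) * (2 * a i)⁻¹,
    fun t => diagOp b fun i => 2 * a i * e t i * (1 - e t i ^ 2)⁻¹,
    diagOp b fun i => (2 * a i)⁻¹, ?_⟩
  refine
    { expOp_eq := hexp
      covQt_eq := fun t ht => ?_
      isNormalLaw := ?_
      S_symm := fun t => diagOp_symm (hE t)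
      S_cont := continuous_diagOp hE hecont
      S_zero := fun x => b.ext_inner fun i => by rw [inner_diagOp (hE 0)]; simp [he]
      S_add := fun s t hs ht x => b.ext_inner fun i => ?_
      Γ_symm := fun t => diagOp_symm (hG t)
      Γ_cont := continuous_diagOp hG fun i => by have := hecont i; fun_prop
      Γ_zero := fun x => b.ext_inner fun i => by rw [inner_diagOp (hG 0)]; simp [he]
      Q_symm := diagOp_symm hQ
      Q_S := fun t x => b.ext_inner fun i => by
        rw [inner_diagOp hQ, inner_diagOp (hE t), inner_diagOp (hE t), inner_diagOp hQ]; ring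
      Γ_Q_Γ := fun t x => b.ext_inner fun i => ?_
      S_Q_S_add := fun t x => b.ext_inner fun i => by
        rw [inner_add_right, inner_diagOp (hE t), inner_diagOp hQ, inner_diagOp (hE t),
          inner_diagOp (hQt t), inner_diagOp hQ]; ring
      Qt_V := fun t ht x => b.ext_inner fun i => ?_
      V_le := fun t ht x => ?_
      Qt_norm_le := fun t ht x => ?_
      Qt_tendsto := fun x => ?_ }
  · ext x
    refine b.ext_inner fun i => ?_
    rw [covQt, _root_.smul_apply, inner_smul_right, ContinuousLinearMap.comp_apply, hb',
      _root_.sub_apply, inner_sub_right, hexp _ (by positivity), inner_diagOp (hE _),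
      inner_diagOp (hQt t), ContinuousLinearMap.id_apply]
    have : e (2 * t) i = e t i ^ 2 := by
      simp only [he, ← Real.exp_nat_mul, max_eq_left ht,
        max_eq_left (mul_nonneg zero_le_two ht)]
      congr 1; push_cast; ring
    rw [this, mul_inv]
    ring
  · have hs : Summable fun i => (2 * a i)⁻¹ := by
      simp_rw [mul_inv]
      exact hsum.mul_left _
    have hex := exists_isNormalLaw_of_summable b (fun i => by have := hpos i; positivity) hs
      (diagOp b fun i => (2 * a i)⁻¹) (fun i x => inner_diagOp hQ i x)
    rw [invMeasure, hcovQ, normalLaw, dif_pos hex]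
    exact hex.choose_spec
  · rw [inner_diagOp (hE _), inner_diagOp (hE _), inner_diagOp (hE _), ← mul_assoc]
    simp only [he, max_eq_left hs, max_eq_left ht, max_eq_left (add_nonneg hs ht),
      ← Real.exp_add]
    ring_nf
  · rw [inner_diagOp (hG t), inner_diagOp hQ, inner_diagOp (hG t), inner_diagOp (hQt t)]
    have := Real.mul_self_sqrt (sub_nonneg.2 (hesq t i))
    linear_combination ((2 * a i)⁻¹ * ⟪b i, x⟫) * this
  · rw [inner_diagOp (hQt t), inner_diagOp (hV t ht), inner_diagOp (hE t)]
    have h1 := (hlt1 t ht i).ne'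
    have h2 := (hpos i).ne'
    field_simp
  · refine hasSum_le (fun i => ?_)
      (b.hasSum_inner_mul_inner (diagOp b (e t) x)
        (diagOp b (fun i => 2 * a i * e t i * (1 - e t i ^ 2)⁻¹) x))
      ((b.hasSum_norm_sq x).mul_left t⁻¹)
    rw [real_inner_comm (b i) (diagOp b (e t) x), inner_diagOp (hE t), inner_diagOp (hV t ht)]
    have h1 := hlt1 t ht i
    have h2 : e t i * (2 * a i * e t i * (1 - e t i ^ 2)⁻¹) ≤ t⁻¹ := by
      rw [← one_div t, le_div_iff₀ ht, ← sub_nonneg]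
      have h3 := hlt t ht i
      have : 1 - e t i * (2 * a i * e t i * (1 - e t i ^ 2)⁻¹) * t
          = (1 - e t i ^ 2 * (1 + 2 * a i * t)) * (1 - e t i ^ 2)⁻¹ := by
        field_simp; ring
      rw [this]
      exact mul_nonneg (by linarith) (inv_pos.2 h1).le
    calc e t i * ⟪b i, x⟫ * (2 * a i * e t i * (1 - e t i ^ 2)⁻¹ * ⟪b i, x⟫)
        = e t i * (2 * a i * e t i * (1 - e t i ^ 2)⁻¹) * ⟪b i, x⟫ ^ 2 := by ring
      _ ≤ _ := by gcongr
  · have hc : ∀ i, |t⁻¹ * ((1 - e t i ^ 2) * (2 * a i)⁻¹)| ≤ 1 := fun i => by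
      have h1 := hlt1 t ht i
      have h2 := hpos i
      have h3 : 1 - 2 * a i * t ≤ e t i ^ 2 := by
        have := Real.add_one_le_exp (-(2 * a i * t))
        have h2 : e t i ^ 2 = Real.exp (-(2 * a i * t)) := by
          simp only [he, max_eq_left ht.le, ← Real.exp_nat_mul]
          congr 1; push_cast; ring
        linarith
      rw [abs_of_pos (by positivity), ← mul_assoc, ← div_eq_mul_inv, div_le_one (by positivity),
        inv_mul_le_iff₀ ht]
      linarith
    have : t⁻¹ • diagOp b (fun i => (1 - e t i ^ 2) * (2 * a i)⁻¹) x
        = diagOp b (fun i => t⁻¹ * ((1 - e t i ^ 2) * (2 * a i)⁻¹)) x :=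
      b.ext_inner fun i => by
        rw [inner_smul_right, inner_diagOp (hQt t), inner_diagOp hc]; ring
    rw [this]
    simpa using norm_diagOp_le zero_le_one hc x
  · have h1 : Tendsto
        (fun t : ℝ => diagOp b (fun i => (1 - Real.exp (-(2 * a i * t))) / (2 * a i * t)) x)
        (𝓝[>] 0) (𝓝 (diagOp b (fun _ => 1) x)) := by
      refine tendsto_diagOp (C := 1) (by simp) ?_
        (fun i => tendsto_one_sub_exp_div (mul_pos two_pos (hpos i))) x
      filter_upwards [self_mem_nhdsWithin] with t ht i
      exact abs_one_sub_exp_div_le_one (mul_pos (mul_pos two_pos (hpos i)) ht)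
    have h2 : diagOp b (fun _ => 1) x = x := b.ext_inner fun i => by
      rw [inner_diagOp (C := 1) (by simp), one_mul]
    rw [h2] at h1
    refine h1.congr' ?_
    filter_upwards [self_mem_nhdsWithin] with t ht
    have ht : 0 < t := ht
    refine b.ext_inner fun i => ?_
    rw [inner_diagOp (C := 1) fun i => abs_one_sub_exp_div_le_one
      (mul_pos (mul_pos two_pos (hpos i)) ht), inner_smul_right, inner_diagOp (hQt t)]
    have h2 : e t i ^ 2 = Real.exp (-(2 * a i * t)) := by
      simp only [he, max_eq_left ht.le, ← Real.exp_nat_mul]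
      congr 1; push_cast; ring
    rw [h2]
    have := (hpos i).ne'
    field_simp

end Mehler

/-! ### The transition kernel: reversibility, invariance, Chapman-Kolmogorov, Harnack. -/

section Kernel

variable {H : Type*} [NormedAddCommGroup H] [InnerProductSpace ℝ H] [MeasurableSpace H]
  [CompleteSpace H] [SecondCountableTopology H] [BorelSpace H]
  {A : H →ₗ.[ℝ] H} {S Γ Qt V : ℝ → H →L[ℝ] H} {Q : H →L[ℝ] H}

theorem IsMehler.isProbabilityMeasure (hM : IsMehler A S Γ Qt V Q) :
    IsProbabilityMeasure (invMeasure A) := hM.isNormalLaw.1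

/-- The centred Gaussian measure `N(0, Q_t)`, as the image of the invariant measure. -/
noncomputable def noise (A : H →ₗ.[ℝ] H) (Γ : ℝ → H →L[ℝ] H) (t : ℝ) : Measure H :=
  (invMeasure A).map (Γ t)

/-- The Gaussian measure `N(e^{tA} x, Q_t)`. -/
noncomputable def mehlerKernel (A : H →ₗ.[ℝ] H) (S Γ : ℝ → H →L[ℝ] H) (t : ℝ) (x : H) : Measure H :=
  (noise A Γ t).map fun z => S t x + z

theorem IsMehler.isNormalLaw_noise (hM : IsMehler A S Γ Qt V Q) (t : ℝ) :
    IsNormalLaw 0 (Qt t) (noise A Γ t) := by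
  have := hM.isProbabilityMeasure
  refine ⟨Measure.isProbabilityMeasure_map (by fun_prop), fun h => ?_⟩
  rw [noise, charFun_apply, integral_map (by fun_prop) (by fun_prop)]
  have h1 := hM.isNormalLaw.2 (Γ t h)
  rw [charFun_apply] at h1
  have e : ⟪Q (Γ t h), Γ t h⟫ = ⟪Qt t h, h⟫ := by rw [← hM.Γ_symm, hM.Γ_Q_Γ]
  simp_rw [hM.Γ_symm]
  rw [h1, e]
  simp

theorem IsMehler.isProbabilityMeasure_noise (hM : IsMehler A S Γ Qt V Q) (t : ℝ) :
    IsProbabilityMeasure (noise A Γ t) := (hM.isNormalLaw_noise t).1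

theorem IsMehler.isProbabilityMeasure_mehlerKernel (hM : IsMehler A S Γ Qt V Q) (t : ℝ) (x : H) :
    IsProbabilityMeasure (mehlerKernel A S Γ t x) :=
  have := hM.isProbabilityMeasure_noise t
  Measure.isProbabilityMeasure_map (by fun_prop)

theorem IsMehler.isNormalLaw_mehlerKernel (hM : IsMehler A S Γ Qt V Q) (t : ℝ) (x : H) :
    IsNormalLaw (S t x) (Qt t) (mehlerKernel A S Γ t x) := by
  refine ⟨hM.isProbabilityMeasure_mehlerKernel t x, fun h => ?_⟩
  rw [mehlerKernel, charFun_map_const_add, (hM.isNormalLaw_noise t).2, ← Complex.exp_add]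
  congr 1
  simp
  ring

theorem IsMehler.Qt_symm (hM : IsMehler A S Γ Qt V Q) (t : ℝ) (x y : H) :
    ⟪Qt t x, y⟫ = ⟪x, Qt t y⟫ := by
  rw [← hM.Γ_Q_Γ, ← hM.Γ_Q_Γ, hM.Γ_symm, hM.Q_symm, hM.Γ_symm]

theorem integral_mehlerKernel (t : ℝ) (x : H) {E : Type*} [NormedAddCommGroup E] [NormedSpace ℝ E]
    (φ : H → E) :
    ∫ y, φ y ∂(mehlerKernel A S Γ t x) = ∫ z, φ (S t x + z) ∂(noise A Γ t) :=
  integral_map_equiv (MeasurableEquiv.addLeft (S t x)) φ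

theorem lintegral_mehlerKernel (t : ℝ) (x : H) (φ : H → ℝ≥0∞) :
    ∫⁻ y, φ y ∂(mehlerKernel A S Γ t x) = ∫⁻ z, φ (S t x + z) ∂(noise A Γ t) :=
  lintegral_map_equiv φ (MeasurableEquiv.addLeft (S t x))

theorem mehlerKernel_eq_map (t : ℝ) (x : H) :
    mehlerKernel A S Γ t x = (invMeasure A).map fun y => S t x + Γ t y := by
  rw [mehlerKernel, noise, Measure.map_map (by fun_prop) (by fun_prop)]
  rfl

theorem IsMehler.ouSemigroup_eq (hM : IsMehler A S Γ Qt V Q) {t : ℝ} (ht : 0 ≤ t) (φ : H → ℝ)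
    (x : H) : ouSemigroup A t φ x = ∫ y, φ y ∂(mehlerKernel A S Γ t x) := by
  rw [ouSemigroup, hM.expOp_eq t ht, hM.covQt_eq t ht,
    normalLaw_eq (hM.isNormalLaw_mehlerKernel t x)]

theorem IsMehler.ouSemigroup_eq_integral_invMeasure (hM : IsMehler A S Γ Qt V Q) {t : ℝ}
    (ht : 0 ≤ t) {φ : H → ℝ} (hφ : Measurable φ) (x : H) :
    ouSemigroup A t φ x = ∫ y, φ (S t x + Γ t y) ∂(invMeasure A) := by
  rw [hM.ouSemigroup_eq ht, mehlerKernel_eq_map, integral_map (by fun_prop)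
    hφ.aestronglyMeasurable]

theorem IsMehler.integral_prod_exp (hM : IsMehler A S Γ Qt V Q) (h k : H) :
    ∫ p : H × H, Complex.exp (((⟪p.1, h⟫ + ⟪p.2, k⟫ : ℝ) : ℂ) * Complex.I)
      ∂((invMeasure A).prod (invMeasure A))
      = Complex.exp (-((⟪Q h, h⟫ + ⟪Q k, k⟫ : ℝ) : ℂ) / 2) := by
  have := hM.isProbabilityMeasure
  have e : ∀ p : H × H, Complex.exp (((⟪p.1, h⟫ + ⟪p.2, k⟫ : ℝ) : ℂ) * Complex.I)
      = Complex.exp ((⟪p.1, h⟫ : ℂ) * Complex.I) * Complex.exp ((⟪p.2, k⟫ : ℂ) * Complex.I) :=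
    fun p => by rw [← Complex.exp_add]; congr 1; push_cast; ring
  simp_rw [e]
  rw [integral_prod_mul (fun x : H => Complex.exp ((⟪x, h⟫ : ℂ) * Complex.I))
    (fun x : H => Complex.exp ((⟪x, k⟫ : ℂ) * Complex.I)), ← charFun_apply, ← charFun_apply,
    hM.isNormalLaw.2, hM.isNormalLaw.2, ← Complex.exp_add]
  congr 1
  simp
  ring

/-- Reversibility of the Ornstein-Uhlenbeck process started from its invariant measure. -/
theorem IsMehler.map_prod_symm (hM : IsMehler A S Γ Qt V Q) (t : ℝ) :
    ((invMeasure A).prod (invMeasure A)).map (fun p => (p.1, S t p.1 + Γ t p.2))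
      = ((invMeasure A).prod (invMeasure A)).map (fun p => (S t p.1 + Γ t p.2, p.1)) := by
  have := hM.isProbabilityMeasure
  have : IsProbabilityMeasure (((invMeasure A).prod (invMeasure A)).map
    (fun p => (p.1, S t p.1 + Γ t p.2))) := Measure.isProbabilityMeasure_map (by fun_prop)
  have : IsProbabilityMeasure (((invMeasure A).prod (invMeasure A)).map
    (fun p => (S t p.1 + Γ t p.2, p.1))) := Measure.isProbabilityMeasure_map (by fun_prop)
  refine Measure.ext_of_charFunDual (funext fun L => ?_)
  obtain ⟨h, hh⟩ : ∃ h : H, ∀ x, L (x, 0) = ⟪x, h⟫ :=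
    ⟨(InnerProductSpace.toDual ℝ H).symm (L.comp (ContinuousLinearMap.inl ℝ H H)), fun x => by
      rw [real_inner_comm, InnerProductSpace.toDual_symm_apply]; simp⟩
  obtain ⟨k, hk⟩ : ∃ k : H, ∀ x, L (0, x) = ⟪x, k⟫ :=
    ⟨(InnerProductSpace.toDual ℝ H).symm (L.comp (ContinuousLinearMap.inr ℝ H H)), fun x => by
      rw [real_inner_comm, InnerProductSpace.toDual_symm_apply]; simp⟩
  have hL : ∀ x y, L (x, y) = ⟪x, h⟫ + ⟪y, k⟫ := fun x y => by
    rw [← hh, ← hk, ← map_add]; simp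
  -- The joint characteristic function of the process at times `0` and `t`. Only the cross term `⟨Q
  -- S_t k, h⟩` could break the symmetry in `h` and `k`; it does not, as `Q` and `S_t` are symmetric
  -- and commute.
  have key : ∀ h k : H, ∫ p : H × H, Complex.exp (((⟪p.1, h⟫ + ⟪S t p.1 + Γ t p.2, k⟫ : ℝ) : ℂ)
      * Complex.I) ∂((invMeasure A).prod (invMeasure A))
      = Complex.exp (-((⟪Q h, h⟫ + 2 * ⟪Q (S t k), h⟫ + ⟪Q k, k⟫ : ℝ) : ℂ) / 2) := by
    intro h k
    have e : ∀ p : H × H, ⟪p.1, h⟫ + ⟪S t p.1 + Γ t p.2, k⟫ = ⟪p.1, h + S t k⟫ + ⟪p.2, Γ t k⟫ :=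
      fun p => by
        rw [inner_add_left, inner_add_right, hM.S_symm, hM.Γ_symm]; ring
    simp_rw [e]
    rw [hM.integral_prod_exp]
    congr 4
    have h1 : ⟪Q (Γ t k), Γ t k⟫ = ⟪Qt t k, k⟫ := by rw [← hM.Γ_symm, hM.Γ_Q_Γ]
    have h2 : ⟪Q k, k⟫ = ⟪Q (S t k), S t k⟫ + ⟪Qt t k, k⟫ := by
      rw [← hM.S_symm, ← inner_add_left, hM.S_Q_S_add]
    have h3 : ⟪Q h, S t k⟫ = ⟪Q (S t k), h⟫ := by rw [hM.Q_symm, real_inner_comm]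
    rw [h1, h2, map_add, inner_add_left, inner_add_right, inner_add_right, h3]
    ring
  rw [charFunDual_apply, charFunDual_apply, integral_map (by fun_prop) (by fun_prop),
    integral_map (by fun_prop) (by fun_prop)]
  simp_rw [hL]
  rw [key]
  simp_rw [add_comm (⟪S t _ + Γ t _, h⟫ : ℝ)]
  rw [key]
  congr 4
  have : ⟪Q (S t h), k⟫ = ⟪Q (S t k), h⟫ := by
    rw [hM.Q_S, hM.S_symm, hM.Q_symm, real_inner_comm]
  rw [this]
  ring

theorem IsMehler.map_prod_eq (hM : IsMehler A S Γ Qt V Q) (t : ℝ) :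
    ((invMeasure A).prod (invMeasure A)).map (fun p => S t p.1 + Γ t p.2) = invMeasure A := by
  have := hM.isProbabilityMeasure
  have h := congrArg (Measure.map Prod.snd) (hM.map_prod_symm t)
  rw [Measure.map_map (by fun_prop) (by fun_prop), Measure.map_map (by fun_prop) (by fun_prop)] at h
  refine h.trans ?_
  exact Measure.map_fst_prod.trans (by simp)

theorem IsMehler.lintegral_invariant (hM : IsMehler A S Γ Qt V Q) (t : ℝ) {ψ : H → ℝ≥0∞}
    (hψ : Measurable ψ) :
    ∫⁻ x, ∫⁻ y, ψ y ∂(mehlerKernel A S Γ t x) ∂(invMeasure A) = ∫⁻ x, ψ x ∂(invMeasure A) := by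
  have := hM.isProbabilityMeasure
  conv_rhs => rw [← hM.map_prod_eq t]
  rw [lintegral_map hψ (by fun_prop), lintegral_prod _ (by fun_prop)]
  refine lintegral_congr fun x => ?_
  rw [mehlerKernel_eq_map, lintegral_map hψ (by fun_prop)]

/-- The Chapman-Kolmogorov equation. -/
theorem IsMehler.map_prod_mehlerKernel (hM : IsMehler A S Γ Qt V Q) {s t : ℝ} (hs : 0 ≤ s)
    (ht : 0 ≤ t) (x : H) :
    ((invMeasure A).prod (invMeasure A)).map (fun p => S t (S s x + Γ s p.1) + Γ t p.2)
      = mehlerKernel A S Γ (s + t) x := by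
  have := hM.isProbabilityMeasure
  refine IsNormalLaw.unique (m := S (s + t) x) (C := Qt (s + t))
    ⟨Measure.isProbabilityMeasure_map (by fun_prop), fun h => ?_⟩
    (hM.isNormalLaw_mehlerKernel _ _)
  rw [charFun_apply, integral_map (by fun_prop) (by fun_prop)]
  have hadd : ∀ y, S (s + t) y = S t (S s y) := fun y => by
    rw [add_comm, hM.S_add t s ht hs]
  have hadd' : ∀ y, S (s + t) y = S s (S t y) := hM.S_add s t hs ht
  have e : ∀ p : H × H, Complex.exp ((⟪S t (S s x + Γ s p.1) + Γ t p.2, h⟫ : ℂ) * Complex.I)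
      = Complex.exp ((⟪S (s + t) x, h⟫ : ℂ) * Complex.I) *
        Complex.exp (((⟪p.1, Γ s (S t h)⟫ + ⟪p.2, Γ t h⟫ : ℝ) : ℂ) * Complex.I) := fun p => by
    rw [← Complex.exp_add, ← add_mul, ← Complex.ofReal_add, hadd, map_add, inner_add_left,
      inner_add_left, hM.S_symm t (Γ s p.1), hM.Γ_symm, hM.Γ_symm, add_assoc]
  simp_rw [e]
  rw [integral_const_mul, hM.integral_prod_exp, ← Complex.exp_add]
  have h1 : ⟪Q (Γ t h), Γ t h⟫ = ⟪Qt t h, h⟫ := by rw [← hM.Γ_symm, hM.Γ_Q_Γ]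
  have h2 : ⟪Q (Γ s (S t h)), Γ s (S t h)⟫ = ⟪S t (Qt s (S t h)), h⟫ := by
    rw [← hM.Γ_symm, hM.Γ_Q_Γ, hM.S_symm]
  -- The cocycle relation of the covariances, read off from three instances of `S_r Q S_r + Q_r =
  -- Q`.
  have h3 : Qt (s + t) h = S t (Qt s (S t h)) + Qt t h := by
    have e1 := hM.S_Q_S_add (s + t) h
    have e2 := hM.S_Q_S_add t h
    have e3 := congrArg (S t) (hM.S_Q_S_add s (S t h))
    rw [map_add, ← hadd, ← hadd'] at e3
    rw [← e2, ← e3, add_assoc] at e1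
    exact add_left_cancel e1
  rw [h1, h2, h3, inner_add_left]
  congr 1
  push_cast
  ring

theorem IsMehler.ouSemigroup_add (hM : IsMehler A S Γ Qt V Q) {s t : ℝ} (hs : 0 ≤ s)
    (ht : 0 ≤ t) {φ : H → ℝ} (hφ : Measurable φ) {K : ℝ} (hK : ∀ x, |φ x| ≤ K) (x : H) :
    ouSemigroup A (s + t) φ x = ∫ y, ouSemigroup A t φ y ∂(mehlerKernel A S Γ s x) := by
  have := hM.isProbabilityMeasure
  have hm : Measurable fun y => ouSemigroup A t φ y := by
    simp_rw [hM.ouSemigroup_eq_integral_invMeasure ht hφ]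
    exact (StronglyMeasurable.integral_prod_right' (f := fun p : H × H => φ (S t p.1 + Γ t p.2))
      (by exact Measurable.stronglyMeasurable (by fun_prop))).measurable
  rw [hM.ouSemigroup_eq (add_nonneg hs ht), ← hM.map_prod_mehlerKernel hs ht,
    integral_map (by fun_prop) hφ.aestronglyMeasurable, integral_prod, mehlerKernel_eq_map,
    integral_map (by fun_prop) hm.aestronglyMeasurable]
  · refine integral_congr_ae (ae_of_all _ fun y => ?_)
    exact (hM.ouSemigroup_eq_integral_invMeasure ht hφ (S s x + Γ s y)).symm
  · exact Integrable.of_bound (Measurable.aestronglyMeasurable (by fun_prop)) K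
      (ae_of_all _ fun p => hK _)

theorem lintegral_mul_sq_le {α : Type*} {mα : MeasurableSpace α} {μ : Measure α} {f g : α → ℝ≥0∞}
    (hf : AEMeasurable f μ) (hg : AEMeasurable g μ) :
    (∫⁻ x, f x * g x ∂μ) ^ 2 ≤ (∫⁻ x, f x ^ 2 ∂μ) * ∫⁻ x, g x ^ 2 ∂μ := by
  have h := ENNReal.lintegral_mul_le_Lp_mul_Lq μ Real.HolderConjugate.two_two hf hg
  have h2 := pow_le_pow_left' h 2
  simp only [Pi.mul_apply, mul_pow, ← ENNReal.rpow_natCast, ← ENNReal.rpow_mul] at h2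
  norm_num at h2
  simpa using h2

/-- Wang's dimension-free Harnack inequality. -/
theorem IsMehler.harnack (hM : IsMehler A S Γ Qt V Q) {t : ℝ} (ht : 0 < t) (x y : H)
    {ψ : H → ℝ≥0∞} (hψ : Measurable ψ) :
    (∫⁻ z, ψ z ∂(mehlerKernel A S Γ t x)) ^ 2 * ENNReal.ofReal (Real.exp (-(t⁻¹ * ‖x - y‖ ^ 2)))
      ≤ ∫⁻ z, ψ z ^ 2 ∂(mehlerKernel A S Γ t y) := by
  have hν := hM.isNormalLaw_noise t
  -- The kernels at `x` and `y` differ by the shift `S_t(x - y) = Q_t v`, a Cameron-Martin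
  -- direction. Cauchy-Schwarz is applied to the density, whose second moment `exp ⟨Q_t v, v⟩` is at
  -- most `exp (‖x - y‖² / t)`.
  set v := V t (x - y) with hv
  have hQv : Qt t v = S t (x - y) := hM.Qt_V t ht _
  have e1 : ∫⁻ z, ψ z ∂(mehlerKernel A S Γ t x)
      = ∫⁻ z, ENNReal.ofReal (Real.exp (⟪v, z⟫ - ⟪Qt t v, v⟫ / 2)) * ψ (S t y + z)
        ∂(noise A Γ t) := by
    rw [lintegral_mehlerKernel, ← hν.lintegral_shift (hM.Qt_symm t) v
      (φ := fun z => ψ (S t y + z)) (by fun_prop), hQv]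
    refine lintegral_congr fun z => ?_
    rw [map_sub]
    congr 1
    abel
  have hE : ∫⁻ z, ENNReal.ofReal (Real.exp (⟪v, z⟫ - ⟪Qt t v, v⟫ / 2)) ^ 2 ∂(noise A Γ t)
      = ENNReal.ofReal (Real.exp ⟪Qt t v, v⟫) := by
    rw [← hν.integral_exp_inner_sq, ofReal_integral_eq_lintegral_ofReal
      (hν.memLp_exp_inner v).integrable_sq (ae_of_all _ fun z => sq_nonneg _)]
    exact lintegral_congr fun z => (ENNReal.ofReal_pow (Real.exp_pos _).le 2).symm
  have hq : ⟪Qt t v, v⟫ ≤ t⁻¹ * ‖x - y‖ ^ 2 := by rw [hQv, hv]; exact hM.V_le t ht _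
  have hcs := lintegral_mul_sq_le (μ := noise A Γ t)
    (f := fun z => ENNReal.ofReal (Real.exp (⟪v, z⟫ - ⟪Qt t v, v⟫ / 2)))
    (g := fun z => ψ (S t y + z)) (by fun_prop) (by fun_prop)
  rw [← e1, hE, ← lintegral_mehlerKernel (φ := fun z => ψ z ^ 2)] at hcs
  calc _ ≤ (ENNReal.ofReal (Real.exp ⟪Qt t v, v⟫) * ∫⁻ z, ψ z ^ 2 ∂(mehlerKernel A S Γ t y))
        * ENNReal.ofReal (Real.exp (-(t⁻¹ * ‖x - y‖ ^ 2))) := by gcongr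
    _ = ENNReal.ofReal (Real.exp (⟪Qt t v, v⟫ - t⁻¹ * ‖x - y‖ ^ 2))
        * ∫⁻ z, ψ z ^ 2 ∂(mehlerKernel A S Γ t y) := by
        rw [show ⟪Qt t v, v⟫ - t⁻¹ * ‖x - y‖ ^ 2 = ⟪Qt t v, v⟫ + -(t⁻¹ * ‖x - y‖ ^ 2) from
          sub_eq_add_neg _ _, Real.exp_add, ENNReal.ofReal_mul (Real.exp_pos _).le]; ring
    _ ≤ 1 * ∫⁻ z, ψ z ^ 2 ∂(mehlerKernel A S Γ t y) := by
        gcongr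
        rw [← ENNReal.ofReal_one]
        exact ENNReal.ofReal_le_ofReal (Real.exp_le_one_iff.2 (by linarith))
    _ = _ := one_mul _

/-- Harnack's inequality is integrated in `y` against `μ`, and invariance removes the kernel on the
right. So the kernel at any fixed `x` acts continuously on `L²(μ)`. -/
theorem IsMehler.exists_sq_lintegral_le (hM : IsMehler A S Γ Qt V Q) {t : ℝ} (ht : 0 < t) (x : H) :
    ∃ c : ℝ≥0∞, c ≠ 0 ∧ ∀ ψ : H → ℝ≥0∞, Measurable ψ →
      (∫⁻ z, ψ z ∂(mehlerKernel A S Γ t x)) ^ 2 * c ≤ ∫⁻ z, ψ z ^ 2 ∂(invMeasure A) := by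
  have := hM.isProbabilityMeasure
  refine ⟨∫⁻ y, ENNReal.ofReal (Real.exp (-(t⁻¹ * ‖x - y‖ ^ 2))) ∂(invMeasure A), ?_,
    fun ψ hψ => ?_⟩
  · intro h
    rw [lintegral_eq_zero_iff (by fun_prop)] at h
    obtain ⟨y, hy⟩ := h.exists
    simp only [Pi.zero_apply, ENNReal.ofReal_eq_zero] at hy
    exact absurd hy (not_le.2 (Real.exp_pos _))
  · rw [← hM.lintegral_invariant t (hψ.pow_const 2), ← lintegral_const_mul _ (by fun_prop)]
    exact lintegral_mono fun y => hM.harnack ht x y hψ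

/-- The `L²` bound applied to indicators. This is what upgrades `μ`-a.e. hypotheses to statements at
every point. -/
theorem IsMehler.mehlerKernel_absolutelyContinuous (hM : IsMehler A S Γ Qt V Q) {t : ℝ}
    (ht : 0 < t) (x : H) : mehlerKernel A S Γ t x ≪ invMeasure A := by
  obtain ⟨c, hc, h⟩ := hM.exists_sq_lintegral_le ht x
  refine Measure.AbsolutelyContinuous.mk fun s hs hμ => ?_
  have h1 := h (s.indicator 1) (measurable_one.indicator hs)
  have e : (fun z : H => (s.indicator 1 z : ℝ≥0∞) ^ 2) = s.indicator 1 := by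
    ext z; by_cases hz : z ∈ s <;> simp [hz]
  rw [e, lintegral_indicator_one hs, lintegral_indicator_one hs, hμ] at h1
  simpa [hc] using h1

theorem IsMehler.exists_lintegral_enorm_le (hM : IsMehler A S Γ Qt V Q) {t : ℝ} (ht : 0 < t)
    (x : H) : ∃ c : ℝ≥0∞, c ≠ 0 ∧ ∀ ψ : H → ℝ, AEStronglyMeasurable ψ (invMeasure A) →
      (∫⁻ z, ‖ψ z‖ₑ ∂(mehlerKernel A S Γ t x)) ^ 2 * c ≤ eLpNorm ψ 2 (invMeasure A) ^ 2 := by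
  obtain ⟨c, hc, h⟩ := hM.exists_sq_lintegral_le ht x
  refine ⟨c, hc, fun ψ hψ => ?_⟩
  have h1 := h (fun z => ‖hψ.mk ψ z‖ₑ) (hψ.stronglyMeasurable_mk.measurable.enorm)
  have e1 : ∫⁻ z, ‖ψ z‖ₑ ∂(mehlerKernel A S Γ t x)
      = ∫⁻ z, ‖hψ.mk ψ z‖ₑ ∂(mehlerKernel A S Γ t x) := by
    refine lintegral_congr_ae ?_
    filter_upwards [(hM.mehlerKernel_absolutelyContinuous ht x).ae_le hψ.ae_eq_mk] with z hz
    rw [hz]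
  have e2 : eLpNorm ψ 2 (invMeasure A) ^ 2 = ∫⁻ z, ‖hψ.mk ψ z‖ₑ ^ 2 ∂(invMeasure A) := by
    rw [eLpNorm_congr_ae hψ.ae_eq_mk, eLpNorm_eq_lintegral_rpow_enorm_toReal (by simp) (by simp),
      ← ENNReal.rpow_natCast, ← ENNReal.rpow_mul]
    simp
  rw [e1, e2]
  exact h1

end Kernel

/-! ### The essential supremum norm. -/

section EssNorm

variable {H : Type*} [NormedAddCommGroup H] [InnerProductSpace ℝ H] [MeasurableSpace H]
  {E : Type*} [NormedAddCommGroup E] {A : H →ₗ.[ℝ] H}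

theorem essNorm_nonneg (A : H →ₗ.[ℝ] H) (f : H → E) : 0 ≤ essNorm A f := ENNReal.toReal_nonneg

theorem essNorm_le {f : H → E} {C : ℝ} (hC : 0 ≤ C) (h : ∀ᵐ x ∂(invMeasure A), ‖f x‖ ≤ C) :
    essNorm A f ≤ C := by
  rw [essNorm, eLpNorm_exponent_top]
  exact ENNReal.toReal_le_of_le_ofReal hC (eLpNormEssSup_le_of_ae_bound h)

theorem ae_norm_le_essNorm {f : H → E} {C : ℝ} (h : ∀ x, ‖f x‖ ≤ C) :
    ∀ᵐ x ∂(invMeasure A), ‖f x‖ ≤ essNorm A f := by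
  have hfin : eLpNormEssSup f (invMeasure A) ≠ ⊤ :=
    ((eLpNormEssSup_le_of_ae_bound (ae_of_all _ h)).trans_lt ENNReal.ofReal_lt_top).ne
  filter_upwards [ae_le_eLpNormEssSup (f := f) (μ := invMeasure A)] with x hx
  have := ENNReal.toReal_mono hfin hx
  rwa [toReal_enorm, ← eLpNorm_exponent_top] at this

end EssNorm

/-! ### Smoothing: the gradient of `R_t φ` for bounded Borel `φ`, and the optimal constant. -/

section Gradient

variable {H : Type*} [NormedAddCommGroup H] [InnerProductSpace ℝ H] [MeasurableSpace H]
  [CompleteSpace H] [SecondCountableTopology H] [BorelSpace H]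
  {A : H →ₗ.[ℝ] H} {S Γ Qt V : ℝ → H →L[ℝ] H} {Q : H →L[ℝ] H}

theorem IsMehler.Qt_V_le (hM : IsMehler A S Γ Qt V Q) {t : ℝ} (ht : 0 < t) (h : H) :
    ⟪Qt t (V t h), V t h⟫ ≤ ((√t)⁻¹ * ‖h‖) ^ 2 := by
  rw [hM.Qt_V t ht, mul_pow, inv_pow, Real.sq_sqrt ht.le]
  exact hM.V_le t ht h

theorem IsMehler.integral_abs_mul_V_le (hM : IsMehler A S Γ Qt V Q) {t : ℝ} (ht : 0 < t)
    {φ : H → ℝ} (hφ : Measurable φ) {K : ℝ} (hK : ∀ x, |φ x| ≤ K) (x h : H) :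
    ∫ z, |φ (S t x + z) * ⟪V t h, z⟫| ∂(noise A Γ t)
      ≤ √(∫ y, φ y ^ 2 ∂(mehlerKernel A S Γ t x)) * ((√t)⁻¹ * ‖h‖) := by
  have hν := hM.isNormalLaw_noise t
  have := hν.1
  have hφ2 : MemLp (fun z => φ (S t x + z)) 2 (noise A Γ t) :=
    MemLp.of_bound (Measurable.aestronglyMeasurable (by fun_prop)) K (ae_of_all _ fun z => hK _)
  refine (integral_abs_mul_le_sqrt hφ2 (hν.memLp_inner (V t h) 2 (by simp))).trans ?_
  rw [integral_mehlerKernel, hν.integral_inner_sq]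
  gcongr
  exact Real.sqrt_le_iff.2 ⟨by positivity, hM.Qt_V_le ht h⟩

theorem IsMehler.integrable_mul_V (hM : IsMehler A S Γ Qt V Q) {t : ℝ}
    {φ : H → ℝ} (hφ : Measurable φ) {K : ℝ} (hK : ∀ x, |φ x| ≤ K) (x h : H) :
    Integrable (fun z => φ (S t x + z) * ⟪V t h, z⟫) (noise A Γ t) := by
  have hν := hM.isNormalLaw_noise t
  have := hν.1
  exact (hν.integrable_inner _).bdd_mul (c := K) (Measurable.aestronglyMeasurable (by fun_prop))
    (ae_of_all _ fun z => hK _)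

/-- Moving `x` by `h` shifts the Gaussian by `S_t h = Q_t V_t h`, so the second-order Cameron-Martin
expansion applies with error at most `K ‖h‖² / t`. This is Fréchet differentiability although `φ` is
only Borel. -/
theorem IsMehler.exists_hasGradientAt (hM : IsMehler A S Γ Qt V Q) {t : ℝ} (ht : 0 < t)
    {φ : H → ℝ} (hφ : Measurable φ) {K : ℝ} (hK : ∀ x, |φ x| ≤ K) (x : H) :
    ∃ g, HasGradientAt (ouSemigroup A t φ) g x ∧
      ∀ h, ⟪g, h⟫ = ∫ z, φ (S t x + z) * ⟪V t h, z⟫ ∂(noise A Γ t) := by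
  have hν := hM.isNormalLaw_noise t
  have := hν.1
  have hint := fun h => hM.integrable_mul_V (t := t) hφ hK x h
  let ℓ : H →ₗ[ℝ] ℝ :=
    { toFun := fun h => ∫ z, φ (S t x + z) * ⟪V t h, z⟫ ∂(noise A Γ t)
      map_add' := fun h k => by
        rw [← integral_add (hint h) (hint k)]
        simp_rw [map_add, inner_add_left, mul_add]
      map_smul' := fun c h => by
        rw [RingHom.id_apply, smul_eq_mul, ← integral_const_mul]
        refine integral_congr_ae (ae_of_all _ fun z => ?_)
        simp only [map_smul, inner_smul_left, conj_trivial]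
        ring }
  let L : H →L[ℝ] ℝ := ℓ.mkContinuous
    (√(∫ y, φ y ^ 2 ∂(mehlerKernel A S Γ t x)) * (√t)⁻¹) fun h => by
      refine (norm_integral_le_integral_norm _).trans ?_
      rw [mul_assoc]
      exact hM.integral_abs_mul_V_le ht hφ hK x h
  refine ⟨(InnerProductSpace.toDual ℝ H).symm L, ?_, fun h => by
    rw [InnerProductSpace.toDual_symm_apply]; rfl⟩
  rw [hasGradientAt_iff_hasFDerivAt, LinearIsometryEquiv.apply_symm_apply,
    hasFDerivAt_iff_isLittleO_nhds_zero]
  have hbig : (fun h => ouSemigroup A t φ (x + h) - ouSemigroup A t φ x - L h)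
      =O[𝓝 0] fun h => ‖h‖ ^ 2 := by
    refine Asymptotics.IsBigO.of_bound (K * t⁻¹) ?_
    have hsmall : ∀ᶠ h : H in 𝓝 0, ((√t)⁻¹ * ‖h‖) ^ 2 < 1 := by
      have : Tendsto (fun h : H => ((√t)⁻¹ * ‖h‖) ^ 2) (𝓝 0) (𝓝 (((√t)⁻¹ * ‖(0 : H)‖) ^ 2)) :=
        Continuous.tendsto (by fun_prop) 0
      exact this.eventually_lt_const (by simp)
    filter_upwards [hsmall] with h hh
    have hq := hM.Qt_V_le ht h
    have hq1 := hq.trans hh.le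
    have hb := hν.abs_integral_shift_sub_le (hM.Qt_symm t) (V t h) hq1
      (φ := fun z => φ (S t x + z)) (by fun_prop) (fun z => hK _)
    have hK0 : 0 ≤ K := (abs_nonneg _).trans (hK 0)
    rw [hM.ouSemigroup_eq ht.le, hM.ouSemigroup_eq ht.le, integral_mehlerKernel,
      integral_mehlerKernel, Real.norm_eq_abs, norm_pow, norm_norm]
    have e : (fun z => φ (S t (x + h) + z)) = fun z => φ (S t x + (Qt t (V t h) + z)) := by
      ext z; rw [hM.Qt_V t ht, map_add, add_assoc]
    rw [e]
    refine hb.trans ?_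
    rw [mul_assoc]
    refine mul_le_mul_of_nonneg_left (hq.trans_eq ?_) hK0
    rw [mul_pow, inv_pow, Real.sq_sqrt ht.le]
  refine hbig.trans_isLittleO ?_
  exact (Asymptotics.isLittleO_norm_pow_id one_lt_two)

theorem IsMehler.hasGradientAt (hM : IsMehler A S Γ Qt V Q) {t : ℝ} (ht : 0 < t)
    {φ : H → ℝ} (hφ : Measurable φ) {K : ℝ} (hK : ∀ x, |φ x| ≤ K) (x : H) :
    HasGradientAt (ouSemigroup A t φ) (gradient (ouSemigroup A t φ) x) x := by
  obtain ⟨g, hg, -⟩ := hM.exists_hasGradientAt ht hφ hK x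
  rwa [hg.gradient]

theorem IsMehler.inner_gradient (hM : IsMehler A S Γ Qt V Q) {t : ℝ} (ht : 0 < t)
    {φ : H → ℝ} (hφ : Measurable φ) {K : ℝ} (hK : ∀ x, |φ x| ≤ K) (x h : H) :
    ⟪gradient (ouSemigroup A t φ) x, h⟫
      = ∫ z, φ (S t x + z) * ⟪V t h, z⟫ ∂(noise A Γ t) := by
  obtain ⟨g, hg, hg'⟩ := hM.exists_hasGradientAt ht hφ hK x
  rw [hg.gradient, hg']

theorem norm_le_of_forall_inner_le {g : H} {C : ℝ} (h : ∀ v, ⟪g, v⟫ ≤ C * ‖v‖) (hC : 0 ≤ C) :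
    ‖g‖ ≤ C := by
  have h1 := h g
  rw [real_inner_self_eq_norm_sq] at h1
  by_contra! h2
  nlinarith [norm_nonneg g]

theorem IsMehler.norm_gradient_le_sqrt (hM : IsMehler A S Γ Qt V Q) {t : ℝ} (ht : 0 < t)
    {φ : H → ℝ} (hφ : Measurable φ) {K : ℝ} (hK : ∀ x, |φ x| ≤ K) (x : H) :
    ‖gradient (ouSemigroup A t φ) x‖
      ≤ √(∫ y, φ y ^ 2 ∂(mehlerKernel A S Γ t x)) * (√t)⁻¹ := by
  refine norm_le_of_forall_inner_le (fun v => ?_) (by positivity)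
  rw [hM.inner_gradient ht hφ hK, mul_assoc]
  exact ((le_abs_self _).trans (abs_integral_le_integral_abs)).trans
    (hM.integral_abs_mul_V_le ht hφ hK x v)

theorem IsMehler.sqrt_integral_sq_le (hM : IsMehler A S Γ Qt V Q) {t : ℝ} {x : H}
    {φ : H → ℝ} {K : ℝ} (hK : ∀ᵐ y ∂(mehlerKernel A S Γ t x), |φ y| ≤ K) (hK0 : 0 ≤ K) :
    √(∫ y, φ y ^ 2 ∂(mehlerKernel A S Γ t x)) ≤ K := by
  have := hM.isProbabilityMeasure_mehlerKernel t x
  refine Real.sqrt_le_iff.2 ⟨hK0, ?_⟩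
  have : ∫ y, φ y ^ 2 ∂(mehlerKernel A S Γ t x) ≤ ∫ y, K ^ 2 ∂(mehlerKernel A S Γ t x) := by
    refine integral_mono_of_nonneg (ae_of_all _ fun y => sq_nonneg _) (integrable_const _) ?_
    filter_upwards [hK] with y hy
    exact sq_le_sq' (by linarith [(abs_le.1 hy).1]) (abs_le.1 hy).2
  simpa using this

theorem IsMehler.norm_gradient_le (hM : IsMehler A S Γ Qt V Q) {t : ℝ} (ht : 0 < t)
    {φ : H → ℝ} (hφ : Measurable φ) {K : ℝ} (hK : ∀ x, |φ x| ≤ K) (x : H) {m : ℝ} (hm0 : 0 ≤ m)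
    (hm : ∀ᵐ y ∂(invMeasure A), |φ y| ≤ m) :
    ‖gradient (ouSemigroup A t φ) x‖ ≤ m * (√t)⁻¹ := by
  refine (hM.norm_gradient_le_sqrt ht hφ hK x).trans ?_
  gcongr
  exact hM.sqrt_integral_sq_le ((hM.mehlerKernel_absolutelyContinuous ht x).ae_le hm) hm0

theorem rpow_neg_half {t : ℝ} (ht : 0 < t) : t ^ (-(1 / 2) : ℝ) = (√t)⁻¹ := by
  rw [Real.rpow_neg ht.le, Real.sqrt_eq_rpow]

theorem gradConst_nonneg (A : H →ₗ.[ℝ] H) : 0 ≤ gradConst A :=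
  Real.sInf_nonneg fun _ h => h.1

/-- The optimal constant in the gradient estimate controls the first absolute moments of
`z ↦ ⟪V t h, z⟫`. -/
theorem IsMehler.integral_abs_inner_V_le (hM : IsMehler A S Γ Qt V Q) {t : ℝ} (ht : 0 < t)
    (h : H) : ∫ z, |⟪V t h, z⟫| ∂(noise A Γ t) ≤ gradConst A * ((√t)⁻¹ * ‖h‖) := by
  have hpt : 0 < (√t)⁻¹ := inv_pos.2 (Real.sqrt_pos.2 ht)
  rcases eq_or_ne h 0 with rfl | hh
  · simp
  have hk : 0 < (√t)⁻¹ * ‖h‖ := mul_pos hpt (norm_pos_iff.2 hh)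
  rw [← div_le_iff₀ hk]
  -- The set defining `gradConst` is nonempty: the Cauchy-Schwarz gradient bound makes the constant
  -- `1` admissible.
  refine le_csInf ⟨1, zero_le_one, fun s hs φ hφ x => ?_⟩ fun C hC => ?_
  · obtain ⟨K, hK⟩ := hφ.2
    rw [rpow_neg_half hs, one_mul, mul_comm]
    exact hM.norm_gradient_le hs hφ.1 hK x (essNorm_nonneg _ _) (ae_norm_le_essNorm hK)
  · rw [div_le_iff₀ hk]
    classical
    -- For the sign of `⟨V_t h, ·⟩` the gradient formula at `x = 0`, where `S_t x = 0`, returns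
    -- exactly the first absolute moment; so every admissible constant bounds this moment.
    set φ : H → ℝ := fun y => if 0 ≤ ⟪V t h, y⟫ then 1 else -1 with hφ
    have hφm : Measurable φ :=
      Measurable.ite (measurableSet_le measurable_const (by fun_prop)) measurable_const
        measurable_const
    have hφ1 : ∀ y, |φ y| ≤ 1 := fun y => by
      simp only [hφ]; split_ifs <;> simp
    have h1 := hC.2 t ht φ ⟨hφm, 1, hφ1⟩ 0
    have h2 := hM.inner_gradient ht hφm hφ1 0 h
    have e : ∫ z, |⟪V t h, z⟫| ∂(noise A Γ t) = ⟪gradient (ouSemigroup A t φ) 0, h⟫ := by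
      rw [h2]
      refine integral_congr_ae (ae_of_all _ fun z => ?_)
      simp only [map_zero, zero_add, hφ]
      split_ifs with h0
      · rw [abs_of_nonneg h0, one_mul]
      · rw [abs_of_neg (not_le.1 h0), neg_one_mul]
    rw [e]
    calc _ ≤ ‖gradient (ouSemigroup A t φ) 0‖ * ‖h‖ := real_inner_le_norm _ _
      _ ≤ (C * (√t)⁻¹ * 1) * ‖h‖ := by
        gcongr
        rw [rpow_neg_half ht] at h1
        refine h1.trans ?_
        have := hC.1
        gcongr
        exact essNorm_le zero_le_one (ae_of_all _ hφ1)
      _ = _ := by ring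

end Gradient

/-! ### The weight `e^{-lam s} s^{-1/2}` and its integral `Γ(1/2) lam^{-1/2}`. -/

section LaplaceWeight

theorem integrableOn_exp_neg_mul {lam : ℝ} (hlam : 0 < lam) :
    IntegrableOn (fun s : ℝ => Real.exp (-lam * s)) (Set.Ioi 0) :=
  exp_neg_integrableOn_Ioi 0 hlam

theorem exp_neg_mul_inv_sqrt_eq (lam : ℝ) {s : ℝ} (hs : 0 < s) :
    Real.exp (-lam * s) * (√s)⁻¹ = s ^ ((1 / 2 : ℝ) - 1) * Real.exp (-(lam * s)) := by
  rw [← rpow_neg_half hs, mul_comm, neg_mul]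
  norm_num

theorem integrableOn_exp_neg_mul_inv_sqrt {lam : ℝ} (hlam : 0 < lam) :
    IntegrableOn (fun s : ℝ => Real.exp (-lam * s) * (√s)⁻¹) (Set.Ioi 0) := by
  have h := integrableOn_rpow_mul_exp_neg_mul_rpow (p := 1) (s := (1 / 2 : ℝ) - 1) (b := lam)
    (by norm_num) one_pos hlam
  refine h.congr_fun (fun s hs => ?_) measurableSet_Ioi
  beta_reduce
  rw [exp_neg_mul_inv_sqrt_eq lam hs, Real.rpow_one, neg_mul]

theorem integral_exp_neg_mul_inv_sqrt {lam : ℝ} (hlam : 0 < lam) :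
    ∫ s in Set.Ioi (0 : ℝ), Real.exp (-lam * s) * (√s)⁻¹ = √(Real.pi / lam) := by
  rw [setIntegral_congr_fun measurableSet_Ioi fun s hs => exp_neg_mul_inv_sqrt_eq lam hs,
    Real.integral_rpow_mul_exp_neg_mul_Ioi (by norm_num) hlam, Real.Gamma_one_half_eq,
    ← Real.sqrt_eq_rpow, ← Real.sqrt_mul (by positivity), one_div_mul_eq_div]

end LaplaceWeight

/-! ### Pointwise Laplace representation of solutions and of their gradients. -/

section Representation

variable {H : Type*} [NormedAddCommGroup H] [InnerProductSpace ℝ H] [MeasurableSpace H]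
  [CompleteSpace H] [SecondCountableTopology H] [BorelSpace H]
  {A : H →ₗ.[ℝ] H} {S Γ Qt V : ℝ → H →L[ℝ] H} {Q : H →L[ℝ] H}

theorem IsMehler.measurable_mehler (hM : IsMehler A S Γ Qt V Q) (x : H) :
    Measurable fun p : ℝ × H => S p.1 x + Γ p.1 p.2 :=
  measurable_uncurry_of_continuous_of_measurable (u := fun (s : ℝ) (y : H) => S s x + Γ s y)
    (fun y => (hM.S_cont x).add (hM.Γ_cont y)) fun s => by fun_prop

theorem IsMehler.measurable_integral_mehler (hM : IsMehler A S Γ Qt V Q) {φ : H → ℝ}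
    (hφ : Measurable φ) (x : H) :
    Measurable fun s => ∫ y, φ (S s x + Γ s y) ∂(invMeasure A) := by
  have := hM.isProbabilityMeasure
  exact (StronglyMeasurable.integral_prod_right' (f := fun p : ℝ × H => φ (S p.1 x + Γ p.1 p.2))
    (hφ.comp (hM.measurable_mehler x)).stronglyMeasurable).measurable

theorem IsMehler.aestronglyMeasurable_time (hM : IsMehler A S Γ Qt V Q) {φ : H → ℝ}
    (hφ : Measurable φ) (x : H) :
    AEStronglyMeasurable (fun s => ouSemigroup A s φ x) (volume.restrict (Set.Ioi 0)) :=
  (hM.measurable_integral_mehler hφ x).aestronglyMeasurable.congr <| by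
    filter_upwards [ae_restrict_mem measurableSet_Ioi] with s hs
    rw [hM.ouSemigroup_eq_integral_invMeasure (le_of_lt hs) hφ]

theorem IsMehler.measurable_ouSemigroup (hM : IsMehler A S Γ Qt V Q) {t : ℝ} (ht : 0 ≤ t)
    {φ : H → ℝ} (hφ : Measurable φ) : Measurable (ouSemigroup A t φ) := by
  have := hM.isProbabilityMeasure
  have e : ouSemigroup A t φ = fun x => ∫ y, φ (S t x + Γ t y) ∂(invMeasure A) :=
    funext fun x => hM.ouSemigroup_eq_integral_invMeasure ht hφ x
  rw [e]
  exact (StronglyMeasurable.integral_prod_right' (f := fun p : H × H => φ (S t p.1 + Γ t p.2))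
    (by exact Measurable.stronglyMeasurable (by fun_prop))).measurable

theorem IsMehler.integrable_mehlerKernel (hM : IsMehler A S Γ Qt V Q) {t : ℝ}
    {φ : H → ℝ} (hφ : Measurable φ) {K : ℝ} (hK : ∀ x, |φ x| ≤ K) (x : H) :
    Integrable φ (mehlerKernel A S Γ t x) := by
  have := hM.isProbabilityMeasure_mehlerKernel t x
  exact Integrable.of_bound hφ.aestronglyMeasurable K (ae_of_all _ hK)

theorem IsMehler.abs_ouSemigroup_le (hM : IsMehler A S Γ Qt V Q) {t : ℝ} (ht : 0 ≤ t)
    {φ : H → ℝ} {K : ℝ} (hK : ∀ x, |φ x| ≤ K) (x : H) : |ouSemigroup A t φ x| ≤ K := by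
  have := hM.isProbabilityMeasure_mehlerKernel t x
  rw [hM.ouSemigroup_eq ht]
  simpa using norm_integral_le_of_norm_le_const (μ := mehlerKernel A S Γ t x) (f := φ) (ae_of_all _ hK)

theorem IsMehler.abs_ouSemigroup_le_of_ae (hM : IsMehler A S Γ Qt V Q) {t : ℝ} (ht : 0 < t)
    {φ : H → ℝ} {K : ℝ} (hK : ∀ᵐ x ∂(invMeasure A), |φ x| ≤ K) (x : H) :
    |ouSemigroup A t φ x| ≤ K := by
  have := hM.isProbabilityMeasure_mehlerKernel t x
  rw [hM.ouSemigroup_eq ht.le]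
  simpa using norm_integral_le_of_norm_le_const (μ := mehlerKernel A S Γ t x) (f := φ)
    ((hM.mehlerKernel_absolutelyContinuous ht x).ae_le hK)

theorem IsMehler.integrableOn_exp_mul_ouSemigroup (hM : IsMehler A S Γ Qt V Q) {lam : ℝ}
    (hlam : 0 < lam) {φ : H → ℝ} (hφ : Measurable φ) {K : ℝ} (hK : ∀ x, |φ x| ≤ K) (x : H) :
    IntegrableOn (fun s => Real.exp (-lam * s) * ouSemigroup A s φ x) (Set.Ioi 0) := by
  refine (integrableOn_exp_neg_mul hlam).mul_bdd (c := K) (hM.aestronglyMeasurable_time hφ x) ?_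
  filter_upwards [ae_restrict_mem measurableSet_Ioi] with s hs
  exact hM.abs_ouSemigroup_le (le_of_lt hs) hK x

/-- Since a kernel at positive time is continuous on `L²(μ)`, convergence in `L²(μ)` yields
convergence at each prescribed point `x`. -/
theorem IsMehler.tendsto_integral_mehlerKernel (hM : IsMehler A S Γ Qt V Q) {t : ℝ} (ht : 0 < t)
    (x : H) {ι : Type*} {l : Filter ι} {ψ : ι → H → ℝ}
    (hψ : ∀ᶠ i in l, AEStronglyMeasurable (ψ i) (invMeasure A))
    (h : Tendsto (fun i => eLpNorm (ψ i) 2 (invMeasure A)) l (𝓝 0)) :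
    Tendsto (fun i => ∫ y, ψ i y ∂(mehlerKernel A S Γ t x)) l (𝓝 0) := by
  obtain ⟨c, hc, hle⟩ := hM.exists_lintegral_enorm_le ht x
  -- Replacing `c` by `min c 1` makes the divisor finite, while it stays nonzero.
  have h1 : Tendsto (fun i => eLpNorm (ψ i) 2 (invMeasure A) ^ 2 / min c 1) l (𝓝 0) := by
    have := ENNReal.Tendsto.div_const (ENNReal.Tendsto.pow (n := 2) h) (b := min c 1)
      (Or.inr (by simp [hc]))
    simpa using this
  have h2 : Tendsto (fun i => (∫⁻ y, ‖ψ i y‖ₑ ∂(mehlerKernel A S Γ t x)) ^ 2) l (𝓝 0) := by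
    refine tendsto_of_tendsto_of_tendsto_of_le_of_le' tendsto_const_nhds h1
      (Eventually.of_forall fun _ => zero_le) ?_
    filter_upwards [hψ] with i hi
    rw [ENNReal.le_div_iff_mul_le (Or.inl (by simp [hc])) (Or.inl (by simp))]
    exact (mul_le_mul_right (min_le_left c 1) _).trans (hle _ hi)
  have h3 : Tendsto (fun i => ∫⁻ y, ‖ψ i y‖ₑ ∂(mehlerKernel A S Γ t x)) l (𝓝 0) := by
    have := (ENNReal.continuous_rpow_const (y := (1 / 2 : ℝ))).tendsto 0 |>.comp h2
    simp only [Function.comp_def, ← ENNReal.rpow_natCast, ← ENNReal.rpow_mul] at this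
    norm_num at this
    exact this
  rw [tendsto_zero_iff_enorm_tendsto_zero]
  exact tendsto_of_tendsto_of_tendsto_of_le_of_le tendsto_const_nhds h3 (fun _ => zero_le)
    fun i => enorm_integral_le_lintegral_enorm _

theorem IsC1b.measurable {u : H → ℝ} (hu : IsC1b u) : Measurable u := hu.1.continuous.measurable

theorem IsMehler.continuous_integral_mehler (hM : IsMehler A S Γ Qt V Q) {u : H → ℝ}
    (hu : IsC1b u) (x : H) : Continuous fun s => ∫ y, u (S s x + Γ s y) ∂(invMeasure A) := by
  have := hM.isProbabilityMeasure
  obtain ⟨C, hC⟩ := hu.2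
  have hm := hu.measurable
  exact continuous_of_dominated (bound := fun _ => C)
    (fun s => Measurable.aestronglyMeasurable (by fun_prop)) (fun s => ae_of_all _ fun y => (hC _).1)
    (integrable_const _)
    (ae_of_all _ fun y => hu.1.continuous.comp ((hM.S_cont x).add (hM.Γ_cont y)))

variable {u g Lu : H → ℝ} {lam K : ℝ}

/-- The generator is only an `L²` limit of difference quotients. Applying `R_s` with `s > 0` turns
it into a limit at the point `x`, but only from the right in time. -/
theorem IsMehler.hasDerivWithinAt_ouSemigroup (hM : IsMehler A S Γ Qt V Q) (hu : IsC1b u)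
    (hL : HasL2Generator A u Lu) (hg : Measurable g) (hK : ∀ x, |g x| ≤ K)
    (heq : ∀ᵐ x ∂(invMeasure A), lam * u x - Lu x = g x) {s : ℝ} (hs : 0 < s) (x : H) :
    HasDerivWithinAt (fun s => ouSemigroup A s u x)
      (lam * ouSemigroup A s u x - ouSemigroup A s g x) (Set.Ioi s) s := by
  have := hM.isProbabilityMeasure_mehlerKernel s x
  obtain ⟨C, hC⟩ := hu.2
  have hCu : ∀ x, |u x| ≤ C := fun x => (hC x).1
  have hum := hu.measurable
  have h0 : Tendsto (fun t : ℝ => eLpNorm (fun x => t⁻¹ * (ouSemigroup A t u x - u x)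
      - (lam * u x - g x)) 2 (invMeasure A)) (𝓝[>] 0) (𝓝 0) := by
    refine hL.2.2.congr fun t => eLpNorm_congr_ae ?_
    filter_upwards [heq] with x hx
    linarith
  have hmt : ∀ᶠ t : ℝ in 𝓝[>] 0, Measurable (ouSemigroup A t u) := by
    filter_upwards [self_mem_nhdsWithin] with t ht
    exact hM.measurable_ouSemigroup (le_of_lt ht) hum
  have h1 := hM.tendsto_integral_mehlerKernel hs x (by
    filter_upwards [hmt] with t ht
    exact Measurable.aestronglyMeasurable (by fun_prop)) h0
  have h2 : Tendsto (fun t : ℝ => t⁻¹ * (ouSemigroup A (s + t) u x - ouSemigroup A s u x))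
      (𝓝[>] 0) (𝓝 (lam * ouSemigroup A s u x - ouSemigroup A s g x)) := by
    have h3 := h1.add_const (lam * ouSemigroup A s u x - ouSemigroup A s g x)
    rw [zero_add] at h3
    refine h3.congr' ?_
    filter_upwards [self_mem_nhdsWithin, hmt] with t ht htm
    have i1 := hM.integrable_mehlerKernel (t := s) htm
      (fun y => hM.abs_ouSemigroup_le (le_of_lt ht) hCu y) x
    have i2 := hM.integrable_mehlerKernel (t := s) hum hCu x
    have i3 := hM.integrable_mehlerKernel (t := s) hg hK x
    rw [integral_sub (f := fun y => t⁻¹ * (ouSemigroup A t u y - u y)) (g := fun y => lam * u y - g y)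
      ((i1.sub i2).const_mul _) ((i2.const_mul _).sub i3), integral_const_mul,
      integral_sub i1 i2, integral_sub (i2.const_mul _) i3, integral_const_mul,
      ← hM.ouSemigroup_add hs.le (le_of_lt ht) hum hCu, ← hM.ouSemigroup_eq hs.le,
      ← hM.ouSemigroup_eq hs.le]
    ring
  rw [hasDerivWithinAt_iff_tendsto_slope' (by simp)]
  have h4 : Tendsto (fun r => r - s) (𝓝[>] s) (𝓝[>] 0) := by
    refine tendsto_nhdsWithin_iff.2 ⟨?_, ?_⟩
    · have : Tendsto (fun r => r - s) (𝓝 s) (𝓝 (s - s)) := Continuous.tendsto (by fun_prop) s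
      rw [sub_self] at this
      exact this.mono_left nhdsWithin_le_nhds
    · filter_upwards [self_mem_nhdsWithin] with r hr
      exact sub_pos.2 (Set.mem_Ioi.1 hr)
  refine (h2.comp h4).congr fun r => ?_
  simp [slope_def_field, div_eq_inv_mul]

/-- The Laplace transform representation of solutions of `lam u - L u = g`, at every point. -/
theorem IsMehler.eq_integral_ouSemigroup (hM : IsMehler A S Γ Qt V Q) (hlam : 0 < lam)
    (hu : IsC1b u) (hL : HasL2Generator A u Lu) (hg : Measurable g) (hK : ∀ x, |g x| ≤ K)
    (heq : ∀ᵐ x ∂(invMeasure A), lam * u x - Lu x = g x) (x : H) :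
    u x = ∫ s in Set.Ioi (0 : ℝ), Real.exp (-lam * s) * ouSemigroup A s g x := by
  have := hM.isProbabilityMeasure
  obtain ⟨C, hC⟩ := hu.2
  have hCu : ∀ x, |u x| ≤ C := fun x => (hC x).1
  have hcont := hM.continuous_integral_mehler hu x
  have hFe : ∀ s, 0 ≤ s → ∫ y, u (S s x + Γ s y) ∂(invMeasure A) = ouSemigroup A s u x :=
    fun s hs => (hM.ouSemigroup_eq_integral_invMeasure hs hu.measurable x).symm
  -- `F(s) = e^{-lam s} R_s u(x)` has right derivative `-e^{-lam s} R_s g(x)` for `s > 0`. In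
  -- Mehler's form it is continuous up to `s = 0` with `F(0) = u(x)`, and the fundamental theorem of
  -- calculus needs no more than that.
  set F : ℝ → ℝ := fun s => Real.exp (-lam * s) * ∫ y, u (S s x + Γ s y) ∂(invMeasure A) with hF
  have hint := hM.integrableOn_exp_mul_ouSemigroup hlam hg hK x
  have hF0 : F 0 = u x := by simp [hF, hM.S_zero, hM.Γ_zero]
  have hFTC : ∀ T : ℝ, 0 < T → ∫ s in (0 : ℝ)..T, -(Real.exp (-lam * s) * ouSemigroup A s g x)
      = F T - u x := by
    intro T hT
    rw [← hF0]
    refine intervalIntegral.integral_eq_sub_of_hasDeriv_right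
      (Continuous.continuousOn (by fun_prop)) (fun s hs => ?_) ?_
    · rw [min_eq_left hT.le, max_eq_right hT.le] at hs
      have h1 := hM.hasDerivWithinAt_ouSemigroup hu hL hg hK heq hs.1 x
      have h2 : HasDerivWithinAt (fun s => ∫ y, u (S s x + Γ s y) ∂(invMeasure A))
          (lam * ouSemigroup A s u x - ouSemigroup A s g x) (Set.Ioi s) s :=
        h1.congr (fun r hr => hFe r (hs.1.trans hr).le) (hFe s hs.1.le)
      have h3 : HasDerivWithinAt (fun s : ℝ => Real.exp (-lam * s))
          (Real.exp (-lam * s) * (-lam)) (Set.Ioi s) s := by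
        have := ((hasDerivAt_id s).const_mul (-lam)).exp
        simpa using this.hasDerivWithinAt
      refine (h3.mul h2).congr_deriv ?_
      rw [hFe s hs.1.le]
      ring
    · rw [intervalIntegrable_iff_integrableOn_Ioc_of_le hT.le]
      exact (hint.mono_set Set.Ioc_subset_Ioi_self).neg
  have h1 : Tendsto (fun T : ℝ => ∫ s in (0 : ℝ)..T, -(Real.exp (-lam * s) * ouSemigroup A s g x))
      atTop (𝓝 (∫ s in Set.Ioi (0 : ℝ), -(Real.exp (-lam * s) * ouSemigroup A s g x))) :=
    intervalIntegral_tendsto_integral_Ioi 0 hint.neg tendsto_id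
  have h2 : Tendsto (fun T : ℝ => F T - u x) atTop (𝓝 (0 - u x)) := by
    refine Tendsto.sub_const ?_ _
    have he : Tendsto (fun T : ℝ => Real.exp (-lam * T) * C) atTop (𝓝 0) := by
      have : Tendsto (fun T : ℝ => -lam * T) atTop atBot :=
        tendsto_id.const_mul_atTop_of_neg (by linarith)
      simpa using (Real.tendsto_exp_atBot.comp this).mul_const C
    refine squeeze_zero_norm' ?_ he
    filter_upwards [eventually_ge_atTop 0] with T hT
    rw [hF, norm_mul, Real.norm_of_nonneg (Real.exp_pos _).le]
    gcongr
    simpa using norm_integral_le_of_norm_le_const (μ := invMeasure A)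
      (f := fun y => u (S T x + Γ T y)) (ae_of_all _ fun y => hCu _)
  have h3 := tendsto_nhds_unique (h1.congr' (by
    filter_upwards [eventually_gt_atTop 0] with T hT using hFTC T hT)) h2
  rw [integral_neg] at h3
  linarith

theorem IsMehler.abs_ouSemigroup_sub_le (hM : IsMehler A S Γ Qt V Q) {t : ℝ} (ht : 0 < t)
    (hg : Measurable g) (hK : ∀ x, |g x| ≤ K) (x y : H) :
    |ouSemigroup A t g y - ouSemigroup A t g x| ≤ K * (√t)⁻¹ * ‖y - x‖ := by
  have hK0 : 0 ≤ K := (abs_nonneg _).trans (hK 0)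
  refine convex_univ.norm_image_sub_le_of_norm_hasFDerivWithin_le
    (fun z _ => (hM.hasGradientAt ht hg hK z).hasFDerivAt.hasFDerivWithinAt) (fun z _ => ?_)
    (Set.mem_univ _) (Set.mem_univ _)
  rw [LinearIsometryEquiv.norm_map]
  exact hM.norm_gradient_le ht hg hK z hK0 (ae_of_all _ hK)

/-- Differentiation under the Laplace integral: `R_s g` is Lipschitz with constant `K s^{-1/2}`, so
the difference quotients are dominated by a multiple of `e^{-lam s} s^{-1/2}`, integrable at zero.
-/
theorem IsMehler.inner_gradient_eq_integral (hM : IsMehler A S Γ Qt V Q) (hlam : 0 < lam)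
    (hu : IsC1b u) (hL : HasL2Generator A u Lu) (hg : Measurable g) (hK : ∀ x, |g x| ≤ K)
    (heq : ∀ᵐ x ∂(invMeasure A), lam * u x - Lu x = g x) (x h : H) :
    ⟪gradient u x, h⟫
      = ∫ s in Set.Ioi (0 : ℝ), Real.exp (-lam * s) * ⟪gradient (ouSemigroup A s g) x, h⟫ := by
  have h1 : Tendsto (fun r : ℝ => r⁻¹ • (u (x + r • h) - u x)) (𝓝[≠] 0) (𝓝 ⟪gradient u x, h⟫) := by
    have := ((hu.1.differentiable (by norm_num)) x).hasGradientAt.hasFDerivAt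
    exact (this.hasLineDerivAt h).tendsto_slope_zero
  refine tendsto_nhds_unique h1 ?_
  have e : ∀ r : ℝ, r⁻¹ • (u (x + r • h) - u x) = ∫ s in Set.Ioi (0 : ℝ),
      Real.exp (-lam * s) * (r⁻¹ • (ouSemigroup A s g (x + r • h) - ouSemigroup A s g x)) := by
    intro r
    rw [hM.eq_integral_ouSemigroup hlam hu hL hg hK heq x,
      hM.eq_integral_ouSemigroup hlam hu hL hg hK heq (x + r • h),
      ← integral_sub (hM.integrableOn_exp_mul_ouSemigroup hlam hg hK _)
        (hM.integrableOn_exp_mul_ouSemigroup hlam hg hK _), ← integral_smul]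
    refine integral_congr_ae (ae_of_all _ fun s => ?_)
    simp only [smul_eq_mul]
    ring
  simp_rw [e]
  refine tendsto_integral_filter_of_dominated_convergence
    (fun s => Real.exp (-lam * s) * (√s)⁻¹ * (K * ‖h‖)) (Eventually.of_forall fun r => ?_) ?_
    ((integrableOn_exp_neg_mul_inv_sqrt hlam).mul_const _) ?_
  · exact (Continuous.aestronglyMeasurable (by fun_prop)).mul
      (((hM.aestronglyMeasurable_time hg (x + r • h)).sub
        (hM.aestronglyMeasurable_time hg x)).const_smul r⁻¹)
  · filter_upwards [self_mem_nhdsWithin] with r hr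
    filter_upwards [ae_restrict_mem measurableSet_Ioi] with s hs
    have hb := hM.abs_ouSemigroup_sub_le hs hg hK x (x + r • h)
    rw [add_sub_cancel_left, norm_smul] at hb
    have hr' : 0 < ‖r‖ := norm_pos_iff.2 hr
    rw [norm_mul, norm_smul, norm_inv, Real.norm_of_nonneg (Real.exp_pos _).le, mul_assoc]
    refine mul_le_mul_of_nonneg_left ?_ (Real.exp_pos _).le
    rw [inv_mul_le_iff₀ hr', Real.norm_eq_abs]
    refine hb.trans_eq ?_
    ring
  · filter_upwards [ae_restrict_mem measurableSet_Ioi] with s hs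
    have := (hM.hasGradientAt hs hg hK x).hasFDerivAt
    exact ((this.hasLineDerivAt h).tendsto_slope_zero).const_mul _

end Representation

/-! ### The Dirichlet form and the energy inequality. -/

section Energy

variable {H : Type*} [NormedAddCommGroup H] [InnerProductSpace ℝ H] [MeasurableSpace H]
  [CompleteSpace H] [SecondCountableTopology H] [BorelSpace H]
  {A : H →ₗ.[ℝ] H} {S Γ Qt V : ℝ → H →L[ℝ] H} {Q : H →L[ℝ] H}
  {u w c Lu : H → ℝ}

theorem continuous_gradient (hw : ContDiff ℝ 1 w) : Continuous (gradient w) :=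
  (InnerProductSpace.toDual ℝ H).symm.continuous.comp (hw.continuous_fderiv (by norm_num))

theorem IsMehler.integral_prod_comm (hM : IsMehler A S Γ Qt V Q) (t : ℝ) {a b : H → ℝ}
    (ha : Measurable a) (hb : Measurable b) :
    ∫ p : H × H, a p.1 * b (S t p.1 + Γ t p.2) ∂((invMeasure A).prod (invMeasure A))
      = ∫ p : H × H, a (S t p.1 + Γ t p.2) * b p.1 ∂((invMeasure A).prod (invMeasure A)) := by
  have h := congrArg (fun ρ : Measure (H × H) => ∫ q, a q.1 * b q.2 ∂ρ) (hM.map_prod_symm t)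
  rwa [integral_map (by fun_prop) (Measurable.aestronglyMeasurable (by fun_prop)),
    integral_map (by fun_prop) (Measurable.aestronglyMeasurable (by fun_prop))] at h

theorem IsMehler.integral_prod_comp (hM : IsMehler A S Γ Qt V Q) (t : ℝ) {a : H → ℝ}
    (ha : Measurable a) :
    ∫ p : H × H, a (S t p.1 + Γ t p.2) ∂((invMeasure A).prod (invMeasure A))
      = ∫ x, a x ∂(invMeasure A) := by
  conv_rhs => rw [← hM.map_prod_eq t]
  rw [integral_map (by fun_prop) ha.aestronglyMeasurable]

theorem IsMehler.integral_ouSemigroup_mul (hM : IsMehler A S Γ Qt V Q) {t : ℝ} (ht : 0 ≤ t)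
    (hu : Measurable u) {K : ℝ} (hK : ∀ x, |u x| ≤ K) (hc : Measurable c) (hK' : ∀ x, |c x| ≤ K) :
    ∫ x, ouSemigroup A t u x * c x ∂(invMeasure A)
      = ∫ p : H × H, u (S t p.1 + Γ t p.2) * c p.1 ∂((invMeasure A).prod (invMeasure A)) := by
  have := hM.isProbabilityMeasure
  rw [integral_prod]
  · refine integral_congr_ae (ae_of_all _ fun x => ?_)
    simp only [integral_mul_const]
    rw [hM.ouSemigroup_eq_integral_invMeasure ht hu]
  · refine Integrable.of_bound (Measurable.aestronglyMeasurable (by fun_prop)) (K * K)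
      (ae_of_all _ fun p => ?_)
    rw [norm_mul]
    exact mul_le_mul (hK _) (hK' _) (norm_nonneg _) ((abs_nonneg _).trans (hK 0))

/-- The Dirichlet form of the Ornstein-Uhlenbeck semigroup. -/
theorem IsMehler.integral_sub_ouSemigroup_mul (hM : IsMehler A S Γ Qt V Q) {t : ℝ} (ht : 0 ≤ t)
    (hu : Measurable u) {K : ℝ} (hK : ∀ x, |u x| ≤ K) (hc : Measurable c) (hK' : ∀ x, |c x| ≤ K) :
    ∫ x, (u x - ouSemigroup A t u x) * c x ∂(invMeasure A)
      = 2⁻¹ * ∫ p : H × H, (u p.1 - u (S t p.1 + Γ t p.2)) * (c p.1 - c (S t p.1 + Γ t p.2))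
        ∂((invMeasure A).prod (invMeasure A)) := by
  have := hM.isProbabilityMeasure
  have hb : ∀ x y, ‖u x * c y‖ ≤ K * K := fun x y => by
    rw [norm_mul]
    exact mul_le_mul (hK _) (hK' _) (norm_nonneg _) ((abs_nonneg _).trans (hK 0))
  have i1 : Integrable (fun p : H × H => u p.1 * c p.1)
      ((invMeasure A).prod (invMeasure A)) := Integrable.of_bound
    (Measurable.aestronglyMeasurable (by fun_prop)) (K * K) (ae_of_all _ fun p => hb _ _)
  have i2 : Integrable (fun p : H × H => u p.1 * c (S t p.1 + Γ t p.2))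
      ((invMeasure A).prod (invMeasure A)) := Integrable.of_bound
    (Measurable.aestronglyMeasurable (by fun_prop)) (K * K) (ae_of_all _ fun p => hb _ _)
  have i3 : Integrable (fun p : H × H => u (S t p.1 + Γ t p.2) * c p.1)
      ((invMeasure A).prod (invMeasure A)) := Integrable.of_bound
    (Measurable.aestronglyMeasurable (by fun_prop)) (K * K) (ae_of_all _ fun p => hb _ _)
  have i4 : Integrable (fun p : H × H => u (S t p.1 + Γ t p.2) * c (S t p.1 + Γ t p.2))
      ((invMeasure A).prod (invMeasure A)) := Integrable.of_bound
    (Measurable.aestronglyMeasurable (by fun_prop)) (K * K) (ae_of_all _ fun p => hb _ _)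
  have e : ∀ p : H × H, (u p.1 - u (S t p.1 + Γ t p.2)) * (c p.1 - c (S t p.1 + Γ t p.2))
      = (u p.1 * c p.1 - u p.1 * c (S t p.1 + Γ t p.2))
        - (u (S t p.1 + Γ t p.2) * c p.1 - u (S t p.1 + Γ t p.2) * c (S t p.1 + Γ t p.2)) :=
    fun p => by ring
  simp_rw [e]
  have e1 : ∫ p : H × H, u p.1 * c p.1 ∂((invMeasure A).prod (invMeasure A))
      = ∫ x, u x * c x ∂(invMeasure A) := by
    rw [integral_fun_fst (fun x => u x * c x)]; simp
  have e2 := hM.integral_prod_comp t (a := fun x => u x * c x) (by fun_prop)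
  have hR := hM.measurable_ouSemigroup ht hu
  have i5 : Integrable (fun x => u x * c x) (invMeasure A) := Integrable.of_bound
    (Measurable.aestronglyMeasurable (by fun_prop)) (K * K) (ae_of_all _ fun p => hb _ _)
  have i6 : Integrable (fun x => ouSemigroup A t u x * c x) (invMeasure A) := by
    refine Integrable.of_bound (Measurable.aestronglyMeasurable (by fun_prop)) (K * K)
      (ae_of_all _ fun x => ?_)
    rw [norm_mul]
    exact mul_le_mul (hM.abs_ouSemigroup_le ht hK x) (hK' _) (norm_nonneg _)
      ((abs_nonneg _).trans (hK 0))
  have e3 := integral_sub (i1.sub i2) (i3.sub i4)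
  simp only [Pi.sub_apply] at e3
  rw [e3, integral_sub i1 i2, integral_sub i3 i4, e1, e2,
    hM.integral_prod_comm t hu hc, ← hM.integral_ouSemigroup_mul ht hu hK hc hK']
  simp_rw [sub_mul]
  rw [integral_sub i5 i6]
  ring

/-- The gradient of `R_t w`, in the form `∫ ∇w(e^{tA} x + z) N(0, Q_t)(dz)`. -/
noncomputable def meanGradient (A : H →ₗ.[ℝ] H) (S Γ : ℝ → H →L[ℝ] H) (w : H → ℝ) (t : ℝ) (x : H) :
    H := ∫ y, gradient w (S t x + Γ t y) ∂(invMeasure A)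

/-- A lower bound of variance type: the square of `w - a - ⟨g, ·⟩`, with `g` the mean gradient, has
nonnegative integral, and Gaussian integration by parts evaluates the cross term as `⟨Q_t g, g⟩`. -/
theorem IsMehler.le_integral_sub_sq (hM : IsMehler A S Γ Qt V Q) (hw : IsC1b w) (t : ℝ) (x : H)
    (a : ℝ) :
    ⟪Qt t (meanGradient A S Γ w t x), meanGradient A S Γ w t x⟫
      ≤ ∫ y, (a - w (S t x + Γ t y)) ^ 2 ∂(invMeasure A) := by
  have := hM.isProbabilityMeasure
  have hν := hM.isNormalLaw_noise t
  have := hν.1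
  obtain ⟨C, hC⟩ := hw.2
  have hwm := hw.measurable
  have hgc := continuous_gradient hw.1
  have hg : meanGradient A S Γ w t x = ∫ z, gradient w (S t x + z) ∂(noise A Γ t) := by
    rw [noise, integral_map (by fun_prop) (by fun_prop)]
    rfl
  set g := meanGradient A S Γ w t x with hgdef
  have e1 : ∫ z, w (S t x + z) * ⟪g, z⟫ ∂(noise A Γ t) = ⟪Qt t g, g⟫ := by
    rw [hν.integral_mul_inner_eq (hM.Qt_symm t) (S t x) g hw.1 (fun x => (hC x).1)
      (fun x => (hC x).2)]
    simp_rw [real_inner_comm (Qt t g)]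
    rw [integral_inner, ← hg]
    exact Integrable.of_bound (by fun_prop) C (ae_of_all _ fun z => (hC _).2)
  have e2 : ∫ y, (a - w (S t x + Γ t y)) ^ 2 ∂(invMeasure A)
      = ∫ z, (a - w (S t x + z)) ^ 2 ∂(noise A Γ t) := by
    rw [noise, integral_map (by fun_prop) (Measurable.aestronglyMeasurable (by fun_prop))]
  have i1 : Integrable (fun z => (a - w (S t x + z)) ^ 2) (noise A Γ t) := by
    refine Integrable.of_bound (Measurable.aestronglyMeasurable (by fun_prop)) ((|a| + C) ^ 2)
      (ae_of_all _ fun z => ?_)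
    rw [norm_pow]
    refine pow_le_pow_left₀ (norm_nonneg _) ?_ 2
    exact (norm_sub_le _ _).trans (add_le_add le_rfl (hC _).1)
  have i2 : Integrable (fun z => w (S t x + z) * ⟪g, z⟫) (noise A Γ t) :=
    (hν.integrable_inner _).bdd_mul (c := C) (Measurable.aestronglyMeasurable (by fun_prop))
      (ae_of_all _ fun z => (hC _).1)
  have i3 := hν.integrable_inner g
  have i4 := (hν.memLp_inner g 2 (by simp)).integrable_sq
  have h0 : 0 ≤ ∫ z, (w (S t x + z) - a - ⟪g, z⟫) ^ 2 ∂(noise A Γ t) :=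
    integral_nonneg fun z => sq_nonneg _
  have e : ∀ z, (w (S t x + z) - a - ⟪g, z⟫) ^ 2 = ((a - w (S t x + z)) ^ 2
      - 2 * (w (S t x + z) * ⟪g, z⟫)) + (2 * a * ⟪g, z⟫ + ⟪g, z⟫ ^ 2) := fun z => by ring
  simp_rw [e] at h0
  rw [integral_add (f := fun z => (a - w (S t x + z)) ^ 2 - 2 * (w (S t x + z) * ⟪g, z⟫))
      (g := fun z => 2 * a * ⟪g, z⟫ + ⟪g, z⟫ ^ 2) (i1.sub (i2.const_mul 2))
      ((i3.const_mul _).add i4),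
    integral_sub i1 (i2.const_mul 2), integral_add (i3.const_mul _) i4, integral_const_mul,
    integral_const_mul, e1, hν.integral_inner, hν.integral_inner_sq] at h0
  rw [e2]
  linarith

theorem norm_meanGradient_le [IsProbabilityMeasure (invMeasure A)] {C : ℝ}
    (hC : ∀ x, ‖gradient w x‖ ≤ C) (t : ℝ) (x : H) : ‖meanGradient A S Γ w t x‖ ≤ C := by
  simpa [meanGradient] using norm_integral_le_of_norm_le_const (μ := invMeasure A)
    (f := fun y => gradient w (S t x + Γ t y)) (ae_of_all _ fun y => hC _)

theorem IsMehler.tendsto_meanGradient (hM : IsMehler A S Γ Qt V Q) (hw : IsC1b w) (x : H) :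
    Tendsto (fun t => meanGradient A S Γ w t x) (𝓝[>] 0) (𝓝 (gradient w x)) := by
  have := hM.isProbabilityMeasure
  obtain ⟨C, hC⟩ := hw.2
  have hgc := continuous_gradient hw.1
  have h : Continuous fun t => meanGradient A S Γ w t x :=
    continuous_of_dominated (bound := fun _ => C)
      (fun s => Continuous.aestronglyMeasurable (by fun_prop))
      (fun s => ae_of_all _ fun y => (hC _).2) (integrable_const _)
      (ae_of_all _ fun y => hgc.comp ((hM.S_cont x).add (hM.Γ_cont y)))
  have h0 : meanGradient A S Γ w 0 x = gradient w x := by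
    simp [meanGradient, hM.S_zero, hM.Γ_zero]
  rw [← h0]
  exact (h.tendsto 0).mono_left nhdsWithin_le_nhds

theorem measurable_meanGradient [IsProbabilityMeasure (invMeasure A)] (hw : IsC1b w) (t : ℝ) :
    StronglyMeasurable fun x => meanGradient A S Γ w t x := by
  have hgc := continuous_gradient hw.1
  exact StronglyMeasurable.integral_prod_right'
    (f := fun p : H × H => gradient w (S t p.1 + Γ t p.2))
    (Continuous.stronglyMeasurable (by fun_prop))

/-- For short times `Q_t / t` is a contraction tending strongly to the identity, and the mean
gradient tends to the gradient; dominated convergence does the rest. -/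
theorem IsMehler.tendsto_integral_inner_meanGradient (hM : IsMehler A S Γ Qt V Q)
    (hw : IsC1b w) :
    Tendsto (fun t => ∫ x, ⟪t⁻¹ • Qt t (meanGradient A S Γ w t x), meanGradient A S Γ w t x⟫
      ∂(invMeasure A)) (𝓝[>] 0) (𝓝 (∫ x, ‖gradient w x‖ ^ 2 ∂(invMeasure A))) := by
  have := hM.isProbabilityMeasure
  obtain ⟨C, hC⟩ := hw.2
  have hCg : ∀ x, ‖gradient w x‖ ≤ C := fun x => (hC x).2
  refine tendsto_integral_filter_of_dominated_convergence (fun _ => C * C)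
    (Eventually.of_forall fun t => ?_) ?_ (integrable_const _) (ae_of_all _ fun x => ?_)
  · have h := (measurable_meanGradient (A := A) (S := S) (Γ := Γ) hw t).aestronglyMeasurable
      (μ := invMeasure A)
    exact AEStronglyMeasurable.inner
      (((Qt t).continuous.comp_aestronglyMeasurable h).const_smul t⁻¹) h
  · filter_upwards [self_mem_nhdsWithin] with t ht
    refine ae_of_all _ fun x => (norm_inner_le_norm _ _).trans ?_
    have h := norm_meanGradient_le (A := A) (S := S) (Γ := Γ) hCg t x
    exact mul_le_mul ((hM.Qt_norm_le t ht _).trans h) h (norm_nonneg _)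
      ((norm_nonneg _).trans h)
  · have h1 := hM.tendsto_meanGradient hw x
    have h2 : Tendsto (fun t => t⁻¹ • Qt t (meanGradient A S Γ w t x)) (𝓝[>] 0)
        (𝓝 (gradient w x)) := by
      have h3 := hM.Qt_tendsto (gradient w x)
      have h4 : Tendsto (fun t => t⁻¹ • Qt t (meanGradient A S Γ w t x - gradient w x)) (𝓝[>] 0)
          (𝓝 0) := by
        refine squeeze_zero_norm' ?_ (tendsto_iff_norm_sub_tendsto_zero.1 h1)
        filter_upwards [self_mem_nhdsWithin] with t ht
        exact hM.Qt_norm_le t ht _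
      have h5 := h4.add h3
      rw [zero_add] at h5
      refine h5.congr fun t => ?_
      rw [map_sub, smul_sub, sub_add_cancel]
    have := h2.inner (𝕜 := ℝ) h1
    rwa [real_inner_self_eq_norm_sq] at this

theorem tendsto_integral_mul_of_eLpNorm {α : Type*} {mα : MeasurableSpace α} {μ : Measure α}
    [IsProbabilityMeasure μ] {ι : Type*} {l : Filter ι} {ψ : ι → α → ℝ}
    (hψ : ∀ᶠ i in l, AEStronglyMeasurable (ψ i) μ)
    (h : Tendsto (fun i => eLpNorm (ψ i) 2 μ) l (𝓝 0)) {c : α → ℝ} {C : ℝ}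
    (hC : ∀ x, |c x| ≤ C) :
    Tendsto (fun i => ∫ x, ψ i x * c x ∂μ) l (𝓝 0) := by
  have h1 : Tendsto (fun i => eLpNorm (ψ i) 2 μ * ENNReal.ofReal C) l (𝓝 0) := by
    have := ENNReal.Tendsto.mul_const (b := ENNReal.ofReal C) h (Or.inr ENNReal.ofReal_ne_top)
    rwa [zero_mul] at this
  rw [tendsto_zero_iff_enorm_tendsto_zero]
  refine tendsto_of_tendsto_of_tendsto_of_le_of_le' tendsto_const_nhds h1
    (Eventually.of_forall fun _ => zero_le) ?_
  filter_upwards [hψ] with i hi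
  calc ‖∫ x, ψ i x * c x ∂μ‖ₑ ≤ ∫⁻ x, ‖ψ i x * c x‖ₑ ∂μ := enorm_integral_le_lintegral_enorm _
    _ ≤ ∫⁻ x, ‖ψ i x‖ₑ * ENNReal.ofReal C ∂μ := by
        refine lintegral_mono fun x => ?_
        rw [enorm_mul]
        gcongr
        rw [← ofReal_norm]
        exact ENNReal.ofReal_le_ofReal (hC x)
    _ = eLpNorm (ψ i) 1 μ * ENNReal.ofReal C := by
        rw [lintegral_mul_const' _ _ ENNReal.ofReal_ne_top, eLpNorm_one_eq_lintegral_enorm]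
    _ ≤ _ := by
        gcongr
        exact eLpNorm_le_eLpNorm_of_exponent_le (by norm_num) hi

/-- Energy inequality for the Ornstein-Uhlenbeck generator. -/
theorem IsMehler.energy_le (hM : IsMehler A S Γ Qt V Q) (hu : IsC1b u)
    (hL : HasL2Generator A u Lu) (hw : IsC1b w) (hc : Measurable c) {C : ℝ}
    (hC : ∀ x, |c x| ≤ C) (h : ∀ x y, (w x - w y) ^ 2 ≤ (u x - u y) * (c x - c y)) :
    2⁻¹ * ∫ x, ‖gradient w x‖ ^ 2 ∂(invMeasure A) ≤ -∫ x, Lu x * c x ∂(invMeasure A) := by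
  have := hM.isProbabilityMeasure
  obtain ⟨Cu, hCu⟩ := hu.2
  obtain ⟨Cw, hCw⟩ := hw.2
  have hum := hu.measurable
  have hwm := hw.measurable
  set K := max C Cu
  have hcK : ∀ x, |c x| ≤ K := fun x => (hC x).trans (le_max_left _ _)
  have huK : ∀ x, |u x| ≤ K := fun x => (hCu x).1.trans (le_max_right _ _)
  have hmt : ∀ᶠ t : ℝ in 𝓝[>] 0, Measurable (ouSemigroup A t u) := by
    filter_upwards [self_mem_nhdsWithin] with t ht
    exact hM.measurable_ouSemigroup (le_of_lt ht) hum
  have hLm := hL.2.1.1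
  have iL : Integrable (fun x => Lu x * c x) (invMeasure A) :=
    (hL.2.1.integrable (by norm_num)).mul_bdd (c := C) hc.aestronglyMeasurable (ae_of_all _ hC)
  have h1 : Tendsto (fun t => t⁻¹ * ∫ x, (u x - ouSemigroup A t u x) * c x ∂(invMeasure A))
      (𝓝[>] 0) (𝓝 (-∫ x, Lu x * c x ∂(invMeasure A))) := by
    have h2 := tendsto_integral_mul_of_eLpNorm (by
      filter_upwards [hmt] with t ht
      exact (Measurable.aestronglyMeasurable
        (f := fun x => t⁻¹ * (ouSemigroup A t u x - u x)) (by fun_prop)).sub hLm) hL.2.2 hC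
    have h3 := (h2.add_const (∫ x, Lu x * c x ∂(invMeasure A))).neg
    rw [zero_add] at h3
    refine h3.congr' ?_
    filter_upwards [hmt, self_mem_nhdsWithin] with t ht ht0
    have i1 : Integrable (fun x => (u x - ouSemigroup A t u x) * c x) (invMeasure A) := by
      refine Integrable.of_bound (Measurable.aestronglyMeasurable (by fun_prop)) ((K + K) * K)
        (ae_of_all _ fun x => ?_)
      rw [norm_mul]
      have := (norm_sub_le (u x) (ouSemigroup A t u x)).trans
        (add_le_add (huK x) (hM.abs_ouSemigroup_le (le_of_lt ht0) huK x))
      exact mul_le_mul this (hcK _) (norm_nonneg _) ((norm_nonneg _).trans this)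
    have e : ∀ x, (t⁻¹ * (ouSemigroup A t u x - u x) - Lu x) * c x
        = -t⁻¹ * ((u x - ouSemigroup A t u x) * c x) - Lu x * c x := fun x => by ring
    simp_rw [e]
    rw [integral_sub (i1.const_mul _) iL, integral_const_mul]
    ring
  have h2 := (hM.tendsto_integral_inner_meanGradient hw).const_mul (2⁻¹ : ℝ)
  refine le_of_tendsto_of_tendsto h2 h1 ?_
  filter_upwards [self_mem_nhdsWithin] with t ht
  have ht0 : (0 : ℝ) < t := ht
  have iw : Integrable (fun p : H × H => (w p.1 - w (S t p.1 + Γ t p.2)) ^ 2)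
      ((invMeasure A).prod (invMeasure A)) := by
    refine Integrable.of_bound (Measurable.aestronglyMeasurable (by fun_prop)) ((Cw + Cw) ^ 2)
      (ae_of_all _ fun p => ?_)
    rw [norm_pow]
    exact pow_le_pow_left₀ (norm_nonneg _)
      ((norm_sub_le _ _).trans (add_le_add (hCw _).1 (hCw _).1)) 2
  have iuc : Integrable (fun p : H × H => (u p.1 - u (S t p.1 + Γ t p.2))
      * (c p.1 - c (S t p.1 + Γ t p.2))) ((invMeasure A).prod (invMeasure A)) := by
    refine Integrable.of_bound (Measurable.aestronglyMeasurable (by fun_prop)) ((K + K) * (K + K))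
      (ae_of_all _ fun p => ?_)
    rw [norm_mul]
    have h5 := (norm_sub_le (u p.1) (u (S t p.1 + Γ t p.2))).trans (add_le_add (huK _) (huK _))
    have h6 := (norm_sub_le (c p.1) (c (S t p.1 + Γ t p.2))).trans (add_le_add (hcK _) (hcK _))
    exact mul_le_mul h5 h6 (norm_nonneg _) ((norm_nonneg _).trans h5)
  -- The variance bound with `a = w x`, integrated in `x`. It bounds the time-`t` Dirichlet form of
  -- `w` from below; the hypothesis `h` compares that form with the mixed form of `u` and `c`. Of
  -- these functions only `u` has to lie in the domain of the generator.
  have h7 : ∫ x, ⟪Qt t (meanGradient A S Γ w t x), meanGradient A S Γ w t x⟫ ∂(invMeasure A)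
      ≤ ∫ p : H × H, (w p.1 - w (S t p.1 + Γ t p.2)) ^ 2
        ∂((invMeasure A).prod (invMeasure A)) := by
    rw [integral_prod _ iw]
    refine integral_mono_of_nonneg (ae_of_all _ fun x => ?_) iw.integral_prod_left
      (ae_of_all _ fun x => hM.le_integral_sub_sq hw t x (w x))
    exact (hM.isNormalLaw_noise t).inner_nonneg _
  simp_rw [inner_smul_left, conj_trivial]
  rw [integral_const_mul, hM.integral_sub_ouSemigroup_mul ht0.le hum huK hc hcK,
    mul_left_comm t⁻¹]
  gcongr
  exact h7.trans (integral_mono iw iuc fun p => h _ _)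

end Energy

/-! ### The maximum principle, by testing with powers of the positive part. -/

section MaximumPrinciple

theorem hasDerivAt_max_zero_sq (r : ℝ) :
    HasDerivAt (fun r : ℝ => max r 0 ^ 2) (2 * max r 0) r := by
  rw [hasDerivAt_iff_isLittleO_nhds_zero]
  have hO : (fun h : ℝ => max (r + h) 0 ^ 2 - max r 0 ^ 2 - h • (2 * max r 0))
      =O[𝓝 0] fun h => ‖h‖ ^ 2 := by
    refine Asymptotics.IsBigO.of_bound 1 (Eventually.of_forall fun h => ?_)
    rw [one_mul, norm_pow, norm_norm, Real.norm_eq_abs, Real.norm_eq_abs, sq_abs, smul_eq_mul,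
      abs_le]
    rcases le_total (r + h) 0 with h1 | h1 <;> rcases le_total r 0 with h2 | h2 <;>
      simp only [h1, h2, max_eq_left, max_eq_right] <;> constructor <;> nlinarith
  exact hO.trans_isLittleO (Asymptotics.isLittleO_norm_pow_id one_lt_two)

theorem contDiff_max_zero_sq : ContDiff ℝ 1 fun r : ℝ => max r 0 ^ 2 := by
  rw [contDiff_one_iff_deriv]
  refine ⟨fun r => (hasDerivAt_max_zero_sq r).differentiableAt, ?_⟩
  rw [show deriv (fun r : ℝ => max r 0 ^ 2) = fun r => 2 * max r 0 from
    funext fun r => (hasDerivAt_max_zero_sq r).deriv]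
  fun_prop

/-- Cauchy-Schwarz for `W(r) - W(s) = ∫ W'` with `W(r) = (r⁺)²`: the function `4/3 (r⁺)³` is the
primitive of `(W')² = 4 (r⁺)²`. The square is used because `r⁺` itself is not continuously
differentiable. -/
theorem max_zero_sq_sub_sq_le (r s : ℝ) :
    (max r 0 ^ 2 - max s 0 ^ 2) ^ 2
      ≤ (r - s) * (4 / 3 * max r 0 ^ 3 - 4 / 3 * max s 0 ^ 3) := by
  have key : ∀ a b : ℝ, (a ^ 2 - b ^ 2) ^ 2 ≤ (a - b) * (4 / 3 * a ^ 3 - 4 / 3 * b ^ 3) := by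
    intro a b
    nlinarith [sq_nonneg ((a - b) ^ 2)]
  rcases le_total r 0 with h1 | h1 <;> rcases le_total s 0 with h2 | h2 <;>
    simp only [h1, h2, max_eq_left, max_eq_right]
  · simp
  · have := key 0 s
    nlinarith [pow_nonneg h2 3]
  · have := key r 0
    nlinarith [pow_nonneg h1 3]
  · exact key r s

variable {H : Type*} [NormedAddCommGroup H] [InnerProductSpace ℝ H] [MeasurableSpace H]
  [CompleteSpace H] [SecondCountableTopology H] [BorelSpace H]
  {A : H →ₗ.[ℝ] H} {S Γ Qt V : ℝ → H →L[ℝ] H} {Q : H →L[ℝ] H}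
  {u f Lu : H → ℝ} {B : H → H} {lam M m : ℝ}

theorem hasGradientAt_max_zero_sq (hu : IsC1b u) (m : ℝ) (x : H) :
    HasGradientAt (fun x => max (u x - m) 0 ^ 2) ((2 * max (u x - m) 0) • gradient u x) x := by
  have h := ((hu.1.differentiable (by norm_num)) x).hasGradientAt
  rw [hasGradientAt_iff_hasFDerivAt] at h ⊢
  rw [map_smul]
  exact (hasDerivAt_max_zero_sq (u x - m)).comp_hasFDerivAt x (h.sub_const m)

theorem isC1b_max_zero_sq (hu : IsC1b u) (m : ℝ) : IsC1b fun x => max (u x - m) 0 ^ 2 := by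
  obtain ⟨C, hC⟩ := hu.2
  have hp : ∀ x, |max (u x - m) 0| ≤ C + |m| := fun x => by
    rw [abs_of_nonneg (le_max_right _ _)]
    refine max_le ?_ ((abs_nonneg _).trans ((hC x).1.trans (by simp)))
    linarith [le_abs_self (u x), (hC x).1, neg_abs_le m]
  refine ⟨contDiff_max_zero_sq.comp (hu.1.sub contDiff_const),
    max ((C + |m|) ^ 2) (2 * (C + |m|) * C), fun x => ⟨le_max_of_le_left ?_, le_max_of_le_right ?_⟩⟩
  · rw [abs_pow]
    exact pow_le_pow_left₀ (abs_nonneg _) (hp x) 2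
  · rw [(hasGradientAt_max_zero_sq hu m x).gradient, norm_smul, norm_mul, Real.norm_two,
      Real.norm_eq_abs]
    have := hp x
    have := (hC x).2
    have := (abs_nonneg _).trans (hp x)
    gcongr

/-- The maximum principle for `lam - L - ⟨B, D⟩` when `lam` is large compared with `B`. -/
theorem IsMehler.ae_le_of_large (hM : IsMehler A S Γ Qt V Q) (hu : IsC1b u)
    (hL : HasL2Generator A u Lu) (hB : ∀ᵐ x ∂(invMeasure A), ‖B x‖ ≤ M)
    (hlam : M ^ 2 < 6 * lam)
    (hf : ∀ᵐ x ∂(invMeasure A), lam * u x - Lu x - ⟪B x, gradient u x⟫ ≤ lam * m) :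
    ∀ᵐ x ∂(invMeasure A), u x ≤ m := by
  have := hM.isProbabilityMeasure
  obtain ⟨C, hC⟩ := hu.2
  have hum := hu.measurable
  have hgc := continuous_gradient hu.1
  have hw := isC1b_max_zero_sq hu m
  set p : H → ℝ := fun x => max (u x - m) 0 with hpdef
  have hp0 : ∀ x, 0 ≤ p x := fun x => le_max_right _ _
  have hpm : Measurable p := by fun_prop
  have hpb : ∀ x, p x ≤ C + |m| := fun x => by
    refine max_le ?_ ((abs_nonneg _).trans ((hC x).1.trans (by simp)))
    linarith [le_abs_self (u x), (hC x).1, neg_abs_le m]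
  have hC0 : 0 ≤ C + |m| := (hp0 0).trans (hpb 0)
  have hcb : ∀ x, |4 / 3 * p x ^ 3| ≤ 4 / 3 * (C + |m|) ^ 3 := fun x => by
    rw [abs_of_nonneg (by have := hp0 x; positivity)]
    have := hp0 x
    have := hpb x
    gcongr
  have hE := hM.energy_le (c := fun x => 4 / 3 * p x ^ 3) hu hL hw (by fun_prop) hcb
    fun x y => by
      have := max_zero_sq_sub_sq_le (u x - m) (u y - m)
      rwa [sub_sub_sub_cancel_right] at this
  have e1 : ∀ x, ‖gradient (fun x => max (u x - m) 0 ^ 2) x‖ ^ 2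
      = 4 * p x ^ 2 * ‖gradient u x‖ ^ 2 := fun x => by
    rw [(hasGradientAt_max_zero_sq hu m x).gradient, norm_smul, mul_pow, Real.norm_eq_abs, sq_abs]
    ring
  simp_rw [e1] at hE
  have i1 : Integrable (fun x => Lu x * (4 / 3 * p x ^ 3)) (invMeasure A) :=
    (hL.2.1.integrable (by norm_num)).mul_bdd (c := 4 / 3 * (C + |m|) ^ 3)
      (Measurable.aestronglyMeasurable (by fun_prop)) (ae_of_all _ hcb)
  have i2 : Integrable (fun x => 4 * p x ^ 2 * ‖gradient u x‖ ^ 2) (invMeasure A) := by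
    refine Integrable.of_bound (Measurable.aestronglyMeasurable (by fun_prop))
      (4 * (C + |m|) ^ 2 * C ^ 2) (ae_of_all _ fun x => ?_)
    rw [Real.norm_of_nonneg (by positivity)]
    have := hp0 x
    have := hpb x
    have := (hC x).2
    gcongr
  have i3 : Integrable (fun x => p x ^ 4) (invMeasure A) := by
    refine Integrable.of_bound (Measurable.aestronglyMeasurable (by fun_prop))
      ((C + |m|) ^ 4) (ae_of_all _ fun x => ?_)
    rw [Real.norm_of_nonneg (by positivity)]
    exact pow_le_pow_left₀ (hp0 x) (hpb x) 4
  have hle : ∫ x, -(Lu x * (4 / 3 * p x ^ 3)) ∂(invMeasure A)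
      ≤ ∫ x, (2⁻¹ * (4 * p x ^ 2 * ‖gradient u x‖ ^ 2)
        - (4 / 3 * lam - 2 / 9 * M ^ 2) * p x ^ 4) ∂(invMeasure A) := by
    refine integral_mono_ae i1.neg ((i2.const_mul _).sub (i3.const_mul _)) ?_
    filter_upwards [hB, hf] with x hBx hfx
    have h1 : -Lu x ≤ -lam * (u x - m) + M * ‖gradient u x‖ := by
      have := (real_inner_le_norm (B x) (gradient u x)).trans
        (mul_le_mul_of_nonneg_right hBx (norm_nonneg _))
      linarith
    have h2 : (u x - m) * p x ^ 3 = p x ^ 4 := by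
      rcases le_total (u x - m) 0 with h | h
      · simp [hpdef, h]
      · simp only [hpdef, max_eq_left h]; ring
    have h3 := mul_le_mul_of_nonneg_right h1 (pow_nonneg (hp0 x) 3)
    have h4 : -lam * (u x - m) * p x ^ 3 = -lam * p x ^ 4 := by rw [mul_assoc, h2]
    -- Young's inequality with the weight for which the drift term `4/3 M ‖Du‖ p³` costs exactly the
    -- energy `2 p² ‖Du‖²` on the left. What remains is `(4/3 lam - 2/9 M²) ∫ p⁴ ≤ 0`, hence the
    -- condition `M² < 6 lam`.
    have h5 : 0 ≤ 2 * (p x * ‖gradient u x‖ - M / 3 * p x ^ 2) ^ 2 := by positivity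
    nlinarith
  rw [integral_neg, integral_sub (i2.const_mul _) (i3.const_mul _), integral_const_mul,
    integral_const_mul] at hle
  have h0 : ∫ x, p x ^ 4 ∂(invMeasure A) ≤ 0 := by
    have hpos : 0 < 4 / 3 * lam - 2 / 9 * M ^ 2 := by linarith
    by_contra! h
    have := mul_pos hpos h
    linarith
  have h1 := (integral_eq_zero_iff_of_nonneg (fun x => by positivity) i3).1
    (le_antisymm h0 (integral_nonneg fun x => by positivity))
  filter_upwards [h1] with x hx
  have hx' : p x = 0 := by simpa using hx
  have := le_max_left (u x - m) 0
  rw [show max (u x - m) 0 = 0 from hx'] at this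
  linarith

theorem ouSemigroup_neg (t : ℝ) (u : H → ℝ) (x : H) :
    ouSemigroup A t (fun x => -u x) x = -ouSemigroup A t u x := integral_neg _

theorem HasL2Generator.neg (hL : HasL2Generator A u Lu) :
    HasL2Generator A (fun x => -u x) fun x => -Lu x := by
  refine ⟨hL.1.neg, hL.2.1.neg, hL.2.2.congr fun t => ?_⟩
  rw [← eLpNorm_neg]
  congr 1
  ext x
  simp only [Pi.neg_apply, ouSemigroup_neg]
  ring

theorem gradient_neg (u : H → ℝ) (x : H) : gradient (fun x => -u x) x = -gradient u x := by
  rw [gradient, gradient, ← map_neg]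
  congr 1
  exact fderiv_neg

theorem IsC1b.neg (hu : IsC1b u) : IsC1b fun x => -u x := by
  obtain ⟨C, hC⟩ := hu.2
  exact ⟨hu.1.neg, C, fun x => by simpa [gradient_neg] using hC x⟩

/-- Adding `κ u`, `κ = M²`, to both sides brings the equation into the range of the maximum
principle. With `N = ‖u‖₀`, this gives `N ≤ (F + κ N)/(lam + κ)`; as `N` is finite, `κ` cancels and
no relation between `lam` and the drift is left. -/
theorem IsMehler.essNorm_le_div (hM : IsMehler A S Γ Qt V Q) (hlam : 0 < lam) (hu : IsC1b u)
    (hL : HasL2Generator A u Lu) (hB : ∀ᵐ x ∂(invMeasure A), ‖B x‖ ≤ M)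
    (heq : ∀ᵐ x ∂(invMeasure A), lam * u x - Lu x - ⟪B x, gradient u x⟫ = f x) {F : ℝ}
    (hF0 : 0 ≤ F) (hf : ∀ᵐ x ∂(invMeasure A), |f x| ≤ F) : essNorm A u ≤ F / lam := by
  obtain ⟨C, hC⟩ := hu.2
  have hN := ae_norm_le_essNorm (A := A) (f := u) fun x => (hC x).1
  set N := essNorm A u with hNdef
  have hN0 : 0 ≤ N := essNorm_nonneg A u
  set κ := M ^ 2 with hκ
  have hκ0 : 0 ≤ κ := sq_nonneg M
  set m := (F + κ * N) / (lam + κ) with hm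
  have hpos : 0 < lam + κ := by linarith
  have hmul : (lam + κ) * m = F + κ * N := by rw [hm]; field_simp
  have h1 := hM.ae_le_of_large (lam := lam + κ) (m := m) hu hL hB (by linarith) (by
    filter_upwards [heq, hf, hN] with x hx hfx hNx
    have := (abs_le.1 hfx).2
    have := mul_le_mul_of_nonneg_left (abs_le.1 hNx).2 hκ0
    linarith)
  have h2 := hM.ae_le_of_large (lam := lam + κ) (m := m) hu.neg hL.neg hB (by linarith) (by
    filter_upwards [heq, hf, hN] with x hx hfx hNx
    have := (abs_le.1 hfx).1
    have := mul_le_mul_of_nonneg_left (abs_le.1 hNx).1 hκ0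
    rw [gradient_neg, inner_neg_right]
    linarith)
  have hm0 : 0 ≤ m := by positivity
  have h3 : N ≤ m := essNorm_le hm0 (by
    filter_upwards [h1, h2] with x hx1 hx2
    exact abs_le.2 ⟨by linarith, hx1⟩)
  rw [le_div_iff₀ hlam]
  nlinarith

end MaximumPrinciple

/-! ### Uniform gradient bounds, and the gradient of the Laplace transform along sequences. -/

section Stability

variable {H : Type*} [NormedAddCommGroup H] [InnerProductSpace ℝ H] [MeasurableSpace H]
  [CompleteSpace H] [SecondCountableTopology H] [BorelSpace H]
  {A : H →ₗ.[ℝ] H} {S Γ Qt V : ℝ → H →L[ℝ] H} {Q : H →L[ℝ] H}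
  {u f g Lu : H → ℝ} {B : H → H} {lam K M : ℝ}

theorem IsMehler.norm_gradient_le_of_ae (hM : IsMehler A S Γ Qt V Q) (hlam : 0 < lam)
    (hu : IsC1b u) (hL : HasL2Generator A u Lu) (hg : Measurable g) (hK : ∀ x, |g x| ≤ K)
    (heq : ∀ᵐ x ∂(invMeasure A), lam * u x - Lu x = g x) {G : ℝ} (hG0 : 0 ≤ G)
    (hG : ∀ᵐ x ∂(invMeasure A), |g x| ≤ G) (x : H) : ‖gradient u x‖ ≤ G * √(Real.pi / lam) := by
  refine norm_le_of_forall_inner_le (fun h => ?_) (by positivity)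
  rw [hM.inner_gradient_eq_integral hlam hu hL hg hK heq x h, mul_comm G, mul_assoc,
    ← integral_exp_neg_mul_inv_sqrt hlam, ← integral_mul_const]
  refine (Real.le_norm_self _).trans (norm_integral_le_of_norm_le
    ((integrableOn_exp_neg_mul_inv_sqrt hlam).mul_const _) ?_)
  filter_upwards [ae_restrict_mem measurableSet_Ioi] with s hs
  rw [norm_mul, Real.norm_of_nonneg (Real.exp_pos _).le, mul_assoc]
  refine mul_le_mul_of_nonneg_left ?_ (Real.exp_pos _).le
  calc _ ≤ ‖gradient (ouSemigroup A s g) x‖ * ‖h‖ := norm_inner_le_norm _ _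
    _ ≤ G * (√s)⁻¹ * ‖h‖ := by
      gcongr
      exact hM.norm_gradient_le hs hg hK x hG0 hG
    _ = _ := by ring

theorem measurable_inner_gradient (hB : Measurable B) (hu : IsC1b u) :
    Measurable fun x => ⟪B x, gradient u x⟫ :=
  hB.inner (continuous_gradient hu.1).measurable

/-- A gradient bound that depends on `lam` and on the sup norms of the coefficients only. -/
theorem IsMehler.norm_gradient_le_of_solution (hM : IsMehler A S Γ Qt V Q) (hlam : 0 < lam)
    (hM0 : 0 ≤ M) (hsol : IsKolmogorovSolution A lam B f u) (hf : IsBddBorel f) (hB : IsBddBorel B)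
    (hfM : ∀ᵐ x ∂(invMeasure A), |f x| ≤ M) (hBM : ∀ᵐ x ∂(invMeasure A), ‖B x‖ ≤ M) (x : H) :
    ‖gradient u x‖ ≤ 2 * √(Real.pi / (lam + 4 * Real.pi * M ^ 2))
      * (M + 4 * Real.pi * M ^ 2 * (M / lam)) := by
  obtain ⟨hu, Lu, hL, heq⟩ := hsol
  obtain ⟨C, hC⟩ := hu.2
  obtain ⟨Cf, hCf⟩ := hf.2
  obtain ⟨CB, hCB⟩ := hB.2
  -- Chosen so that `ρ = (π/(lam + κ))^{1/2}` satisfies `ρ M ≤ 1/2`. After adding `κ u` to both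
  -- sides, the drift contributes at most half of `‖Du‖₀` and is absorbed; the zero-order term `κ u`
  -- is controlled by `‖u‖₀ ≤ M / lam`.
  set κ := 4 * Real.pi * M ^ 2 with hκ
  have hκ0 : 0 ≤ κ := by positivity
  have hpos : 0 < lam + κ := by linarith
  set ρ := √(Real.pi / (lam + κ)) with hρ
  have hρ0 : 0 ≤ ρ := Real.sqrt_nonneg _
  have hρM : ρ * M ≤ 1 / 2 := by
    refine abs_le_of_sq_le_sq' ?_ (by norm_num) |>.2
    rw [mul_pow, hρ, Real.sq_sqrt (by positivity), div_mul_eq_mul_div, div_le_iff₀ hpos]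
    linarith
  have hun := ae_norm_le_essNorm (A := A) (f := u) fun x => (hC x).1
  have hgn := ae_norm_le_essNorm (A := A) (f := gradient u) fun x => (hC x).2
  have hU := hM.essNorm_le_div hlam hu hL hBM heq hM0 hfM
  set N := essNorm A (gradient u) with hN
  have hN0 : 0 ≤ N := essNorm_nonneg _ _
  set D := M + κ * (M / lam) with hD
  have hD0 : 0 ≤ D := by positivity
  have hmB := measurable_inner_gradient hB.1 hu
  have hfm := hf.1
  have hum := hu.measurable
  have key : ∀ x, ‖gradient u x‖ ≤ (D + M * N) * ρ := by
    refine hM.norm_gradient_le_of_ae (Lu := Lu) (K := Cf + κ * C + CB * C)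
      (g := fun x => f x + κ * u x + ⟪B x, gradient u x⟫) hpos hu hL (by fun_prop) (fun x => ?_)
      ?_ (by positivity) ?_
    · refine (abs_add_le _ _).trans (add_le_add ((abs_add_le _ _).trans (add_le_add (hCf x) ?_)) ?_)
      · rw [abs_mul, abs_of_nonneg hκ0]
        exact mul_le_mul_of_nonneg_left (hC x).1 hκ0
      · exact (abs_real_inner_le_norm _ _).trans
          (mul_le_mul (hCB x) (hC x).2 (norm_nonneg _) ((norm_nonneg _).trans (hCB x)))
    · filter_upwards [heq] with x hx
      linarith
    · filter_upwards [hfM, hBM, hun, hgn] with x h1 h2 h3 h4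
      refine (abs_add_le _ _).trans (add_le_add ((abs_add_le _ _).trans (add_le_add h1 ?_)) ?_)
      · rw [abs_mul, abs_of_nonneg hκ0]
        exact mul_le_mul_of_nonneg_left (h3.trans hU) hκ0
      · exact (abs_real_inner_le_norm _ _).trans (mul_le_mul h2 h4 (norm_nonneg _) hM0)
  have h1 : N ≤ (D + M * N) * ρ := essNorm_le (by positivity) (ae_of_all _ key)
  have h2 : ρ * M * N ≤ 1 / 2 * N := by gcongr
  have h3 := key x
  nlinarith

theorem IsMehler.aestronglyMeasurable_inner_gradient (hM : IsMehler A S Γ Qt V Q)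
    (hg : Measurable g) (hK : ∀ x, |g x| ≤ K) (x h : H) :
    AEStronglyMeasurable (fun s => ⟪gradient (ouSemigroup A s g) x, h⟫)
      (volume.restrict (Set.Ioi 0)) := by
  refine aestronglyMeasurable_of_tendsto_ae (𝓝[≠] (0 : ℝ))
    (f := fun r s => r⁻¹ • (ouSemigroup A s g (x + r • h) - ouSemigroup A s g x)) (fun r => ?_) ?_
  · exact ((hM.aestronglyMeasurable_time hg (x + r • h)).sub
      (hM.aestronglyMeasurable_time hg x)).const_smul r⁻¹
  · filter_upwards [ae_restrict_mem measurableSet_Ioi] with s hs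
    exact ((hM.hasGradientAt hs hg hK x).hasFDerivAt.hasLineDerivAt h).tendsto_slope_zero

theorem IsMehler.integrableOn_exp_mul_inner_gradient (hM : IsMehler A S Γ Qt V Q) (hlam : 0 < lam)
    (hg : Measurable g) (hK : ∀ x, |g x| ≤ K) (x h : H) :
    IntegrableOn (fun s => Real.exp (-lam * s) * ⟪gradient (ouSemigroup A s g) x, h⟫)
      (Set.Ioi 0) := by
  have hK0 : 0 ≤ K := (abs_nonneg _).trans (hK 0)
  refine ((integrableOn_exp_neg_mul_inv_sqrt hlam).mul_const (K * ‖h‖)).mono'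
    ((Continuous.aestronglyMeasurable (by fun_prop)).mul
      (hM.aestronglyMeasurable_inner_gradient hg hK x h)) ?_
  filter_upwards [ae_restrict_mem measurableSet_Ioi] with s hs
  rw [norm_mul, Real.norm_of_nonneg (Real.exp_pos _).le, mul_assoc]
  refine mul_le_mul_of_nonneg_left ?_ (Real.exp_pos _).le
  calc _ ≤ ‖gradient (ouSemigroup A s g) x‖ * ‖h‖ := norm_inner_le_norm _ _
    _ ≤ K * (√s)⁻¹ * ‖h‖ := by
      gcongr
      exact hM.norm_gradient_le hs hg hK x hK0 (ae_of_all _ hK)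
    _ = _ := by ring

variable {φ : ℕ → H → ℝ} {E c : ℝ}

theorem IsMehler.tendsto_ouSemigroup (hM : IsMehler A S Γ Qt V Q) {t : ℝ} (ht : 0 < t)
    (hφ : ∀ n, Measurable (φ n)) (hE : ∀ n, ∀ᵐ x ∂(invMeasure A), |φ n x| ≤ E)
    (h0 : ∀ᵐ x ∂(invMeasure A), Tendsto (fun n => φ n x) atTop (𝓝 0)) (x : H) :
    Tendsto (fun n => ouSemigroup A t (φ n) x) atTop (𝓝 0) := by
  have := hM.isProbabilityMeasure_mehlerKernel t x
  have hac := hM.mehlerKernel_absolutelyContinuous ht x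
  simp_rw [hM.ouSemigroup_eq ht.le]
  have h := tendsto_integral_of_dominated_convergence (μ := mehlerKernel A S Γ t x) (F := φ)
    (f := fun _ => 0) (fun _ => E) (fun n => (hφ n).aestronglyMeasurable) (integrable_const _)
    (fun n => hac.ae_le (hE n)) (hac.ae_le h0)
  simpa using h

theorem IsMehler.tendsto_integral_exp_mul_ouSemigroup (hM : IsMehler A S Γ Qt V Q)
    (hlam : 0 < lam) (hφ : ∀ n, Measurable (φ n)) (hE : ∀ n, ∀ᵐ x ∂(invMeasure A), |φ n x| ≤ E)
    (h0 : ∀ᵐ x ∂(invMeasure A), Tendsto (fun n => φ n x) atTop (𝓝 0)) (x : H) :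
    Tendsto (fun n => ∫ s in Set.Ioi (0 : ℝ), Real.exp (-lam * s) * ouSemigroup A s (φ n) x)
      atTop (𝓝 0) := by
  have h := tendsto_integral_of_dominated_convergence (μ := volume.restrict (Set.Ioi (0 : ℝ)))
    (F := fun n s => Real.exp (-lam * s) * ouSemigroup A s (φ n) x) (f := fun _ => 0)
    (fun s => Real.exp (-lam * s) * E)
    (fun n => (Continuous.aestronglyMeasurable (by fun_prop)).mul
      (hM.aestronglyMeasurable_time (hφ n) x)) ((integrableOn_exp_neg_mul hlam).mul_const _)
    (fun n => by
      filter_upwards [ae_restrict_mem measurableSet_Ioi] with s hs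
      rw [norm_mul, Real.norm_of_nonneg (Real.exp_pos _).le]
      exact mul_le_mul_of_nonneg_left (hM.abs_ouSemigroup_le_of_ae hs (hE n) x)
        (Real.exp_pos _).le) (by
      filter_upwards [ae_restrict_mem measurableSet_Ioi] with s hs
      have := (hM.tendsto_ouSemigroup hs hφ hE h0 x).const_mul (Real.exp (-lam * s))
      rwa [mul_zero] at this)
  simpa using h

/-- The gradient of `R_s φ` is controlled with the optimal constant where `|φ| ≤ c`, and in mean
square by the excess of `|φ|` over `c`. -/
theorem IsMehler.abs_inner_gradient_le (hM : IsMehler A S Γ Qt V Q) {s : ℝ} (hs : 0 < s)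
    (hg : Measurable g) (hK : ∀ x, |g x| ≤ K) (hc : 0 ≤ c) (x h : H) :
    |⟪gradient (ouSemigroup A s g) x, h⟫| ≤ (c * gradConst A
      + √(ouSemigroup A s (fun y => max (|g y| - c) 0 ^ 2) x)) * ((√s)⁻¹ * ‖h‖) := by
  have hν := hM.isNormalLaw_noise s
  have hem : Measurable fun y => max (|g y| - c) 0 := by fun_prop
  have heK : ∀ y, |max (|g y| - c) 0| ≤ K := fun y => by
    rw [abs_of_nonneg (le_max_right _ _)]
    exact max_le (by linarith [hK y]) ((abs_nonneg _).trans (hK y))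
  rw [hM.inner_gradient hs hg hK]
  have i1 := ((hν.integrable_inner (V s h)).abs.const_mul c)
  have i2 := (hM.integrable_mul_V (t := s) hem heK x h).abs
  calc _ ≤ ∫ z, |g (S s x + z) * ⟪V s h, z⟫| ∂(noise A Γ s) := abs_integral_le_integral_abs
    _ ≤ ∫ z, (c * |⟪V s h, z⟫| + |max (|g (S s x + z)| - c) 0 * ⟪V s h, z⟫|)
        ∂(noise A Γ s) := by
      refine integral_mono (hM.integrable_mul_V (t := s) hg hK x h).abs (i1.add i2) fun z => ?_
      simp only [abs_mul]
      rw [← add_mul, abs_of_nonneg (le_max_right (|g (S s x + z)| - c) 0)]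
      gcongr
      linarith [le_max_left (|g (S s x + z)| - c) 0]
    _ = c * ∫ z, |⟪V s h, z⟫| ∂(noise A Γ s)
        + ∫ z, |max (|g (S s x + z)| - c) 0 * ⟪V s h, z⟫| ∂(noise A Γ s) := by
      rw [integral_add i1 i2, integral_const_mul]
    _ ≤ c * (gradConst A * ((√s)⁻¹ * ‖h‖))
        + √(ouSemigroup A s (fun y => max (|g y| - c) 0 ^ 2) x) * ((√s)⁻¹ * ‖h‖) := by
      rw [hM.ouSemigroup_eq hs.le]
      exact add_le_add (mul_le_mul_of_nonneg_left (hM.integral_abs_inner_V_le hs h) hc)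
        (hM.integral_abs_mul_V_le hs hem heK x h)
    _ = _ := by ring

/-- A quantitative form of "`limsup |φ n| ≤ c` a.e. implies that the gradient of the Laplace
transform at `x` has limsup at most `c C₀ (π/lam)^{1/2}`". The squared excess over `c` tends to zero
under `R_s` at `x` for every `s > 0`, by absolute continuity of the kernel, and its root is then
integrated in `s`. The error `ε` is independent of the direction `h`, so it controls the norm of the
gradient. -/
theorem IsMehler.exists_tendsto_zero_abs_integral_le (hM : IsMehler A S Γ Qt V Q)
    (hlam : 0 < lam) (hφ : ∀ n, IsBddBorel (φ n)) (hE0 : 0 ≤ E)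
    (hE : ∀ n, ∀ᵐ x ∂(invMeasure A), |φ n x| ≤ E) (hc : 0 ≤ c)
    (h0 : ∀ᵐ x ∂(invMeasure A), Tendsto (fun n => max (|φ n x| - c) 0) atTop (𝓝 0)) (x : H) :
    ∃ ε : ℕ → ℝ, Tendsto ε atTop (𝓝 0) ∧ ∀ n h,
      |∫ s in Set.Ioi (0 : ℝ), Real.exp (-lam * s) * ⟪gradient (ouSemigroup A s (φ n)) x, h⟫|
        ≤ (c * gradConst A * √(Real.pi / lam) + ε n) * ‖h‖ := by
  set e : ℕ → H → ℝ := fun n y => max (|φ n y| - c) 0 ^ 2 with he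
  have hφm := fun n => (hφ n).1
  have hem : ∀ n, Measurable (e n) := fun n => by
    have := hφm n
    fun_prop
  have heE : ∀ n, ∀ᵐ y ∂(invMeasure A), |e n y| ≤ E ^ 2 := fun n => by
    filter_upwards [hE n] with y hy
    rw [abs_pow]
    refine pow_le_pow_left₀ (abs_nonneg _) ?_ 2
    rw [abs_of_nonneg (le_max_right _ _)]
    exact max_le (by linarith) hE0
  have he0 : ∀ᵐ y ∂(invMeasure A), Tendsto (fun n => e n y) atTop (𝓝 0) := by
    filter_upwards [h0] with y hy
    simpa using hy.pow 2
  have hm : ∀ n, AEStronglyMeasurable (fun s : ℝ => Real.exp (-lam * s) * (√s)⁻¹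
      * √(ouSemigroup A s (e n) x)) (volume.restrict (Set.Ioi 0)) := fun n =>
    (Measurable.aestronglyMeasurable (by fun_prop)).mul
      (Real.continuous_sqrt.comp_aestronglyMeasurable (hM.aestronglyMeasurable_time (hem n) x))
  have hb : ∀ n, ∀ᵐ s ∂(volume.restrict (Set.Ioi (0 : ℝ))), ‖Real.exp (-lam * s) * (√s)⁻¹
      * √(ouSemigroup A s (e n) x)‖ ≤ Real.exp (-lam * s) * (√s)⁻¹ * E := fun n => by
    filter_upwards [ae_restrict_mem measurableSet_Ioi] with s hs
    rw [Real.norm_of_nonneg (by positivity)]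
    gcongr
    refine Real.sqrt_le_iff.2 ⟨hE0, ?_⟩
    exact (le_abs_self _).trans (hM.abs_ouSemigroup_le_of_ae hs (heE n) x)
  have hI := (integrableOn_exp_neg_mul_inv_sqrt hlam).mul_const E
  refine ⟨fun n => ∫ s in Set.Ioi (0 : ℝ), Real.exp (-lam * s) * (√s)⁻¹
    * √(ouSemigroup A s (e n) x), ?_, fun n h => ?_⟩
  · have h := tendsto_integral_of_dominated_convergence (f := fun _ => 0) _ hm hI hb (by
      filter_upwards [ae_restrict_mem measurableSet_Ioi] with s hs
      have h1 := (Real.continuous_sqrt.tendsto 0).comp (hM.tendsto_ouSemigroup hs hem heE he0 x)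
      have h2 := h1.const_mul (Real.exp (-lam * s) * (√s)⁻¹)
      rwa [Real.sqrt_zero, mul_zero] at h2)
    simpa using h
  · obtain ⟨K, hK⟩ := (hφ n).2
    have i1 := (integrableOn_exp_neg_mul_inv_sqrt hlam).mul_const (c * gradConst A)
    have i2 : Integrable (fun s : ℝ => Real.exp (-lam * s) * (√s)⁻¹
      * √(ouSemigroup A s (e n) x)) (volume.restrict (Set.Ioi 0)) := hI.mono' (hm n) (hb n)
    rw [← integral_exp_neg_mul_inv_sqrt hlam, mul_comm (c * gradConst A), ← integral_mul_const,
      ← integral_add i1 i2, ← integral_mul_const]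
    rw [← Real.norm_eq_abs]
    refine norm_integral_le_of_norm_le ((i1.add i2).mul_const _) ?_
    filter_upwards [ae_restrict_mem measurableSet_Ioi] with s hs
    rw [norm_mul, Real.norm_of_nonneg (Real.exp_pos _).le]
    refine (mul_le_mul_of_nonneg_left (hM.abs_inner_gradient_le hs (hφm n) hK hc x h)
      (Real.exp_pos _).le).trans_eq ?_
    simp only [he]
    ring

end Stability

/-! ### Convergence of the solutions: the iterated contraction. -/

section Convergence

variable {H : Type*} [NormedAddCommGroup H] [InnerProductSpace ℝ H] [MeasurableSpace H]
  [CompleteSpace H] [SecondCountableTopology H] [BorelSpace H]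
  {A : H →ₗ.[ℝ] H} {S Γ Qt V : ℝ → H →L[ℝ] H} {Q : H →L[ℝ] H}
  {u f : H → ℝ} {B : H → H} {un fn : ℕ → H → ℝ} {Bn : ℕ → H → H} {lam M : ℝ}

theorem isBddBorel_add_inner (hf : IsBddBorel f) (hB : IsBddBorel B) (hu : IsC1b u) :
    IsBddBorel fun x => f x + ⟪B x, gradient u x⟫ := by
  obtain ⟨Cf, hCf⟩ := hf.2
  obtain ⟨CB, hCB⟩ := hB.2
  obtain ⟨C, hC⟩ := hu.2
  exact ⟨hf.1.add (measurable_inner_gradient hB.1 hu), Cf + CB * C, fun x =>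
    (norm_add_le _ _).trans (add_le_add (hCf x) ((norm_inner_le_norm _ _).trans
      (mul_le_mul (hCB x) (hC x).2 (norm_nonneg _) ((norm_nonneg _).trans (hCB x)))))⟩

/-- The source terms `f + ⟨B, Du⟩` are close where the coefficients and the gradients are. -/
theorem abs_source_sub_le (x : H) (n : ℕ) :
    |(fn n x + ⟪Bn n x, gradient (un n) x⟫) - (f x + ⟪B x, gradient u x⟫)|
      ≤ |fn n x - f x| + ‖Bn n x - B x‖ * ‖gradient (un n) x‖
        + ‖B x‖ * ‖gradient (un n) x - gradient u x‖ := by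
  have e : (fn n x + ⟪Bn n x, gradient (un n) x⟫) - (f x + ⟪B x, gradient u x⟫)
      = (fn n x - f x) + ⟪Bn n x - B x, gradient (un n) x⟫
        + ⟪B x, gradient (un n) x - gradient u x⟫ := by
    rw [inner_sub_left, inner_sub_right]; ring
  rw [e]
  exact (abs_add_le _ _).trans (add_le_add ((abs_add_le _ _).trans (add_le_add le_rfl
    (abs_real_inner_le_norm _ _))) (abs_real_inner_le_norm _ _))

theorem IsMehler.tendsto_of_solutions (hM : IsMehler A S Γ Qt V Q)
    (hf : IsBddBorel f) (hB : IsBddBorel B)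
    (hfn : ∀ n, IsBddBorel (fn n)) (hBn : ∀ n, IsBddBorel (Bn n))
    (hf_lim : ∀ᵐ x ∂(invMeasure A), Tendsto (fun n => fn n x) atTop (𝓝 (f x)))
    (hB_lim : ∀ᵐ x ∂(invMeasure A), Tendsto (fun n => Bn n x) atTop (𝓝 (B x)))
    (hfM : ∀ n, essNorm A (fn n) ≤ M) (hBM : ∀ n, essNorm A (Bn n) ≤ M)
    (hlam_pos : 0 < lam) (hlam : 4 * essNorm A B ^ 2 * gradConst A ^ 2 ≤ lam)
    (hu : IsKolmogorovSolution A lam B f u)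
    (hun : ∀ n, IsKolmogorovSolution A lam (Bn n) (fn n) (un n)) (x : H) :
    Tendsto (fun n => un n x) atTop (𝓝 (u x)) ∧
      Tendsto (fun n => gradient (un n) x) atTop (𝓝 (gradient u x)) := by
  have hM0 : 0 ≤ M := (essNorm_nonneg A (fn 0)).trans (hfM 0)
  have hfna : ∀ n, ∀ᵐ x ∂(invMeasure A), |fn n x| ≤ M := fun n => by
    obtain ⟨C, hC⟩ := (hfn n).2
    filter_upwards [ae_norm_le_essNorm (A := A) hC] with x hx using hx.trans (hfM n)
  have hBna : ∀ n, ∀ᵐ x ∂(invMeasure A), ‖Bn n x‖ ≤ M := fun n => by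
    obtain ⟨C, hC⟩ := (hBn n).2
    filter_upwards [ae_norm_le_essNorm (A := A) hC] with x hx using hx.trans (hBM n)
  obtain ⟨CB, hCB⟩ := hB.2
  have hBa := ae_norm_le_essNorm (A := A) hCB
  set β := essNorm A B with hβ
  have hβ0 : 0 ≤ β := essNorm_nonneg A B
  have hγ0 : 0 ≤ gradConst A := gradConst_nonneg A
  -- a bound for all gradients
  obtain ⟨K, hK⟩ : ∃ K, ∀ n x, ‖gradient (un n) x‖ ≤ K :=
    ⟨_, fun n x => hM.norm_gradient_le_of_solution hlam_pos hM0 (hun n) (hfn n) (hBn n) (hfna n)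
      (hBna n) x⟩
  have hK0 : 0 ≤ K := (norm_nonneg _).trans (hK 0 0)
  obtain ⟨hu1, Lu, hL, heq⟩ := hu
  choose hun1 Lun hLn heqn using hun
  obtain ⟨Cu, hCu⟩ := hu1.2
  have hCu0 : 0 ≤ Cu := (norm_nonneg _).trans (hCu 0).2
  -- the source terms
  set g : H → ℝ := fun x => f x + ⟪B x, gradient u x⟫ with hg
  set gn : ℕ → H → ℝ := fun n x => fn n x + ⟪Bn n x, gradient (un n) x⟫ with hgn
  have hgb : IsBddBorel g := isBddBorel_add_inner hf hB hu1
  have hgnb : ∀ n, IsBddBorel (gn n) := fun n => isBddBorel_add_inner (hfn n) (hBn n) (hun1 n)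
  obtain ⟨Cg, hCg⟩ := hgb.2
  choose Cgn hCgn using fun n => (hgnb n).2
  have hCg0 : 0 ≤ Cg := (norm_nonneg _).trans (hCg 0)
  have heq' : ∀ᵐ x ∂(invMeasure A), lam * u x - Lu x = g x := by
    filter_upwards [heq] with x hx
    simp only [hg]; linarith
  have heqn' : ∀ n, ∀ᵐ x ∂(invMeasure A), lam * un n x - Lun n x = gn n x := fun n => by
    filter_upwards [heqn n] with x hx
    simp only [hgn]; linarith
  set φ : ℕ → H → ℝ := fun n x => gn n x - g x with hφ
  have hφb : ∀ n, IsBddBorel (φ n) := fun n => ⟨(hgnb n).1.sub hgb.1, Cgn n + Cg, fun x =>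
    (norm_sub_le _ _).trans (add_le_add (hCgn n x) (hCg x))⟩
  have hE : ∀ n, ∀ᵐ x ∂(invMeasure A), |φ n x| ≤ M + M * K + Cg := fun n => by
    filter_upwards [hfna n, hBna n] with x h1 h2
    refine (norm_sub_le _ _).trans (add_le_add ((norm_add_le _ _).trans (add_le_add h1 ?_)) (hCg x))
    exact (norm_inner_le_norm _ _).trans (mul_le_mul h2 (hK n x) (norm_nonneg _) hM0)
  have hE0 : 0 ≤ M + M * K + Cg := by positivity
  -- representation of the differences
  have hrep : ∀ n x, un n x - u x
      = ∫ s in Set.Ioi (0 : ℝ), Real.exp (-lam * s) * ouSemigroup A s (φ n) x := by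
    intro n x
    rw [hM.eq_integral_ouSemigroup hlam_pos (hun1 n) (hLn n) (hgnb n).1 (hCgn n) (heqn' n) x,
      hM.eq_integral_ouSemigroup hlam_pos hu1 hL hgb.1 hCg heq' x,
      ← integral_sub (hM.integrableOn_exp_mul_ouSemigroup hlam_pos (hgnb n).1 (hCgn n) x)
        (hM.integrableOn_exp_mul_ouSemigroup hlam_pos hgb.1 hCg x)]
    refine setIntegral_congr_fun measurableSet_Ioi fun s hs => ?_
    have hs0 : (0 : ℝ) ≤ s := le_of_lt hs
    simp only [hM.ouSemigroup_eq hs0, hφ]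
    rw [integral_sub (hM.integrable_mehlerKernel (hgnb n).1 (hCgn n) x)
      (hM.integrable_mehlerKernel hgb.1 hCg x), mul_sub]
  have hgrep : ∀ n x h, ⟪gradient (un n) x - gradient u x, h⟫
      = ∫ s in Set.Ioi (0 : ℝ), Real.exp (-lam * s)
        * ⟪gradient (ouSemigroup A s (φ n)) x, h⟫ := by
    intro n x h
    rw [inner_sub_left,
      hM.inner_gradient_eq_integral hlam_pos (hun1 n) (hLn n) (hgnb n).1 (hCgn n) (heqn' n) x,
      hM.inner_gradient_eq_integral hlam_pos hu1 hL hgb.1 hCg heq' x,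
      ← integral_sub (hM.integrableOn_exp_mul_inner_gradient hlam_pos (hgnb n).1 (hCgn n) x h)
        (hM.integrableOn_exp_mul_inner_gradient hlam_pos hgb.1 hCg x h)]
    refine setIntegral_congr_fun measurableSet_Ioi fun s hs => ?_
    obtain ⟨Cφ, hCφ⟩ := (hφb n).2
    rw [hM.inner_gradient hs (hgnb n).1 (hCgn n), hM.inner_gradient hs hgb.1 hCg,
      hM.inner_gradient hs (hφb n).1 hCφ, ← mul_sub,
      ← integral_sub (hM.integrable_mul_V (hgnb n).1 (hCgn n) x h)
        (hM.integrable_mul_V hgb.1 hCg x h)]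
    simp only [hφ, sub_mul]
  -- the excess of the source terms over a multiple of a bound for the gradients
  have hexc : ∀ c, (∀ x, Tendsto (fun n => max (‖gradient (un n) x - gradient u x‖ - c) 0) atTop
      (𝓝 0)) → ∀ᵐ x ∂(invMeasure A),
        Tendsto (fun n => max (|φ n x| - β * c) 0) atTop (𝓝 0) := by
    intro c hc
    filter_upwards [hf_lim, hB_lim, hBa] with x h1 h2 h3
    have t1 : Tendsto (fun n => |fn n x - f x|) atTop (𝓝 0) := by
      simpa using (h1.sub_const (f x)).abs
    have t2 : Tendsto (fun n => ‖Bn n x - B x‖ * K) atTop (𝓝 0) := by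
      simpa using ((h2.sub_const (B x)).norm).mul_const K
    have t3 := (t1.add t2).add ((hc x).const_mul β)
    rw [mul_zero, add_zero, add_zero] at t3
    refine squeeze_zero (fun n => le_max_right _ _) (fun n => max_le ?_ (by positivity)) t3
    have h4 := abs_source_sub_le (f := f) (B := B) (u := u) (fn := fn) (Bn := Bn) (un := un) x n
    have h5 := mul_le_mul_of_nonneg_left (hK n x) (norm_nonneg (Bn n x - B x))
    have h6 := mul_le_mul_of_nonneg_right h3 (norm_nonneg (gradient (un n) x - gradient u x))
    have h7 := mul_le_mul_of_nonneg_left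
      (le_max_left (‖gradient (un n) x - gradient u x‖ - c) 0) hβ0
    have h8 : |φ n x| ≤ _ := h4
    linarith
  -- iteration
  set θ := β * gradConst A * √(Real.pi / lam) with hθ
  have hθ0 : 0 ≤ θ := by positivity
  -- The hypothesis on `lam` gives `θ² = β² C₀² π / lam ≤ π/4`, so the factor `4` suffices because
  -- `π < 4`.
  have hθ1 : θ < 1 := by
    refine lt_of_pow_lt_pow_left₀ 2 zero_le_one ?_
    rw [hθ, mul_pow, mul_pow, Real.sq_sqrt (by positivity), ← mul_div_assoc, div_lt_iff₀ hlam_pos]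
    have h1 : 0 ≤ β ^ 2 * gradConst A ^ 2 := by positivity
    nlinarith [Real.pi_lt_four, Real.pi_pos]
  -- In terms of limsup: `limsup ‖Duₙ(x) - Du(x)‖ ≤ θ^k (K + Cu)` at every `x`. The bound at all
  -- points for `k` gives the bound on the source terms a.e., and this gives the bound for `k + 1`
  -- again at all points. No convergence uniform in `x` is needed.
  have hstep : ∀ k : ℕ, ∀ x, Tendsto (fun n => max (‖gradient (un n) x - gradient u x‖
      - θ ^ k * (K + Cu)) 0) atTop (𝓝 0) := by
    intro k
    induction k with
    | zero =>
      intro x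
      refine tendsto_const_nhds.congr fun n => (max_eq_right ?_).symm
      have := (norm_sub_le (gradient (un n) x) (gradient u x)).trans (add_le_add (hK n x) (hCu x).2)
      linarith
    | succ k ih =>
      intro x
      have hc0 : 0 ≤ θ ^ k * (K + Cu) := by positivity
      obtain ⟨ε, hε, hb⟩ := hM.exists_tendsto_zero_abs_integral_le hlam_pos hφb hE0 hE
        (mul_nonneg hβ0 hc0) (hexc _ ih) x
      refine squeeze_zero (fun n => le_max_right _ _) (fun n => max_le ?_ (abs_nonneg _))
        (by simpa using hε.abs)
      have h1 : ‖gradient (un n) x - gradient u x‖ ≤ θ ^ (k + 1) * (K + Cu) + |ε n| := by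
        refine norm_le_of_forall_inner_le (fun h => ?_) (by positivity)
        rw [hgrep]
        refine (le_abs_self _).trans ((hb n h).trans ?_)
        refine mul_le_mul_of_nonneg_right (add_le_add (le_of_eq ?_) (le_abs_self _)) (norm_nonneg _)
        rw [pow_succ']
        nth_rewrite 2 [hθ]
        ring
      linarith
  have hgrad : ∀ x, Tendsto (fun n => gradient (un n) x) atTop (𝓝 (gradient u x)) := by
    intro x
    rw [tendsto_iff_norm_sub_tendsto_zero]
    refine tendsto_order.2 ⟨fun a ha => Eventually.of_forall fun n => ha.trans_le (norm_nonneg _),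
      fun a ha => ?_⟩
    have h1 : Tendsto (fun k : ℕ => θ ^ k * (K + Cu)) atTop (𝓝 0) := by
      simpa using (tendsto_pow_atTop_nhds_zero_of_lt_one hθ0 hθ1).mul_const (K + Cu)
    obtain ⟨k, hk⟩ := (h1.eventually_lt_const (half_pos ha)).exists
    filter_upwards [(hstep k x).eventually_lt_const (half_pos ha)] with n hn
    have := le_max_left (‖gradient (un n) x - gradient u x‖ - θ ^ k * (K + Cu)) 0
    linarith
  refine ⟨?_, hgrad x⟩
  -- The case `c = 0` of `hexc`, available now that the gradients converge.
  have hφ0 : ∀ᵐ x ∂(invMeasure A), Tendsto (fun n => φ n x) atTop (𝓝 0) := by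
    filter_upwards [hexc 0 fun x => by
      have h1 := tendsto_iff_norm_sub_tendsto_zero.1 (hgrad x)
      refine h1.congr fun n => ?_
      rw [sub_zero, max_eq_left (norm_nonneg _)]] with x hx
    rw [tendsto_zero_iff_abs_tendsto_zero]
    refine hx.congr fun n => ?_
    rw [mul_zero, sub_zero, max_eq_left (abs_nonneg _)]
    rfl
  have h := hM.tendsto_integral_exp_mul_ouSemigroup hlam_pos (fun n => (hφb n).1) hE hφ0 x
  simp_rw [← hrep] at h
  simpa using h.add_const (u x)

end Convergence

end OU

theorem mainTheorem6
    {H : Type*} [NormedAddCommGroup H] [InnerProductSpace ℝ H] [CompleteSpace H]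
    [TopologicalSpace.SeparableSpace H] [MeasurableSpace H] [BorelSpace H]
    (A : H →ₗ.[ℝ] H) (hAsa : IsSelfAdjoint A) (hAneg : OU.IsNegDef A)
    (hAtr : ∃ δ : ℝ, 0 < δ ∧ δ < 1 ∧ OU.IsTraceClassNegPow A (1 - δ))
    (f : H → ℝ) (B : H → H) (fn : ℕ → H → ℝ) (Bn : ℕ → H → H) (M : ℝ)
    (hf : OU.IsBddBorel f) (hB : OU.IsBddBorel B)
    (hfn : ∀ n, OU.IsBddBorel (fn n)) (hBn : ∀ n, OU.IsBddBorel (Bn n))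
    (hf_lim : ∀ᵐ x ∂(OU.invMeasure A), Tendsto (fun n => fn n x) atTop (𝓝 (f x)))
    (hB_lim : ∀ᵐ x ∂(OU.invMeasure A), Tendsto (fun n => Bn n x) atTop (𝓝 (B x)))
    (hfM : ∀ n, OU.essNorm A (fn n) ≤ M) (hBM : ∀ n, OU.essNorm A (Bn n) ≤ M)
    (lam : ℝ) (hlam_pos : 0 < lam)
    (hlam : 4 * OU.essNorm A B ^ 2 * OU.gradConst A ^ 2 ≤ lam)
    (u : H → ℝ) (un : ℕ → H → ℝ)
    (hu : OU.IsKolmogorovSolution A lam B f u)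
    (hun : ∀ n, OU.IsKolmogorovSolution A lam (Bn n) (fn n) (un n)) :
    ∀ x : H, Tendsto (fun n => un n x) atTop (𝓝 (u x)) ∧
      Tendsto (fun n => gradient (un n) x) atTop (𝓝 (gradient u x)) := by
  have : SecondCountableTopology H := UniformSpace.secondCountable_of_separable H
  obtain ⟨δ, hδ0, hδ1, htr⟩ := hAtr
  obtain ⟨S, Γ, Qt, V, Q, hM⟩ :=
    OU.exists_isMehler hAsa hAneg (sub_pos.2 hδ1) (by linarith) htr
  exact hM.tendsto_of_solutions hf hB hfn hBn hf_lim hB_lim hfM hBM hlam_pos hlam hu hun
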